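/- Let $U$ be one of the following kernels on $\mathbb R^d$, with Fourier transform $\widehat U(k)$ for $k\ne 0$ (convention $\widehat f(k)=\int_{\mathbb R^d} f(x)e^{-ik\cdot x}\,dx$): - Coulomb, $d=2$: $U=\frac{1}{2\pi|x|}$, $\widehat U=\frac1{|k|}$; - Poisson: $U=-\frac1{2\pi}\ln|x|$ ($d=2$), $U=\frac1{4\pi|x|}$ ($d=3$), $\widehat U=\frac1{|k|^2}$; - biharmonic: $U=-\frac{|x|^2}{8\pi}(\ln|x|-1)$ ($d=2$), $U=\frac{|x|}{8\pi}$ ($d=3$), $\widehat U=-\frac1{|k|^4}$; - Yukawa, $\lambda>0$: $U=\frac1{2\pi}K_0(\lambda|x|)$ ($d=2$), $U=\frac{e^{-\lambda|x|}}{4\pi|x|}$ ($d=3$), $\widehat U=\frac1{|k|^2+\lambda^2}$; - dipole-dipole interaction, $d=3$, with unit vectors $a,b$: $U=\frac{3}{4\pi}\,\frac{a\cdot b-3(x\cdot a)(x\cdot b)/|x|^2}{|x|^3}$, $\widehat U=-a\cdot b+\frac{3(k\cdot a)(k\cdot b)}{|k|^2}$. Let $m\ge 0$ be an integer and let $\rho:\mathbb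 R^d\to\mathbb R$ be smooth and compactly supported with $\int\rho(x)x^\alpha dx=0$ for all $|\alpha|\le m$. Let $\varphi=U*\rho$ (for the dipole kernel, $\varphi=-(a\cdot b)\rho-3\,\frac1{4\pi|x|}*\partial_a\partial_b\rho$). For $L>0$ put $\Omega=[-L,L]^d$, and for an even integer $N>0$ put $h=2L/N$ and let $$\varphi_N(x)=\frac1{(2L)^d}\sum_{p\in\{-N/2,\dots,N/2-1\}^d}\widehat U(\nu_p)\,\widehat\rho(\nu_p)\,e^{i\nu_p\cdot x},\qquad \nu_p=\tfrac{\pi}{L}\bigl(p+\tfrac12(1,\dots,1)\bigr),$$ be the midpoint rule with dual mesh size $\pi/L$ on $[-\pi/h,\pi/h]^d$ for the Fourier integral $(2\pi)^{-d}\int\widehat U\,\widehat\rho\,e^{ik\cdot x}dk$. Let $\Omega_0=\operatorname{supp}\rho$ and $$M_L=\sum_{|\beta|=m+1}\ \max_{x\in\partial\Omega,\ y\in\Omega_0,\ s\in[0,1]}|\partial^\beta U(x-sy)|$$ (the maxima are read as suprema in $[0,\infty]$). Then there is a constant $c>0$, depending on $U,m,\rho$ but not on $L$ or $N$, such that for every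 $L>0$ with $\Omega_0\subset\Omega$: 1. $\sup_{x\in\Omega}|\varphi(x)-\varphi_N(x)|\le c\,M_L$ for all sufficiently large even $N$ (depending on $L$), that is, as soon as $h$ is small enough for the truncation of frequency space to be negligible; 2. for every even $N>0$, $\ \sup_{x\in\Omega}|\varphi(x)-\varphi_N(x)|\le c\,M_L+\frac1{(2L)^d}\sum_{p\in\mathbb Z^d\setminus\{-N/2,\dots,N/2-1\}^d}|\widehat U(\nu_p)\widehat\rho(\nu_p)|$. -/

import Mathlib

open MeasureTheory
open scoped ENNReal ContDiff

noncomputable section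

namespace FSMM

/-- Euclidean space of dimension `d`. -/
abbrev E (d : ℕ) : Type := EuclideanSpace ℝ (Fin d)

/-- The box `[-L, L]^d`. -/
def box (d : ℕ) (L : ℝ) : Set (E d) := {x | ∀ i, x i ∈ Set.Icc (-L) L}

/-- The monomial `x^α` of a multi-index `α`. -/
def monomial {d : ℕ} (α : Fin d → ℕ) (x : E d) : ℝ := ∏ i, x i ^ α i

/-- The moments of `ρ` vanish up to order `m`. -/
def VanishingMoments {d : ℕ} (m : ℕ) (ρ : E d → ℝ) : Prop :=
  ∀ α : Fin d → ℕ, ∑ i, α i ≤ m → ∫ x, ρ x * monomial α x = 0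

/-- The first partial derivative `∂_i f`. -/
def pderiv {d : ℕ} (i : Fin d) (f : E d → ℝ) : E d → ℝ :=
  fun x => lineDeriv ℝ f x (EuclideanSpace.single i 1)

/-- The partial derivative `∂^β f = ∂_1^{β_1} ⋯ ∂_d^{β_d} f` of a multi-index `β`. -/
def mderiv {d : ℕ} (β : Fin d → ℕ) (f : E d → ℝ) : E d → ℝ :=
  (List.finRange d).foldr (fun i g => (pderiv i)^[β i] g) f

/-- The multi-indices `β ∈ ℕ^d` with `|β| = n`. -/
def multiIndices (d n : ℕ) : Finset (Fin d → ℕ) := Finset.univ.piAntidiag n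

/-- The modified Bessel function of the second kind of order zero, for `r > 0`. -/
def besselK0 (r : ℝ) : ℝ := ∫ t in Set.Ioi (0 : ℝ), Real.exp (-(r * Real.cosh t))

/-- The convolution kernels, indexed by the space dimension. -/
inductive Kernel : ℕ → Type
  | coulomb2 : Kernel 2
  | poisson2 : Kernel 2
  | poisson3 : Kernel 3
  | biharmonic2 : Kernel 2
  | biharmonic3 : Kernel 3
  | yukawa2 (lam : ℝ) (hlam : 0 < lam) : Kernel 2
  | yukawa3 (lam : ℝ) (hlam : 0 < lam) : Kernel 3
  /-- The dipole-dipole interaction with dipole axes `a` and `b`. -/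
  | dipole3 (a b : E 3) (ha : ‖a‖ = 1) (hb : ‖b‖ = 1) : Kernel 3

/-- The kernel function `U(x)`, for `x ≠ 0`. -/
def Kernel.U : {d : ℕ} → Kernel d → E d → ℝ
  | _, .coulomb2, x => 1 / (2 * Real.pi * ‖x‖)
  | _, .poisson2, x => -(1 / (2 * Real.pi)) * Real.log ‖x‖
  | _, .poisson3, x => 1 / (4 * Real.pi * ‖x‖)
  | _, .biharmonic2, x => -(‖x‖ ^ 2 / (8 * Real.pi)) * (Real.log ‖x‖ - 1)
  | _, .biharmonic3, x => ‖x‖ / (8 * Real.pi)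
  | _, .yukawa2 lam _, x => 1 / (2 * Real.pi) * besselK0 (lam * ‖x‖)
  | _, .yukawa3 lam _, x => 1 / (4 * Real.pi * ‖x‖) * Real.exp (-(lam * ‖x‖))
  | _, .dipole3 a b _ _, x =>
      3 / (4 * Real.pi) * (inner ℝ a b - 3 * inner ℝ x a * inner ℝ x b / ‖x‖ ^ 2) / ‖x‖ ^ 3

/-- The Fourier transform `Û(k)` of the kernel, for `k ≠ 0`, with the convention
`f̂(k) = ∫ f(x) e^{-i k·x} dx`; it is the reciprocal of the Fourier multiplier of `√(-Δ)`, `-Δ`,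
`-Δ²`, `-Δ + λ²` in the Coulomb, Poisson, biharmonic and Yukawa case. -/
def Kernel.symbol : {d : ℕ} → Kernel d → E d → ℝ
  | _, .coulomb2, k => 1 / ‖k‖
  | _, .poisson2, k => 1 / ‖k‖ ^ 2
  | _, .poisson3, k => 1 / ‖k‖ ^ 2
  | _, .biharmonic2, k => -(1 / ‖k‖ ^ 4)
  | _, .biharmonic3, k => -(1 / ‖k‖ ^ 4)
  | _, .yukawa2 lam _, k => 1 / (‖k‖ ^ 2 + lam ^ 2)
  | _, .yukawa3 lam _, k => 1 / (‖k‖ ^ 2 + lam ^ 2)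
  | _, .dipole3 a b _ _, k => -inner ℝ a b + 3 * inner ℝ k a * inner ℝ k b / ‖k‖ ^ 2

/-- The convolution `(U ∗ ρ)(x) = ∫ U(x - y) ρ(y) dy`. -/
def conv {d : ℕ} (U ρ : E d → ℝ) (x : E d) : ℝ := ∫ y, U (x - y) * ρ y

/-- The potential `φ = U ∗ ρ`. The dipole kernel is not locally integrable at the origin, and its
potential is `φ = -(a·b) ρ - 3 (1 / (4π|x|)) ∗ (∂_a ∂_b ρ)`. -/
def Kernel.potential : {d : ℕ} → Kernel d → (E d → ℝ) → E d → ℝ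
  | _, .dipole3 a b _ _, ρ, x =>
      -inner ℝ a b * ρ x -
        3 * conv Kernel.poisson3.U (fun y => lineDeriv ℝ (fun z => lineDeriv ℝ ρ z b) y a) x
  | _, K, ρ, x => conv K.U ρ x

/-- The Fourier transform `ρ̂(k) = ∫ ρ(x) e^{-i k·x} dx`. -/
def fourier {d : ℕ} (ρ : E d → ℝ) (k : E d) : ℂ :=
  ∫ x, (ρ x : ℂ) * Complex.exp (-(Complex.I * (inner ℝ k x : ℝ)))

/-- The midpoint `ν_{p+1/2} = (π / L) (p + 1/2)` of a cell of the dual mesh. -/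
def node {d : ℕ} (L : ℝ) (p : Fin d → ℤ) : E d :=
  WithLp.toLp 2 fun i => Real.pi / L * ((p i : ℝ) + 1 / 2)

/-- The indices `p ∈ ℤ^d` with `-N/2 ≤ p_i ≤ N/2 - 1` (for even `N`). With `h = 2L/N`, the cells
of these indices make up the box `[-π/h, π/h]^d`. -/
def indices (d N : ℕ) : Finset (Fin d → ℤ) :=
  Fintype.piFinset fun _ => Finset.Ico (-((N / 2 : ℕ) : ℤ)) ((N / 2 : ℕ) : ℤ)

/-- The midpoint-rule approximation with `N` points per direction and dual mesh size `π / L`,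
`φ_N(x) = (2L)^{-d} ∑_p Û(ν_{p+1/2}) ρ̂(ν_{p+1/2}) e^{i ν_{p+1/2}·x}`. -/
def Kernel.midpoint {d : ℕ} (K : Kernel d) (ρ : E d → ℝ) (L : ℝ) (N : ℕ) (x : E d) : ℂ :=
  1 / (2 * (L : ℂ)) ^ d * ∑ p ∈ indices d N,
    (K.symbol (node L p) : ℂ) * fourier ρ (node L p) *
      Complex.exp (Complex.I * (inner ℝ (node L p) x : ℝ))

/-- The part of the midpoint rule on the whole frequency space that `φ_N` leaves out,
`(2L)^{-d} ∑ |Û(ν_{p+1/2}) ρ̂(ν_{p+1/2})|` over the nodes outside `[-π/h, π/h]^d`. -/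
def Kernel.tail {d : ℕ} (K : Kernel d) (ρ : E d → ℝ) (L : ℝ) (N : ℕ) : ℝ≥0∞ :=
  ENNReal.ofReal (1 / (2 * L) ^ d) * ∑' p : {p : Fin d → ℤ // p ∉ indices d N},
    ‖(K.symbol (node L p.1) : ℂ) * fourier ρ (node L p.1)‖ₑ

/-- The error `‖φ - φ_N‖_{∞(Ω)}` on the box `Ω = [-L, L]^d`. -/
def Kernel.error {d : ℕ} (K : Kernel d) (ρ : E d → ℝ) (L : ℝ) (N : ℕ) : ℝ≥0∞ :=
  ⨆ x ∈ box d L, ‖(K.potential ρ x : ℂ) - K.midpoint ρ L N x‖ₑ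

/-- The quantity `∑_{|β| = m+1} max |∂^β U(x - s y)|`, the maximum being over `x ∈ ∂Ω`,
`y ∈ supp ρ`, `0 ≤ s ≤ 1`, with `Ω = [-L, L]^d` (as a supremum in `[0, ∞]`). -/
def Kernel.farField {d : ℕ} (K : Kernel d) (m : ℕ) (ρ : E d → ℝ) (L : ℝ) : ℝ≥0∞ :=
  ∑ β ∈ multiIndices d (m + 1),
    ⨆ x ∈ frontier (box d L), ⨆ y ∈ tsupport ρ, ⨆ s ∈ Set.Icc (0 : ℝ) 1,
      ‖mderiv β K.U (x - s • y)‖ₑ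

end FSMM

end

noncomputable section

namespace FSMM

/-! ### Sums over lattices -/

lemma summable_norm_prod_pi_and_hasSum {ι : Type*} {d : ℕ} (f : Fin d → ι → ℂ)
    (hf : ∀ i, Summable fun n => ‖f i n‖) :
    Summable (fun n : Fin d → ι => ‖∏ i, f i (n i)‖) ∧
      HasSum (fun n : Fin d → ι => ∏ i, f i (n i)) (∏ i, ∑' n, f i n) := by
  induction d with
  | zero =>
    refine ⟨(hasSum_unique _).summable, ?_⟩
    simp
  | succ d ih =>
    obtain ⟨h1, h2⟩ := ih (fun i => f i.succ) (fun i => hf i.succ)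
    have key := (hf 0).mul_norm h1
    have hs := (hf 0).of_norm.hasSum.mul h2 key.of_norm
    constructor
    · rw [← (Fin.consEquiv (fun _ : Fin (d + 1) => ι)).summable_iff]
      refine key.congr fun p => ?_
      simp [Fin.prod_univ_succ, Fin.consEquiv]
    · rw [← (Fin.consEquiv (fun _ : Fin (d + 1) => ι)).hasSum_iff, Fin.prod_univ_succ]
      refine hs.congr_fun ?_
      intro p
      simp [Fin.prod_univ_succ, Fin.consEquiv]

lemma summable_prod_pi {ι : Type*} {d : ℕ} (f : Fin d → ι → ℝ) (hf : ∀ i, Summable (f i))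
    (h0 : ∀ i n, 0 ≤ f i n) : Summable (fun n : Fin d → ι => ∏ i, f i (n i)) := by
  have := (summable_norm_prod_pi_and_hasSum (fun i n => (f i n : ℂ)) (fun i => by
    simpa [abs_of_nonneg (h0 i _)] using hf i)).1
  refine this.congr fun n => ?_
  rw [norm_prod]
  exact Finset.prod_congr rfl fun i _ => by simp [abs_of_nonneg (h0 i _)]

lemma summable_one_add_norm_inv_pow {d K : ℕ} (hd : 0 < d) (hK : d < K) :
    Summable (fun n : Fin d → ℤ => ((1 + ‖n‖) ^ K)⁻¹) := by
  have hd' : (0 : ℝ) < d := by exact_mod_cast hd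
  have hs : (1 : ℝ) < (K : ℝ) / d := by
    rw [lt_div_iff₀ hd', one_mul]; exact_mod_cast hK
  have h1 : Summable (fun n : ℤ => (1 + |(n : ℝ)|) ^ (-((K : ℝ) / d))) := by
    refine Summable.of_norm_bounded_eventually (Real.summable_abs_int_rpow hs) ?_
    have : ({0} : Set ℤ)ᶜ ∈ Filter.cofinite := (Set.finite_singleton 0).compl_mem_cofinite
    filter_upwards [this] with n hn
    have hn0 : (0 : ℝ) < |(n : ℝ)| := by
      have : n ≠ 0 := hn
      positivity
    rw [Real.norm_of_nonneg (by positivity)]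
    exact Real.rpow_le_rpow_of_nonpos hn0 (by linarith) (by linarith)
  refine Summable.of_nonneg_of_le (fun n => by positivity) (fun n => ?_)
    (summable_prod_pi (d := d) (fun _ (n : ℤ) => (1 + |(n : ℝ)|) ^ (-((K : ℝ) / d))) (fun _ => h1)
      fun _ _ => by positivity)
  have : ((1 + ‖n‖) ^ K)⁻¹ = ∏ _i : Fin d, (1 + ‖n‖) ^ (-((K : ℝ) / d)) := by
    rw [Finset.prod_const, Finset.card_univ, Fintype.card_fin, ← Real.rpow_natCast (_ ^ _),
      ← Real.rpow_mul (by positivity), neg_mul, div_mul_cancel₀ _ hd'.ne', Real.rpow_neg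
      (by positivity), Real.rpow_natCast]
  rw [this]
  refine Finset.prod_le_prod (fun _ _ => by positivity) fun i _ => ?_
  have hi : |(n i : ℝ)| ≤ ‖n‖ := by
    have := norm_le_pi_norm n i
    rwa [Int.norm_eq_abs] at this
  refine Real.rpow_le_rpow_of_nonpos (by positivity) (by linarith) ?_
  have : 0 < (K : ℝ) / d := by linarith
  linarith

lemma summable_exp_neg_mul_add_sq {a : ℝ} (ha : 0 < a) (b : ℝ) :
    Summable (fun n : ℤ => Real.exp (-(a * (n + b) ^ 2))) := by
  have h := (Real.summable_one_div_int_add_rpow b 2).2 one_lt_two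
  refine Summable.of_norm_bounded_eventually (h.mul_left a⁻¹) ?_
  have hfin : {n : ℤ | (n : ℝ) + b = 0}.Finite := by
    refine Set.Subsingleton.finite fun n hn m hm => ?_
    have : (n : ℝ) = m := by
      have h1 : (n : ℝ) + b = 0 := hn
      have h2 : (m : ℝ) + b = 0 := hm
      linarith
    exact_mod_cast this
  filter_upwards [hfin.compl_mem_cofinite] with n hn
  have hn0 : (n : ℝ) + b ≠ 0 := hn
  have hy : 0 < a * ((n : ℝ) + b) ^ 2 := by positivity
  rw [Real.norm_of_nonneg (Real.exp_pos _).le, Real.exp_neg]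
  have e : a⁻¹ * (1 / |(n : ℝ) + b| ^ (2 : ℝ)) = (a * ((n : ℝ) + b) ^ 2)⁻¹ := by
    rw [Real.rpow_two, sq_abs]; field_simp
  rw [e]
  exact inv_anti₀ hy (by linarith [Real.add_one_le_exp (a * ((n : ℝ) + b) ^ 2)])

/-- The alternating periodization of the one-dimensional heat kernel. -/
lemma tsum_alternating_heat_kernel {L t : ℝ} (hL : 0 < L) (ht : 0 < t) (x : ℝ) :
    ∑' n : ℤ, (-1 : ℂ) ^ n *
        (((√(4 * Real.pi * t))⁻¹ * Real.exp (-((x + 2 * L * n) ^ 2 / (4 * t))) : ℝ) : ℂ) =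
      1 / (2 * (L : ℂ)) * ∑' p : ℤ,
        ((Real.exp (-(t * (Real.pi / L * (p + 1 / 2)) ^ 2)) : ℝ) : ℂ) *
          Complex.exp (Complex.I * ((Real.pi / L * (p + 1 / 2) * x : ℝ) : ℂ)) := by
  have hpi := Real.pi_pos
  set a : ℝ := t * Real.pi / L ^ 2 with ha_def
  have ha : 0 < a := by positivity
  set b : ℂ := -(t * Real.pi / (2 * L ^ 2)) + Complex.I * x / (2 * L) with hb
  have hLc : (L : ℂ) ≠ 0 := by exact_mod_cast hL.ne'
  have htc : (t : ℂ) ≠ 0 := by exact_mod_cast ht.ne'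
  have hpc : (Real.pi : ℂ) ≠ 0 := by exact_mod_cast hpi.ne'
  have key := Complex.tsum_exp_neg_quadratic (a := (a : ℂ)) (by simpa using ha) b
  set c : ℂ := Complex.exp (-(t * Real.pi ^ 2 / (4 * L ^ 2)) + Complex.I * Real.pi * x / (2 * L))
    with hc
  have hl : ∀ p : ℤ, ((Real.exp (-(t * (Real.pi / L * (p + 1 / 2)) ^ 2)) : ℝ) : ℂ) *
          Complex.exp (Complex.I * ((Real.pi / L * (p + 1 / 2) * x : ℝ) : ℂ)) =
      c * Complex.exp (-Real.pi * a * p ^ 2 + 2 * Real.pi * b * p) := by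
    intro p
    rw [hc, Complex.ofReal_exp, ← Complex.exp_add, ← Complex.exp_add, ha_def, hb]
    congr 1
    push_cast
    field_simp
    ring
  have hr : ∀ n : ℤ, (-1 : ℂ) ^ n *
        (((√(4 * Real.pi * t))⁻¹ * Real.exp (-((x + 2 * L * n) ^ 2 / (4 * t))) : ℝ) : ℂ) =
      ((√(4 * Real.pi * t))⁻¹ : ℝ) * (c * Complex.exp (-Real.pi / a *
        (((-n : ℤ) : ℂ) + Complex.I * b) ^ 2)) := by
    intro n
    have h1 : (-1 : ℂ) ^ n = Complex.exp (-(Complex.I * Real.pi * n)) := by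
      have : (-1 : ℂ) = Complex.exp (-(Complex.I * Real.pi)) := by
        rw [mul_comm, Complex.exp_neg, Complex.exp_pi_mul_I]; norm_num
      rw [this, ← Complex.exp_int_mul]
      congr 1
      ring
    rw [hc, h1, Complex.ofReal_mul, Complex.ofReal_exp, ← Complex.exp_add, mul_left_comm,
      ← Complex.exp_add, ha_def, hb]
    congr 2
    push_cast
    field_simp
    ring_nf
    simp only [Complex.I_sq, Complex.I_pow_three, Complex.I_pow_four]
    ring_nf
  simp_rw [hl, hr]
  rw [tsum_mul_left, tsum_mul_left, tsum_mul_left, key]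
  have hneg := (Equiv.neg ℤ).tsum_eq (fun n : ℤ => Complex.exp (-Real.pi / a *
        ((n : ℂ) + Complex.I * b) ^ 2))
  simp only [Equiv.neg_apply] at hneg
  rw [hneg]
  have hroot : (((√(4 * Real.pi * t))⁻¹ : ℝ) : ℂ) = 1 / (2 * (L : ℂ)) * (1 / (a : ℂ) ^ (1 / 2 : ℂ)) := by
    have h2 : (a : ℂ) ^ (1 / 2 : ℂ) = ((√a : ℝ) : ℂ) := by
      rw [Real.sqrt_eq_rpow, Complex.ofReal_cpow ha.le]; norm_num
    have h3 : √(4 * Real.pi * t) = 2 * L * √a := by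
      have : 4 * Real.pi * t = (2 * L) ^ 2 * a := by rw [ha_def]; field_simp; ring
      rw [this, Real.sqrt_mul (by positivity), Real.sqrt_sq (by positivity)]
    rw [h2, h3]
    push_cast
    field_simp
  rw [hroot]
  ring

variable {d : ℕ}

/-! ### The heat kernel and its alternating periodization -/

/-- The heat kernel `(4πt)^{-d/2} e^{-|z|²/4t}`. -/
def heat {d : ℕ} (t : ℝ) (z : E d) : ℝ :=
  (√(4 * Real.pi * t))⁻¹ ^ d * Real.exp (-(‖z‖ ^ 2 / (4 * t)))

/-- The vector `2Ln` of the lattice of periods. -/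
def period {d : ℕ} (L : ℝ) (n : Fin d → ℤ) : E d := WithLp.toLp 2 fun i => 2 * L * (n i : ℝ)

/-- The sign `(-1)^{n_1 + ⋯ + n_d}`. -/
def altSign {d : ℕ} (n : Fin d → ℤ) : ℂ := ∏ i, (-1 : ℂ) ^ n i

/-- The alternating sum of the translates of the potential `heat t * ρ`. -/
def theta {d : ℕ} (ρ : E d → ℝ) (L t : ℝ) (x : E d) : ℂ :=
  ∑' n : Fin d → ℤ, altSign n * (conv (heat t) ρ (x + period L n) : ℂ)


lemma norm_altSign (n : Fin d → ℤ) : ‖altSign n‖ = 1 := by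
  simp [altSign, norm_prod]

lemma altSign_zero : altSign (0 : Fin d → ℤ) = 1 := by simp [altSign]

lemma period_zero (L : ℝ) : period L (0 : Fin d → ℤ) = 0 := by
  ext i; simp [period]

@[fun_prop]
lemma continuous_heat (t : ℝ) : Continuous (heat t : E d → ℝ) := by
  unfold heat; fun_prop

lemma heat_nonneg (t : ℝ) (z : E d) : 0 ≤ heat t z := by
  unfold heat; positivity

lemma heat_le {t : ℝ} (ht : 0 < t) (z : E d) : heat t z ≤ (√(4 * Real.pi * t))⁻¹ ^ d := by
  unfold heat
  refine mul_le_of_le_one_right (by positivity) (Real.exp_le_one_iff.2 ?_)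
  have : 0 ≤ ‖z‖ ^ 2 / (4 * t) := by positivity
  linarith

lemma heat_eq_prod (t : ℝ) (z : E d) :
    heat t z = ∏ i, (√(4 * Real.pi * t))⁻¹ * Real.exp (-(z i ^ 2 / (4 * t))) := by
  rw [Finset.prod_mul_distrib, ← Real.exp_sum, heat, EuclideanSpace.real_norm_sq_eq,
    Finset.prod_const, Finset.card_univ, Fintype.card_fin, Finset.sum_neg_distrib, Finset.sum_div]

lemma norm_node_sq (L : ℝ) (p : Fin d → ℤ) :
    ‖node L p‖ ^ 2 = ∑ i, (Real.pi / L * ((p i : ℝ) + 1 / 2)) ^ 2 := by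
  rw [EuclideanSpace.real_norm_sq_eq]; rfl

lemma inner_node (L : ℝ) (p : Fin d → ℤ) (z : E d) :
    inner ℝ (node L p) z = ∑ i, Real.pi / L * ((p i : ℝ) + 1 / 2) * z i := by
  simp [PiLp.inner_apply, node, mul_comm]

lemma norm_period_sq (L : ℝ) (n : Fin d → ℤ) :
    ‖period L n‖ ^ 2 = ∑ i, (2 * L * (n i : ℝ)) ^ 2 := by
  rw [EuclideanSpace.real_norm_sq_eq]; rfl

lemma summable_exp_neg_mul_norm_period_sq {L a : ℝ} (hL : 0 < L) (ha : 0 < a) :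
    Summable fun n : Fin d → ℤ => Real.exp (-(a * ‖period L n‖ ^ 2)) := by
  refine (summable_prod_pi (d := d) (fun _ (n : ℤ) => Real.exp (-(a * (2 * L) ^ 2 * (n + 0) ^ 2)))
    (fun _ => summable_exp_neg_mul_add_sq (by positivity) 0) fun _ _ => by positivity).congr ?_
  intro n
  rw [← Real.exp_sum, norm_period_sq, Finset.mul_sum, ← Finset.sum_neg_distrib]
  congr 1
  exact Finset.sum_congr rfl fun i _ => by ring

lemma summable_exp_neg_mul_norm_node_sq {L a : ℝ} (hL : 0 < L) (ha : 0 < a) :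
    Summable fun p : Fin d → ℤ => Real.exp (-(a * ‖node L p‖ ^ 2)) := by
  refine (summable_prod_pi (d := d)
    (fun _ (n : ℤ) => Real.exp (-(a * (Real.pi / L) ^ 2 * (n + 1 / 2) ^ 2)))
    (fun _ => summable_exp_neg_mul_add_sq (by have := Real.pi_pos; positivity) _)
    fun _ _ => by positivity).congr ?_
  intro n
  rw [← Real.exp_sum, norm_node_sq, Finset.mul_sum, ← Finset.sum_neg_distrib]
  congr 1
  exact Finset.sum_congr rfl fun i _ => by ring

lemma exists_hasSum_heat {L t : ℝ} (hL : 0 < L) (ht : 0 < t) (z : E d) :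
    ∃ S : ℂ, HasSum (fun n => altSign n * (heat t (z + period L n) : ℂ)) S ∧
      HasSum (fun p => 1 / (2 * (L : ℂ)) ^ d * ((Real.exp (-(t * ‖node L p‖ ^ 2)) : ℂ) *
        Complex.exp (Complex.I * (inner ℝ (node L p) z : ℝ)))) S := by
  have hpi := Real.pi_pos
  have h1 := summable_norm_prod_pi_and_hasSum (fun (i : Fin d) (n : ℤ) => (-1 : ℂ) ^ n *
        (((√(4 * Real.pi * t))⁻¹ * Real.exp (-((z i + 2 * L * n) ^ 2 / (4 * t))) : ℝ) : ℂ)) (by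
    intro i
    have := (summable_exp_neg_mul_add_sq (a := L ^ 2 / t) (by positivity) (z i / (2 * L))).mul_left
      ((√(4 * Real.pi * t))⁻¹)
    refine this.congr fun n => ?_
    simp only [norm_mul, norm_zpow, norm_neg, norm_one, one_zpow, one_mul, Complex.norm_real]
    rw [Real.norm_of_nonneg (by positivity), Real.norm_of_nonneg (by positivity)]
    congr 3
    field_simp
    ring)
  have h2 := summable_norm_prod_pi_and_hasSum (fun (i : Fin d) (p : ℤ) =>
        ((Real.exp (-(t * (Real.pi / L * (p + 1 / 2)) ^ 2)) : ℝ) : ℂ) *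
          Complex.exp (Complex.I * ((Real.pi / L * (p + 1 / 2) * z i : ℝ) : ℂ))) (by
    intro i
    have := summable_exp_neg_mul_add_sq (a := t * (Real.pi / L) ^ 2) (by positivity) (1 / 2)
    refine this.congr fun n => ?_
    rw [norm_mul, mul_comm Complex.I, Complex.norm_exp_ofReal_mul_I, mul_one, Complex.norm_real,
      Real.norm_of_nonneg (by positivity)]
    congr 2
    ring)
  refine ⟨_, h1.2.congr_fun ?_, ?_⟩
  · intro n
    rw [heat_eq_prod, altSign, Complex.ofReal_prod, ← Finset.prod_mul_distrib]
    rfl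
  · simp_rw [tsum_alternating_heat_kernel hL ht]
    rw [Finset.prod_mul_distrib, Finset.prod_const, Finset.card_univ, Fintype.card_fin,
      div_pow, one_pow]
    refine HasSum.mul_left _ (h2.2.congr_fun ?_)
    intro p
    rw [Finset.prod_mul_distrib, norm_node_sq, inner_node, ← Complex.exp_sum,
      ← Complex.ofReal_prod, ← Real.exp_sum]
    congr 2
    · rw [Finset.sum_neg_distrib, Finset.mul_sum]
    · push_cast
      rw [Finset.mul_sum]

lemma heat_add_period_le {t : ℝ} (ht : 0 < t) (z w : E d) {R : ℝ} (hz : ‖z‖ ≤ R) :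
    heat t (z + w) ≤ (√(4 * Real.pi * t))⁻¹ ^ d * Real.exp (R ^ 2 / (4 * t)) *
      Real.exp (-(1 / (8 * t) * ‖w‖ ^ 2)) := by
  rw [heat, mul_assoc (_ ^ d), ← Real.exp_add]
  refine mul_le_mul_of_nonneg_left (Real.exp_le_exp.2 ?_) (by positivity)
  have h1 : ‖w‖ ≤ ‖z + w‖ + ‖z‖ := by
    have := norm_sub_le (z + w) z
    simpa using this
  have h2 : ‖w‖ ^ 2 ≤ 2 * ‖z + w‖ ^ 2 + 2 * R ^ 2 := by
    have h0 := norm_nonneg w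
    have h3 := norm_nonneg z
    nlinarith [sq_nonneg (‖z + w‖ - ‖z‖), norm_nonneg (z + w)]
  have : R ^ 2 / (4 * t) + -(1 / (8 * t) * ‖w‖ ^ 2) - -(‖z + w‖ ^ 2 / (4 * t)) =
      (2 * ‖z + w‖ ^ 2 + 2 * R ^ 2 - ‖w‖ ^ 2) / (8 * t) := by field_simp; ring
  have h4 : 0 ≤ (2 * ‖z + w‖ ^ 2 + 2 * R ^ 2 - ‖w‖ ^ 2) / (8 * t) :=
    div_nonneg (by linarith) (by positivity)
  linarith

lemma exists_norm_le_of_hasCompactSupport {ρ : E d → ℝ} (hs : HasCompactSupport ρ) :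
    ∃ R : ℝ, 0 < R ∧ ∀ y, ρ y ≠ 0 → ‖y‖ ≤ R := by
  obtain ⟨R, hR⟩ := hs.isCompact.isBounded.exists_norm_le
  exact ⟨max R 1, by positivity, fun y hy => (hR y (subset_tsupport _ hy)).trans (le_max_left _ _)⟩

lemma hasSum_theta {ρ : E d → ℝ} (hc : Continuous ρ) (hs : HasCompactSupport ρ)
    {L t : ℝ} (hL : 0 < L) (ht : 0 < t) (x : E d) :
    HasSum (fun n => altSign n * (conv (heat t) ρ (x + period L n) : ℂ)) (theta ρ L t x) ∧
      HasSum (fun p => 1 / (2 * (L : ℂ)) ^ d * ((Real.exp (-(t * ‖node L p‖ ^ 2)) : ℂ) *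
        (fourier ρ (node L p) * Complex.exp (Complex.I * (inner ℝ (node L p) x : ℝ)))))
        (theta ρ L t x) := by
  obtain ⟨R, hR, hRρ⟩ := exists_norm_le_of_hasCompactSupport hs
  have hint : Integrable ρ := hc.integrable_of_hasCompactSupport hs
  choose S hS1 hS2 using fun y : E d => exists_hasSum_heat hL ht (x - y)
  have e1 : ∀ n : Fin d → ℤ, altSign n * (conv (heat t) ρ (x + period L n) : ℂ) =
      ∫ y, (ρ y : ℂ) * (altSign n * (heat t (x - y + period L n) : ℂ)) := by
    intro n
    rw [conv, ← integral_complex_ofReal, ← integral_const_mul]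
    refine integral_congr_ae (.of_forall fun y => ?_)
    simp only
    rw [show x + period L n - y = x - y + period L n by abel]
    push_cast
    ring
  have H1 : HasSum (fun n => altSign n * (conv (heat t) ρ (x + period L n) : ℂ))
      (∫ y, (ρ y : ℂ) * S y) := by
    simp_rw [e1]
    set C : ℝ := (√(4 * Real.pi * t))⁻¹ ^ d * Real.exp ((‖x‖ + R) ^ 2 / (4 * t)) with hC
    have hsum : Summable fun n : Fin d → ℤ => C * Real.exp (-(1 / (8 * t) * ‖period L n‖ ^ 2)) :=
      (summable_exp_neg_mul_norm_period_sq hL (by positivity)).mul_left C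
    refine hasSum_integral_of_dominated_convergence
      (fun n y => ‖ρ y‖ * (C * Real.exp (-(1 / (8 * t) * ‖period L n‖ ^ 2)))) ?_ ?_ ?_ ?_ ?_
    · intro n
      exact (by fun_prop : Continuous _).aestronglyMeasurable
    · intro n
      refine .of_forall fun y => ?_
      rw [norm_mul, norm_mul, norm_altSign, one_mul, Complex.norm_real, Complex.norm_real]
      by_cases hy : ρ y = 0
      · simp [hy]
      refine mul_le_mul_of_nonneg_left ?_ (norm_nonneg _)
      rw [Real.norm_of_nonneg (heat_nonneg _ _)]
      exact heat_add_period_le ht _ _ ((norm_sub_le _ _).trans (by linarith [hRρ y hy]))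
    · exact .of_forall fun y => hsum.mul_left _
    · simp_rw [tsum_mul_left]
      exact hint.norm.mul_const _
    · exact .of_forall fun y => (hS1 y).mul_left _
  have e2 : ∀ p : Fin d → ℤ, 1 / (2 * (L : ℂ)) ^ d * ((Real.exp (-(t * ‖node L p‖ ^ 2)) : ℂ) *
        (fourier ρ (node L p) * Complex.exp (Complex.I * (inner ℝ (node L p) x : ℝ)))) =
      ∫ y, (ρ y : ℂ) * (1 / (2 * (L : ℂ)) ^ d * ((Real.exp (-(t * ‖node L p‖ ^ 2)) : ℂ) *
        Complex.exp (Complex.I * (inner ℝ (node L p) (x - y) : ℝ)))) := by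
    intro p
    rw [fourier, ← integral_mul_const, ← integral_const_mul, ← integral_const_mul]
    refine integral_congr_ae (.of_forall fun y => ?_)
    simp only
    rw [inner_sub_right, Complex.ofReal_sub, mul_sub, sub_eq_add_neg, Complex.exp_add]
    ring
  have H2 : HasSum (fun p => 1 / (2 * (L : ℂ)) ^ d * ((Real.exp (-(t * ‖node L p‖ ^ 2)) : ℂ) *
        (fourier ρ (node L p) * Complex.exp (Complex.I * (inner ℝ (node L p) x : ℝ)))))
      (∫ y, (ρ y : ℂ) * S y) := by
    simp_rw [e2]
    set C : ℝ := ‖1 / (2 * (L : ℂ)) ^ d‖ with hC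
    have hsum : Summable fun p : Fin d → ℤ => C * Real.exp (-(t * ‖node L p‖ ^ 2)) :=
      (summable_exp_neg_mul_norm_node_sq hL ht).mul_left C
    refine hasSum_integral_of_dominated_convergence
      (fun p y => ‖ρ y‖ * (C * Real.exp (-(t * ‖node L p‖ ^ 2)))) ?_ ?_ ?_ ?_ ?_
    · intro n
      exact (by fun_prop : Continuous _).aestronglyMeasurable
    · intro p
      refine .of_forall fun y => ?_
      rw [norm_mul, norm_mul, norm_mul, Complex.norm_real, mul_comm Complex.I,
        Complex.norm_exp_ofReal_mul_I, mul_one, Complex.norm_real,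
        Real.norm_of_nonneg (Real.exp_pos _).le]
    · exact .of_forall fun y => hsum.mul_left _
    · simp_rw [tsum_mul_left]
      exact hint.norm.mul_const _
    · exact .of_forall fun y => (hS2 y).mul_left _
  have e : theta ρ L t x = ∫ y, (ρ y : ℂ) * S y := H1.tsum_eq
  rw [e]
  exact ⟨H1, H2⟩

/-! ### Vanishing moments and Taylor expansion -/

lemma prod_coord_eq_monomial {j : ℕ} (f : Fin j → Fin d) (y : E d) :
    ∏ i, y (f i) = monomial (fun c => (Finset.univ.filter fun i => f i = c).card) y := by
  rw [monomial, ← Finset.prod_fiberwise (s := Finset.univ) (g := f)]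
  refine Finset.prod_congr rfl fun c _ => ?_
  rw [Finset.prod_congr rfl (g := fun _ => y c), Finset.prod_const]
  intro i hi
  rw [(Finset.mem_filter.1 hi).2]

lemma multilinear_apply_eq_sum {j : ℕ} (M : ContinuousMultilinearMap ℝ (fun _ : Fin j => E d) ℝ)
    (y : E d) : M (fun _ => y) = ∑ f : Fin j → Fin d,
      (∏ i, y (f i)) * M (fun i => EuclideanSpace.single (f i) 1) := by
  have hy : y = ∑ c, y c • EuclideanSpace.single c (1 : ℝ) := by
    have := (EuclideanSpace.basisFun (Fin d) ℝ).sum_repr y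
    simpa using this.symm
  have h1 : M (fun _ => y) = M (fun _ => ∑ c, y c • EuclideanSpace.single c (1 : ℝ)) := by
    rw [← hy]
  rw [h1, ContinuousMultilinearMap.map_sum]
  exact Finset.sum_congr rfl fun f _ => by
    rw [ContinuousMultilinearMap.map_smul_univ, smul_eq_mul]

lemma continuous_monomial (α : Fin d → ℕ) : Continuous (monomial α : E d → ℝ) := by
  unfold monomial; fun_prop

lemma VanishingMoments.integral_multilinear {m : ℕ} {ρ : E d → ℝ} (hm : VanishingMoments m ρ)
    (hc : Continuous ρ) (hs : HasCompactSupport ρ) {j : ℕ} (hj : j ≤ m)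
    (M : ContinuousMultilinearMap ℝ (fun _ : Fin j => E d) ℝ) :
    ∫ y, ρ y * M (fun _ => y) = 0 := by
  simp_rw [multilinear_apply_eq_sum M, Finset.mul_sum, ← mul_assoc, prod_coord_eq_monomial]
  rw [integral_finsetSum]
  · refine Finset.sum_eq_zero fun f _ => ?_
    rw [integral_mul_const, hm _ (le_of_eq_of_le ?_ hj), zero_mul]
    rw [← Finset.card_eq_sum_card_fiberwise (s := Finset.univ) (f := f) (by simp)]
    simp
  · intro f _
    exact Integrable.mul_const ((hc.mul (continuous_monomial _)).integrable_of_hasCompactSupport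
      hs.mul_right) _

lemma iteratedDeriv_comp_line {g : E d → ℝ} (hg : ContDiff ℝ ∞ g) (a b : E d) (n : ℕ) (s : ℝ) :
    iteratedDeriv n (fun s : ℝ => g (a + s • b)) s =
      iteratedFDeriv ℝ n g (a + s • b) (fun _ => b) := by
  have h1 : (fun s : ℝ => g (a + s • b)) =
      (fun x => g (a + x)) ∘ (ContinuousLinearMap.toSpanSingleton ℝ b) := by
    ext s; simp
  have h2 : ContDiff ℝ ∞ (fun x => g (a + x)) := hg.comp (contDiff_const.add contDiff_id)
  rw [iteratedDeriv_eq_iteratedFDeriv, h1,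
    ContinuousLinearMap.iteratedFDeriv_comp_right _ h2 _ (by exact_mod_cast le_top),
    iteratedFDeriv_comp_add_left]
  simp

lemma exists_taylor_line {g : E d → ℝ} (hg : ContDiff ℝ ∞ g) (a b : E d) (m : ℕ) :
    ∃ s ∈ Set.Icc (0 : ℝ) 1,
      |g (a + b) - ∑ j ∈ Finset.range (m + 1),
        ((j.factorial : ℝ)⁻¹) * iteratedFDeriv ℝ j g a (fun _ => b)| ≤
      ‖iteratedFDeriv ℝ (m + 1) g (a + s • b)‖ * ‖b‖ ^ (m + 1) := by
  have hh : ContDiff ℝ ∞ (fun s : ℝ => g (a + s • b)) := by fun_prop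
  obtain ⟨s, hs, h⟩ := taylor_mean_remainder_lagrange_iteratedDeriv
    (f := fun s : ℝ => g (a + s • b)) (x := 1) (x₀ := 0) (n := m) zero_ne_one
    (hh.of_le (by exact_mod_cast le_top)).contDiffOn
  have hs' : s ∈ Set.Icc (0 : ℝ) 1 := by
    rw [Set.uIoo_of_le zero_le_one] at hs
    exact Set.Ioo_subset_Icc_self hs
  refine ⟨s, hs', ?_⟩
  have e : taylorWithinEval (fun s : ℝ => g (a + s • b)) m (Set.uIcc 0 1) 0 1 =
      ∑ j ∈ Finset.range (m + 1), ((j.factorial : ℝ)⁻¹) * iteratedFDeriv ℝ j g a (fun _ => b) := by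
    rw [taylor_within_apply]
    refine Finset.sum_congr rfl fun j _ => ?_
    rw [iteratedDerivWithin_eq_iteratedDeriv, iteratedDeriv_comp_line hg]
    · simp
    · rw [Set.uIcc_of_le zero_le_one]; exact uniqueDiffOn_Icc zero_lt_one
    · exact (hh.of_le (by exact_mod_cast le_top)).contDiffAt
    · simp
  rw [← e]
  simp only [one_smul] at h
  rw [h, iteratedDeriv_comp_line hg, sub_zero, one_pow, mul_one, abs_div, Nat.abs_cast]
  refine (div_le_self (abs_nonneg _) (by exact_mod_cast Nat.factorial_pos _)).trans ?_
  have := (iteratedFDeriv ℝ (m + 1) g (a + s • b)).le_opNorm (fun _ => b)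
  simpa using this

lemma VanishingMoments.abs_integral_le {m : ℕ} {ρ : E d → ℝ} (hm : VanishingMoments m ρ)
    (hc : Continuous ρ) (hs : HasCompactSupport ρ) {g : E d → ℝ} (hg : ContDiff ℝ ∞ g)
    (a : E d) (τ B : ℝ)
    (hB : ∀ y, ρ y ≠ 0 → ∀ s ∈ Set.Icc (0 : ℝ) 1,
      ‖iteratedFDeriv ℝ (m + 1) g (a + s • (τ • y))‖ * ‖τ • y‖ ^ (m + 1) ≤ B) :
    |∫ y, ρ y * g (a + τ • y)| ≤ B * ∫ y, |ρ y| := by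
  have hint : Integrable ρ := hc.integrable_of_hasCompactSupport hs
  have hM : ∀ j : ℕ, Continuous fun y : E d => iteratedFDeriv ℝ j g a (fun _ => τ • y) := fun j =>
    (iteratedFDeriv ℝ j g a).cont.comp (by fun_prop)
  have hgc := hg.continuous
  have hz : ∫ y, ρ y * ∑ j ∈ Finset.range (m + 1),
      ((j.factorial : ℝ)⁻¹) * iteratedFDeriv ℝ j g a (fun _ => τ • y) = 0 := by
    simp_rw [Finset.mul_sum]
    rw [integral_finsetSum]
    · refine Finset.sum_eq_zero fun j hj => ?_
      have hj' : j ≤ m := by simpa [Nat.lt_succ_iff] using hj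
      have : ∀ y : E d, ρ y * ((j.factorial : ℝ)⁻¹ * iteratedFDeriv ℝ j g a (fun _ => τ • y)) =
          ((j.factorial : ℝ)⁻¹ * τ ^ j) * (ρ y * iteratedFDeriv ℝ j g a (fun _ => y)) := by
        intro y
        have := (iteratedFDeriv ℝ j g a).map_smul_univ (fun _ => τ) (fun _ => y)
        simp only [Finset.prod_const, Finset.card_univ, Fintype.card_fin, smul_eq_mul] at this
        rw [this]; ring
      simp_rw [this]
      rw [integral_const_mul, hm.integral_multilinear hc hs hj', mul_zero]
    · intro j _
      exact (hc.mul (continuous_const.mul (hM j))).integrable_of_hasCompactSupport hs.mul_right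
  have hsub : ∫ y, ρ y * g (a + τ • y) = ∫ y, ρ y * (g (a + τ • y) -
      ∑ j ∈ Finset.range (m + 1),
        ((j.factorial : ℝ)⁻¹) * iteratedFDeriv ℝ j g a (fun _ => τ • y)) := by
    simp_rw [mul_sub]
    rw [integral_sub, hz, sub_zero]
    · exact (hc.mul (by fun_prop)).integrable_of_hasCompactSupport hs.mul_right
    · refine (hc.mul ?_).integrable_of_hasCompactSupport hs.mul_right
      exact continuous_finsetSum _ fun j _ => continuous_const.mul (hM j)
  rw [hsub, ← integral_const_mul]
  rw [← Real.norm_eq_abs]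
  refine norm_integral_le_of_norm_le (hint.abs.const_mul B) (.of_forall fun y => ?_)
  by_cases hy : ρ y = 0
  · simp [hy]
  obtain ⟨s, hs1, hs2⟩ := exists_taylor_line hg a (τ • y) m
  rw [norm_mul, mul_comm B, Real.norm_eq_abs, Real.norm_eq_abs]
  exact mul_le_mul_of_nonneg_left (hs2.trans (hB y hy s hs1)) (abs_nonneg _)

/-! ### Decay of the heat potential -/

lemma one_add_pow_mul_exp_le (K : ℕ) {x : ℝ} (hx : 0 ≤ x) :
    (1 + x) ^ K * Real.exp (-(x ^ 2 / 4)) ≤ K.factorial * Real.exp 2 := by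
  have h1 : (1 + x) ^ K / K.factorial ≤ Real.exp (1 + x) :=
    Real.pow_div_factorial_le_exp _ (by linarith) K
  have hf : (0 : ℝ) < K.factorial := by exact_mod_cast Nat.factorial_pos K
  rw [div_le_iff₀ hf] at h1
  calc (1 + x) ^ K * Real.exp (-(x ^ 2 / 4))
      ≤ Real.exp (1 + x) * K.factorial * Real.exp (-(x ^ 2 / 4)) := by gcongr
    _ = K.factorial * Real.exp (1 + x + -(x ^ 2 / 4)) := by rw [Real.exp_add (1 + x)]; ring
    _ ≤ K.factorial * Real.exp 2 := by
      gcongr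
      nlinarith [sq_nonneg (x - 2)]

lemma contDiff_gaussian : ContDiff ℝ ∞ (fun x : E d => Real.exp (-(‖x‖ ^ 2 / 4))) :=
  Real.contDiff_exp.comp (((contDiff_norm_sq ℝ).div_const _).neg)

lemma exists_gaussian_decay (k n : ℕ) : ∃ C : ℝ, 0 ≤ C ∧ ∀ x : E d,
    ‖x‖ ^ k * ‖iteratedFDeriv ℝ n (fun x : E d => Real.exp (-(‖x‖ ^ 2 / 4))) x‖ ≤ C := by
  have hT : Function.HasTemperateGrowth (fun x : E d => -(‖x‖ ^ 2 / 4)) := by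
    have h := (Function.HasTemperateGrowth.const (E := E d) (-(1 / 4) : ℝ)).mul
      (Function.hasTemperateGrowth_norm_sq (E d))
    have e : (fun x : E d => -(‖x‖ ^ 2 / 4)) = (fun _ => (-(1 / 4) : ℝ)) * fun x => ‖x‖ ^ 2 := by
      funext x
      simp only [Pi.mul_apply]
      ring
    rw [e]
    exact h
  obtain ⟨K, C, hC, h⟩ := hT.norm_iteratedFDeriv_le_uniform n
  refine ⟨n.factorial * (1 + C) ^ n * ((k + K * n).factorial * Real.exp 2), by positivity,
    fun x => ?_⟩
  have hb := norm_iteratedFDeriv_comp_le (g := Real.exp) (f := fun x : E d => -(‖x‖ ^ 2 / 4))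
    (n := n) (N := ∞) Real.contDiff_exp hT.1 (by exact_mod_cast le_top) x
    (C := Real.exp (-(‖x‖ ^ 2 / 4))) (D := (1 + C) * (1 + ‖x‖) ^ K) (by
      intro i _
      rw [norm_iteratedFDeriv_eq_norm_iteratedDeriv, iteratedDeriv_eq_iterate, Real.iter_deriv_exp,
        Real.norm_of_nonneg (Real.exp_pos _).le]) (by
      intro i hi1 hi2
      have h1 : (1 : ℝ) ≤ (1 + C) * (1 + ‖x‖) ^ K := by
        have : (1 : ℝ) ≤ (1 + ‖x‖) ^ K := one_le_pow₀ (by linarith [norm_nonneg x])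
        nlinarith
      refine (h i hi2 x).trans ((?_ : _ ≤ (1 + C) * (1 + ‖x‖) ^ K).trans
        (le_self_pow₀ h1 (by omega)))
      gcongr
      linarith)
  have hx := norm_nonneg x
  calc ‖x‖ ^ k * ‖iteratedFDeriv ℝ n (fun x : E d => Real.exp (-(‖x‖ ^ 2 / 4))) x‖
      ≤ (1 + ‖x‖) ^ k * (n.factorial * Real.exp (-(‖x‖ ^ 2 / 4)) *
        ((1 + C) * (1 + ‖x‖) ^ K) ^ n) := by
        gcongr
        · linarith
        · exact hb
    _ = n.factorial * (1 + C) ^ n * ((1 + ‖x‖) ^ (k + K * n) * Real.exp (-(‖x‖ ^ 2 / 4))) := by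
        rw [pow_add, pow_mul, mul_pow]; ring
    _ ≤ _ := by
        exact mul_le_mul_of_nonneg_left (one_add_pow_mul_exp_le _ hx) (by positivity)

lemma heat_eq_gaussian {t : ℝ} (ht : 0 < t) (z : E d) :
    heat t z = (√(4 * Real.pi * t))⁻¹ ^ d * Real.exp (-(‖(√t)⁻¹ • z‖ ^ 2 / 4)) := by
  rw [heat, norm_smul, mul_pow, norm_inv, inv_pow (‖√t‖), Real.norm_of_nonneg (Real.sqrt_nonneg _),
    Real.sq_sqrt ht.le]
  congr 3
  field_simp

lemma integral_heat {t : ℝ} (ht : 0 < t) : ∫ z : E d, heat t z = 1 := by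
  have hpi := Real.pi_pos
  have h := GaussianFourier.integral_rexp_neg_mul_sq_norm (V := E d) (b := 1 / (4 * t))
    (by positivity)
  have e : ∀ z : E d, heat t z = (√(4 * Real.pi * t))⁻¹ ^ d *
      Real.exp (-(1 / (4 * t)) * ‖z‖ ^ 2) := by
    intro z; rw [heat]; congr 2; ring
  simp_rw [e]
  rw [integral_const_mul, h, finrank_euclideanSpace, Fintype.card_fin,
    show Real.pi / (1 / (4 * t)) = 4 * Real.pi * t by field_simp,
    Real.sqrt_eq_rpow, ← Real.rpow_neg (by positivity), ← Real.rpow_natCast, ← Real.rpow_mul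
    (by positivity), ← Real.rpow_add (by positivity)]
  convert Real.rpow_zero _ using 2
  ring

lemma integrable_heat {t : ℝ} (ht : 0 < t) : Integrable (heat t : E d → ℝ) := by
  by_contra h
  have := integral_heat (d := d) ht
  rw [integral_undef h] at this
  exact zero_ne_one this

lemma integral_heat_mul_abs_le {ρ : E d → ℝ} {B : ℝ} (hB : ∀ y, |ρ y| ≤ B) {t : ℝ} (ht : 0 < t)
    (x : E d) : ∫ y, heat t (x - y) * |ρ y| ≤ B := by
  have h1 : Integrable fun y => heat t (x - y) := (integrable_heat ht).comp_sub_left x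
  calc ∫ y, heat t (x - y) * |ρ y| ≤ ∫ y, heat t (x - y) * B := by
        refine integral_mono_of_nonneg (.of_forall fun y => ?_) (h1.mul_const B)
          (.of_forall fun y => ?_)
        · exact mul_nonneg (heat_nonneg _ _) (abs_nonneg _)
        · exact mul_le_mul_of_nonneg_left (hB y) (heat_nonneg _ _)
    _ = B := by
        rw [integral_mul_const, integral_sub_left_eq_self (fun y => heat t y) volume x,
          integral_heat ht, one_mul]

lemma abs_conv_heat_le {ρ : E d → ℝ} {B : ℝ} (hB : ∀ y, |ρ y| ≤ B) {t : ℝ} (ht : 0 < t)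
    (x : E d) : |conv (heat t) ρ x| ≤ B := by
  refine le_trans ?_ (integral_heat_mul_abs_le hB ht x)
  rw [conv, ← Real.norm_eq_abs]
  refine (norm_integral_le_integral_norm _).trans (le_of_eq ?_)
  refine integral_congr_ae (.of_forall fun y => ?_)
  simp [abs_of_nonneg (heat_nonneg _ _)]

lemma VanishingMoments.exists_conv_heat_le {m : ℕ} {ρ : E d → ℝ} (hm : VanishingMoments m ρ)
    (hc : Continuous ρ) (hs : HasCompactSupport ρ) : ∃ C : ℝ, 0 ≤ C ∧ ∀ t : ℝ, 0 < t → ∀ z : E d,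
      |conv (heat t) ρ z| * ‖z‖ ^ (d + m + 1) ≤ C ∧
        |conv (heat t) ρ z| * √t ^ (d + m + 1) ≤ C := by
  have hpi := Real.pi_pos
  obtain ⟨R, hR, hRρ⟩ := exists_norm_le_of_hasCompactSupport hs
  obtain ⟨B, hB⟩ := hc.bounded_above_of_compact_support hs
  have hB0 : 0 ≤ B := (norm_nonneg _).trans (hB 0)
  obtain ⟨C0, hC0, h0⟩ := exists_gaussian_decay (d := d) 0 (m + 1)
  obtain ⟨C1, hC1, h1⟩ := exists_gaussian_decay (d := d) (d + m + 1) (m + 1)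
  set I : ℝ := ∫ y, |ρ y| with hI
  have hI0 : 0 ≤ I := integral_nonneg fun y => abs_nonneg _
  have key : ∀ t : ℝ, 0 < t → ∀ (z : E d) (D : ℝ),
      (∀ y, ρ y ≠ 0 → ∀ s ∈ Set.Icc (0 : ℝ) 1, ‖iteratedFDeriv ℝ (m + 1)
        (fun x : E d => Real.exp (-(‖x‖ ^ 2 / 4))) ((√t)⁻¹ • (z - s • y))‖ ≤ D) →
      |conv (heat t) ρ z| ≤ (√(4 * Real.pi))⁻¹ ^ d * (√t)⁻¹ ^ (d + m + 1) * (D * R ^ (m + 1) * I) := by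
    intro t ht z D hD
    have hst : 0 < √t := Real.sqrt_pos.2 ht
    have e : conv (heat t) ρ z = (√(4 * Real.pi * t))⁻¹ ^ d *
        ∫ y, ρ y * Real.exp (-(‖(√t)⁻¹ • z + (-(√t)⁻¹) • y‖ ^ 2 / 4)) := by
      rw [conv, ← integral_const_mul]
      refine integral_congr_ae (.of_forall fun y => ?_)
      simp only
      rw [heat_eq_gaussian ht, smul_sub, neg_smul, ← sub_eq_add_neg]
      ring
    have hb := hm.abs_integral_le hc hs contDiff_gaussian ((√t)⁻¹ • z) (-(√t)⁻¹)
      (D * ((√t)⁻¹ * R) ^ (m + 1)) (by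
        intro y hy s hs'
        have e2 : (√t)⁻¹ • z + s • (-(√t)⁻¹) • y = (√t)⁻¹ • (z - s • y) := by
          rw [smul_sub, neg_smul, smul_neg, smul_comm s, ← sub_eq_add_neg]
        rw [e2, norm_smul, norm_neg, norm_inv, Real.norm_of_nonneg hst.le]
        have := hD y hy s hs'
        have h3 : 0 ≤ D := (norm_nonneg _).trans this
        gcongr
        exact hRρ y hy)
    rw [e, abs_mul, abs_of_nonneg (by positivity), Real.sqrt_mul (by positivity)]
    refine (mul_le_mul_of_nonneg_left hb (by positivity)).trans (le_of_eq ?_)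
    rw [mul_inv, mul_pow, mul_pow, add_assoc, pow_add]
    ring
  refine ⟨max ((√(4 * Real.pi))⁻¹ ^ d * (C0 * R ^ (m + 1) * I))
    (max ((√(4 * Real.pi))⁻¹ ^ d * 2 ^ (d + m + 1) * (C1 * R ^ (m + 1) * I))
      (B * (2 * R) ^ (d + m + 1))), by positivity, fun t ht z => ⟨?_, ?_⟩⟩
  · refine le_trans ?_ (le_max_right _ _)
    by_cases hz : ‖z‖ < 2 * R
    · refine le_trans ?_ (le_max_right _ _)
      gcongr
      exact abs_conv_heat_le hB ht z
    · refine le_trans ?_ (le_max_left _ _)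
      push Not at hz
      have hz0 : 0 < ‖z‖ := by linarith
      have hst : 0 < √t := Real.sqrt_pos.2 ht
      have := key t ht z (C1 * (2 * √t / ‖z‖) ^ (d + m + 1)) (by
        intro y hy s hs'
        have h2 : ‖z‖ / (2 * √t) ≤ ‖(√t)⁻¹ • (z - s • y)‖ := by
          rw [norm_smul, norm_inv, Real.norm_of_nonneg hst.le, div_le_iff₀ (by positivity)]
          have h3 : ‖s • y‖ ≤ R := by
            rw [norm_smul, Real.norm_of_nonneg hs'.1]
            have := hRρ y hy
            nlinarith [hs'.2, norm_nonneg y, hs'.1]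
          have h4 := norm_sub_norm_le z (s • y)
          rw [show (√t)⁻¹ * ‖z - s • y‖ * (2 * √t) = 2 * ‖z - s • y‖ by field_simp]
          linarith
        have h5 := h1 ((√t)⁻¹ • (z - s • y))
        have h6 : (‖z‖ / (2 * √t)) ^ (d + m + 1) * ‖iteratedFDeriv ℝ (m + 1)
          (fun x : E d => Real.exp (-(‖x‖ ^ 2 / 4))) ((√t)⁻¹ • (z - s • y))‖ ≤ C1 :=
          le_trans (by gcongr) h5
        rw [show (2 * √t / ‖z‖) = (‖z‖ / (2 * √t))⁻¹ by rw [inv_div], inv_pow,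
          ← div_eq_mul_inv, le_div_iff₀ (by positivity), mul_comm]
        exact h6)
      calc |conv (heat t) ρ z| * ‖z‖ ^ (d + m + 1)
          ≤ ((√(4 * Real.pi))⁻¹ ^ d * (√t)⁻¹ ^ (d + m + 1) *
            (C1 * (2 * √t / ‖z‖) ^ (d + m + 1) * R ^ (m + 1) * I)) * ‖z‖ ^ (d + m + 1) := by gcongr
        _ = (√(4 * Real.pi))⁻¹ ^ d * ((√t)⁻¹ * (2 * √t / ‖z‖) * ‖z‖) ^ (d + m + 1) *
            (C1 * R ^ (m + 1) * I) := by rw [mul_pow, mul_pow]; ring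
        _ = _ := by
            rw [show (√t)⁻¹ * (2 * √t / ‖z‖) * ‖z‖ = 2 by field_simp]
  · refine le_trans ?_ (le_max_left _ _)
    have hst : 0 < √t := Real.sqrt_pos.2 ht
    have := key t ht z C0 (fun y _ s _ => by simpa using h0 ((√t)⁻¹ • (z - s • y)))
    calc |conv (heat t) ρ z| * √t ^ (d + m + 1)
        ≤ ((√(4 * Real.pi))⁻¹ ^ d * (√t)⁻¹ ^ (d + m + 1) * (C0 * R ^ (m + 1) * I)) *
          √t ^ (d + m + 1) := by gcongr
      _ = (√(4 * Real.pi))⁻¹ ^ d * ((√t)⁻¹ * √t) ^ (d + m + 1) * (C0 * R ^ (m + 1) * I) := by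
          rw [mul_pow]; ring
      _ = _ := by rw [inv_mul_cancel₀ hst.ne', one_pow, mul_one]

/-! ### The Fourier transform of the density at the nodes -/

lemma norm_fourier_le (ρ : E d → ℝ) (k : E d) : ‖fourier ρ k‖ ≤ ∫ y, |ρ y| := by
  rw [fourier]
  refine (norm_integral_le_integral_norm _).trans (le_of_eq ?_)
  refine integral_congr_ae (.of_forall fun y => ?_)
  simp only
  rw [norm_mul, mul_comm Complex.I, ← neg_mul, ← Complex.ofReal_neg, Complex.norm_exp_ofReal_mul_I,
    mul_one, Complex.norm_real, Real.norm_eq_abs]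

lemma VanishingMoments.integral_inner_pow {m : ℕ} {ρ : E d → ℝ} (hm : VanishingMoments m ρ)
    (hc : Continuous ρ) (hs : HasCompactSupport ρ) {j : ℕ} (hj : j ≤ m) (k : E d) :
    ∫ y, ρ y * inner ℝ k y ^ j = 0 := by
  have := hm.integral_multilinear hc hs hj
    ((ContinuousMultilinearMap.mkPiAlgebra ℝ (Fin j) ℝ).compContinuousLinearMap
      (fun _ => innerSL ℝ k))
  simpa using this

lemma VanishingMoments.exists_fourier_le {m : ℕ} {ρ : E d → ℝ} (hm : VanishingMoments m ρ)
    (hc : Continuous ρ) (hs : HasCompactSupport ρ) :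
    ∃ C : ℝ, 0 ≤ C ∧ ∀ k, ‖fourier ρ k‖ ≤ C * ‖k‖ ^ (m + 1) := by
  obtain ⟨R, hR, hRρ⟩ := exists_norm_le_of_hasCompactSupport hs
  have hint : Integrable ρ := hc.integrable_of_hasCompactSupport hs
  set I : ℝ := ∫ y, |ρ y| with hI
  have hI0 : 0 ≤ I := integral_nonneg fun y => abs_nonneg _
  refine ⟨max I (R ^ (m + 1) * Real.exp R * I), by positivity, fun k => ?_⟩
  rcases le_or_gt 1 ‖k‖ with hk | hk
  · refine (norm_fourier_le ρ k).trans ?_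
    have h1 : (1 : ℝ) ≤ ‖k‖ ^ (m + 1) := one_le_pow₀ hk
    calc I ≤ max I (R ^ (m + 1) * Real.exp R * I) * 1 := by rw [mul_one]; exact le_max_left _ _
      _ ≤ _ := by gcongr
  · have hz : ∫ y, (ρ y : ℂ) * ∑ j ∈ Finset.range (m + 1),
        (-(Complex.I * (inner ℝ k y : ℝ))) ^ j / (j.factorial : ℂ) = 0 := by
      simp_rw [Finset.mul_sum]
      rw [integral_finsetSum]
      · refine Finset.sum_eq_zero fun j hj => ?_
        have hj' : j ≤ m := by simpa [Nat.lt_succ_iff] using hj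
        have : ∀ y : E d, (ρ y : ℂ) * ((-(Complex.I * (inner ℝ k y : ℝ))) ^ j / (j.factorial : ℂ)) =
            ((-Complex.I) ^ j / (j.factorial : ℂ)) * ((ρ y * inner ℝ k y ^ j : ℝ) : ℂ) := by
          intro y
          rw [← neg_mul, mul_pow]
          push_cast
          ring
        simp_rw [this]
        rw [integral_const_mul, integral_complex_ofReal, hm.integral_inner_pow hc hs hj']
        simp
      · intro j _
        refine Continuous.integrable_of_hasCompactSupport (by fun_prop) ?_
        exact (hs.comp_left Complex.ofReal_zero).mul_right
    have hsub : fourier ρ k = ∫ y, (ρ y : ℂ) * (Complex.exp (-(Complex.I * (inner ℝ k y : ℝ))) -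
        ∑ j ∈ Finset.range (m + 1),
          (-(Complex.I * (inner ℝ k y : ℝ))) ^ j / (j.factorial : ℂ)) := by
      simp_rw [mul_sub]
      rw [integral_sub, hz, sub_zero, fourier]
      · refine Continuous.integrable_of_hasCompactSupport (by fun_prop) ?_
        exact (hs.comp_left Complex.ofReal_zero).mul_right
      · refine Continuous.integrable_of_hasCompactSupport (by fun_prop) ?_
        exact (hs.comp_left Complex.ofReal_zero).mul_right
    rw [hsub]
    refine (norm_integral_le_of_norm_le
      (hint.abs.const_mul ((‖k‖ * R) ^ (m + 1) * Real.exp R)) (.of_forall fun y => ?_)).trans ?_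
    · by_cases hy : ρ y = 0
      · simp [hy]
      rw [norm_mul, Complex.norm_real, mul_comm, Real.norm_eq_abs]
      refine mul_le_mul_of_nonneg_right ?_ (abs_nonneg _)
      refine (Complex.norm_exp_sub_sum_le_norm_mul_exp _ _).trans ?_
      have h1 : ‖-(Complex.I * ((inner ℝ k y : ℝ) : ℂ))‖ ≤ ‖k‖ * R := by
        rw [norm_neg, norm_mul, Complex.norm_I, one_mul, Complex.norm_real]
        refine (norm_inner_le_norm k y).trans ?_
        gcongr
        exact hRρ y hy
      gcongr
      nlinarith
    · rw [integral_const_mul]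
      calc (‖k‖ * R) ^ (m + 1) * Real.exp R * I = (R ^ (m + 1) * Real.exp R * I) * ‖k‖ ^ (m + 1) := by
            rw [mul_pow]; ring
        _ ≤ _ := by gcongr; exact le_max_right _ _

lemma exists_fourier_decay {ρ : E d → ℝ} (hρ : ContDiff ℝ ∞ ρ) (hs : HasCompactSupport ρ) (K : ℕ) :
    ∃ C : ℝ, 0 ≤ C ∧ ∀ k, ‖fourier ρ k‖ * ‖k‖ ^ K ≤ C := by
  have hpi := Real.pi_pos
  have hs' : HasCompactSupport (fun x => (ρ x : ℂ)) := hs.comp_left Complex.ofReal_zero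
  have hρ' : ContDiff ℝ ∞ (fun x => (ρ x : ℂ)) := Complex.ofRealCLM.contDiff.comp hρ
  set f : SchwartzMap (E d) ℂ := hs'.toSchwartzMap hρ' with hf
  obtain ⟨C, hC⟩ := (FourierTransform.fourier f : SchwartzMap (E d) ℂ).decay K 0
  have e : ∀ k : E d, fourier ρ k = (FourierTransform.fourier f : SchwartzMap (E d) ℂ)
      ((2 * Real.pi)⁻¹ • k) := by
    intro k
    rw [SchwartzMap.fourier_coe, Real.fourier_eq', fourier]
    refine integral_congr_ae (.of_forall fun y => ?_)
    simp only
    rw [smul_eq_mul, mul_comm, inner_smul_right, real_inner_comm]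
    congr 2
    push_cast
    field_simp
  refine ⟨(2 * Real.pi) ^ K * C, mul_nonneg (by positivity) hC.1.le, fun k => ?_⟩
  have h := hC.2 ((2 * Real.pi)⁻¹ • k)
  rw [norm_iteratedFDeriv_zero, ← e, norm_smul, norm_inv, Real.norm_of_nonneg (by positivity),
    mul_pow, inv_pow, mul_assoc, inv_mul_le_iff₀ (by positivity)] at h
  linarith

/-! ### Nodes and periods -/

lemma norm_node_ge {L : ℝ} (hL : 0 < L) (hd : 0 < d) (p : Fin d → ℤ) :
    1 / L ≤ ‖node L p‖ ∧ (1 + ‖p‖) / 2 ≤ L * ‖node L p‖ := by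
  have hpi := Real.pi_gt_three
  have habs : ∀ n : ℤ, 1 / 2 ≤ |(n : ℝ) + 1 / 2| ∧ |(n : ℝ)| / 2 ≤ |(n : ℝ) + 1 / 2| := by
    intro n
    rcases le_or_gt 0 n with hn | hn
    · have : (0 : ℝ) ≤ n := by exact_mod_cast hn
      rw [abs_of_nonneg this, abs_of_nonneg (by linarith)]
      constructor <;> linarith
    · have : (n : ℝ) ≤ -1 := by exact_mod_cast Int.le_sub_one_of_lt hn
      rw [abs_of_nonpos (by linarith), abs_of_nonpos (by linarith)]
      constructor <;> linarith
  have hcoord : ∀ i, Real.pi * |(p i : ℝ) + 1 / 2| ≤ L * ‖node L p‖ := by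
    intro i
    have := PiLp.norm_apply_le (node L p) i
    have e : ‖(node L p) i‖ = Real.pi / L * |(p i : ℝ) + 1 / 2| := by
      rw [node, Real.norm_eq_abs, abs_mul, abs_of_pos (by positivity)]
    rw [e] at this
    calc Real.pi * |(p i : ℝ) + 1 / 2| = L * (Real.pi / L * |(p i : ℝ) + 1 / 2|) := by field_simp
      _ ≤ _ := by gcongr
  have h1 : 3 / 2 ≤ L * ‖node L p‖ := by
    have := hcoord ⟨0, hd⟩
    nlinarith [(habs (p ⟨0, hd⟩)).1]
  constructor
  · rw [div_le_iff₀ hL]; linarith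
  · have h2 : ‖p‖ ≤ 2 * (L * ‖node L p‖) - 1 := by
      refine (pi_norm_le_iff_of_nonneg (by linarith)).2 fun i => ?_
      rw [Int.norm_eq_abs]
      have := hcoord i
      nlinarith [(habs (p i)).1, (habs (p i)).2]
    linarith

lemma norm_add_period_ge {L : ℝ} (hL : 0 < L) {x : E d} (hx : x ∈ box d L) (n : Fin d → ℤ)
    (hn : n ≠ 0) : ∃ i, L * (2 * ‖n‖ - 1) ≤ |x i + 2 * L * n i| ∧ 1 ≤ ‖n‖ := by
  have hne : Nonempty (Fin d) := by
    by_contra h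
    rw [not_nonempty_iff] at h
    exact hn (Subsingleton.elim _ _)
  obtain ⟨i, hi⟩ := Finite.exists_max fun i => ‖n i‖
  have hni : ‖n‖ = ‖n i‖ :=
    le_antisymm ((pi_norm_le_iff_of_nonneg (norm_nonneg _)).2 hi) (norm_le_pi_norm n i)
  refine ⟨i, ?_, ?_⟩
  · have h1 : |x i| ≤ L := abs_le.2 (hx i)
    have h2 : |2 * L * (n i : ℝ)| - |x i| ≤ |x i + 2 * L * n i| := by
      have := abs_sub_abs_le_abs_sub (2 * L * (n i : ℝ)) (-x i)
      rw [abs_neg, sub_neg_eq_add, add_comm (2 * L * (n i : ℝ))] at this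
      exact this
    rw [abs_mul, abs_of_pos (by positivity)] at h2
    rw [hni, Int.norm_eq_abs]
    linarith
  · by_contra h
    push Not at h
    refine hn (funext fun j => ?_)
    have h3 := (norm_le_pi_norm n j).trans_lt h
    rw [Int.norm_eq_abs] at h3
    have : |n j| < 1 := by exact_mod_cast h3
    simpa using Int.abs_lt_one_iff.1 this

lemma norm_add_period_ge_half {L : ℝ} (hL : 0 < L) {x : E d} (hx : x ∈ box d L) (n : Fin d → ℤ)
    (hn : n ≠ 0) : L * ((1 + ‖n‖) / 2) ≤ ‖x + period L n‖ := by
  obtain ⟨i, hi, h1⟩ := norm_add_period_ge hL hx n hn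
  have h2 := PiLp.norm_apply_le (x + period L n) i
  have e : ‖(x + period L n) i‖ = |x i + 2 * L * n i| := by simp [period]
  rw [e] at h2
  nlinarith

lemma summable_symbol_mul_fourier {ρ : E d → ℝ} (hρ : ContDiff ℝ ∞ ρ) (hs : HasCompactSupport ρ)
    {L : ℝ} (hL : 0 < L) (hd : 0 < d) {f : E d → ℝ} {B : ℝ} (hf : ∀ p, |f (node L p)| ≤ B) :
    Summable fun p : Fin d → ℤ => ‖(f (node L p) : ℂ) * fourier ρ (node L p)‖ := by
  obtain ⟨C, hC, h⟩ := exists_fourier_decay hρ hs (d + 1)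
  refine Summable.of_nonneg_of_le (fun _ => norm_nonneg _) (fun p => ?_)
    ((summable_one_add_norm_inv_pow hd (Nat.lt_succ_self d)).mul_left (B * (C * (2 * L) ^ (d + 1))))
  have hp := (norm_node_ge hL hd p).2
  have hB : 0 ≤ B := (abs_nonneg _).trans (hf p)
  rw [norm_mul, Complex.norm_real, Real.norm_eq_abs, mul_assoc]
  refine mul_le_mul (hf p) ?_ (norm_nonneg _) hB
  have hp0 : 0 < 1 + ‖p‖ := by positivity
  rw [← div_eq_mul_inv, le_div_iff₀ (by positivity)]
  calc ‖fourier ρ (node L p)‖ * (1 + ‖p‖) ^ (d + 1)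
      ≤ ‖fourier ρ (node L p)‖ * ((2 * L) * ‖node L p‖) ^ (d + 1) := by
        gcongr
        linarith
    _ = (‖fourier ρ (node L p)‖ * ‖node L p‖ ^ (d + 1)) * (2 * L) ^ (d + 1) := by
        rw [mul_pow]; ring
    _ ≤ _ := by gcongr; exact h _

/-! ### Bounds for the alternating periodization of the heat potential -/

lemma VanishingMoments.exists_theta_le {m : ℕ} {ρ : E d → ℝ} (hm : VanishingMoments m ρ)
    (hc : Continuous ρ) (hs : HasCompactSupport ρ) (hd : 0 < d) :
    ∃ C : ℝ, 0 ≤ C ∧ ∀ L : ℝ, 0 < L → ∀ t : ℝ, L ^ 2 ≤ t → ∀ x : E d,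
      ‖theta ρ L t x‖ ≤ C * (L ^ (d + m + 1))⁻¹ * Real.exp (-(t / (2 * L ^ 2))) := by
  obtain ⟨C, hC, h⟩ := hm.exists_fourier_le hc hs
  set S : ℝ := ∑' p : Fin d → ℤ, ((1 + ‖p‖) ^ (d + 1))⁻¹ with hS
  have hsumm : Summable fun p : Fin d → ℤ => ((1 + ‖p‖) ^ (d + 1))⁻¹ :=
    summable_one_add_norm_inv_pow hd (Nat.lt_succ_self d)
  set F : ℝ := ((m + 1) + (d + 1)).factorial * Real.exp 2 with hF
  refine ⟨(2 ^ d)⁻¹ * C * F * 2 ^ (d + 1) * S, ?_, fun L hL t ht x => ?_⟩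
  · have : 0 ≤ S := tsum_nonneg fun p => by positivity
    positivity
  have ht0 : 0 < t := lt_of_lt_of_le (by positivity) ht
  have hsum := (hasSum_theta hc hs hL ht0 x).2
  rw [← hsum.tsum_eq]
  set A : ℝ := (2 ^ d)⁻¹ * C * F * 2 ^ (d + 1) * (L ^ (d + m + 1))⁻¹ *
    Real.exp (-(t / (2 * L ^ 2))) with hA
  have hb := hsumm.hasSum.mul_left A
  rw [← hS] at hb
  have hgoal : (2 ^ d)⁻¹ * C * F * 2 ^ (d + 1) * S * (L ^ (d + m + 1))⁻¹ *
      Real.exp (-(t / (2 * L ^ 2))) = A * S := by rw [hA]; ring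
  rw [hgoal]
  refine tsum_of_norm_bounded hb fun p => ?_
  set q : ℝ := L * ‖node L p‖ with hq
  have hq1 : 1 ≤ q := by
    have := (norm_node_ge hL hd p).1
    rw [div_le_iff₀ hL] at this
    linarith
  have hq2 : (1 + ‖p‖) / 2 ≤ q := (norm_node_ge hL hd p).2
  have hν : ‖node L p‖ = q / L := by rw [hq]; field_simp
  have hexp : Real.exp (-(t * ‖node L p‖ ^ 2)) ≤
      Real.exp (-(t / (2 * L ^ 2))) * Real.exp (-(q ^ 2 / 4)) := by
    rw [← Real.exp_add, Real.exp_le_exp, hν]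
    have hτ : 1 ≤ t / L ^ 2 := by rw [le_div_iff₀ (by positivity)]; linarith
    have e1 : t * (q / L) ^ 2 = t / L ^ 2 * q ^ 2 := by field_simp
    have e2 : t / (2 * L ^ 2) = t / L ^ 2 / 2 := by field_simp
    rw [e1, e2]
    nlinarith [mul_nonneg (sub_nonneg.2 hτ) (by nlinarith : 0 ≤ q ^ 2 - 1)]
  have hF' : q ^ (m + 1) * Real.exp (-(q ^ 2 / 4)) ≤ F * ((1 + q) ^ (d + 1))⁻¹ := by
    rw [← div_eq_mul_inv, le_div_iff₀ (by positivity)]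
    calc q ^ (m + 1) * Real.exp (-(q ^ 2 / 4)) * (1 + q) ^ (d + 1)
        ≤ (1 + q) ^ (m + 1) * Real.exp (-(q ^ 2 / 4)) * (1 + q) ^ (d + 1) := by
          gcongr; linarith
      _ = (1 + q) ^ ((m + 1) + (d + 1)) * Real.exp (-(q ^ 2 / 4)) := by rw [pow_add]; ring
      _ ≤ F := one_add_pow_mul_exp_le _ (by linarith)
  have hp : ((1 + q) ^ (d + 1))⁻¹ ≤ 2 ^ (d + 1) * ((1 + ‖p‖) ^ (d + 1))⁻¹ := by
    rw [← div_eq_mul_inv, ← div_pow, ← inv_pow]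
    refine pow_le_pow_left₀ (by positivity) ?_ _
    have : 0 < 1 + ‖p‖ := by positivity
    rw [inv_le_comm₀ (by positivity) (by positivity), inv_div]
    linarith
  rw [norm_mul, norm_mul, norm_mul, mul_comm Complex.I, Complex.norm_exp_ofReal_mul_I, mul_one,
    Complex.norm_real, Real.norm_of_nonneg (Real.exp_pos _).le]
  have hn : ‖1 / (2 * (L : ℂ)) ^ d‖ = (2 ^ d)⁻¹ * (L ^ d)⁻¹ := by
    rw [norm_div, norm_one, norm_pow, norm_mul, Complex.norm_real, Real.norm_of_nonneg hL.le,
      one_div, mul_pow, mul_inv]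
    simp
  rw [hn]
  calc (2 ^ d)⁻¹ * (L ^ d)⁻¹ * (Real.exp (-(t * ‖node L p‖ ^ 2)) * ‖fourier ρ (node L p)‖)
      ≤ (2 ^ d)⁻¹ * (L ^ d)⁻¹ * ((Real.exp (-(t / (2 * L ^ 2))) * Real.exp (-(q ^ 2 / 4))) *
        (C * (q / L) ^ (m + 1))) := by
        gcongr
        rw [← hν]; exact h _
    _ = (2 ^ d)⁻¹ * C * (L ^ (d + m + 1))⁻¹ * Real.exp (-(t / (2 * L ^ 2))) *
        (q ^ (m + 1) * Real.exp (-(q ^ 2 / 4))) := by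
        rw [div_pow, add_assoc d m 1, pow_add L d]; field_simp
    _ ≤ (2 ^ d)⁻¹ * C * (L ^ (d + m + 1))⁻¹ * Real.exp (-(t / (2 * L ^ 2))) *
        (F * (2 ^ (d + 1) * ((1 + ‖p‖) ^ (d + 1))⁻¹)) := by
        refine mul_le_mul_of_nonneg_left (hF'.trans ?_) (by positivity)
        gcongr
    _ = _ := by rw [hA]; ring

lemma theta_sub_eq_tsum {ρ : E d → ℝ} (hc : Continuous ρ) (hs : HasCompactSupport ρ)
    {L t : ℝ} (hL : 0 < L) (ht : 0 < t) (x : E d) :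
    theta ρ L t x - (conv (heat t) ρ x : ℂ) = ∑' n : Fin d → ℤ, if n = 0 then 0 else
      altSign n * (conv (heat t) ρ (x + period L n) : ℂ) := by
  have h := (hasSum_theta hc hs hL ht x).1
  have e := h.summable.tsum_eq_add_tsum_ite 0
  rw [h.tsum_eq, altSign_zero, period_zero, add_zero, one_mul] at e
  rw [e, add_sub_cancel_left]

lemma VanishingMoments.exists_theta_sub_le {m : ℕ} {ρ : E d → ℝ} (hm : VanishingMoments m ρ)
    (hc : Continuous ρ) (hs : HasCompactSupport ρ) (hd : 0 < d) :
    ∃ C : ℝ, 0 ≤ C ∧ ∀ L : ℝ, 0 < L → ∀ t : ℝ, 0 < t → ∀ x ∈ box d L,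
      ‖theta ρ L t x - (conv (heat t) ρ x : ℂ)‖ ≤ C * (L ^ (d + m + 1))⁻¹ := by
  obtain ⟨C, hC, h⟩ := hm.exists_conv_heat_le hc hs
  set S : ℝ := ∑' p : Fin d → ℤ, ((1 + ‖p‖) ^ (d + m + 1))⁻¹ with hS
  have hsumm := summable_one_add_norm_inv_pow hd (by omega : d < d + m + 1)
  have hS0 : 0 ≤ S := tsum_nonneg fun p => by positivity
  refine ⟨C * 2 ^ (d + m + 1) * S, by positivity, fun L hL t ht x hx => ?_⟩
  rw [theta_sub_eq_tsum hc hs hL ht]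
  have hb := hsumm.hasSum.mul_left (C * 2 ^ (d + m + 1) * (L ^ (d + m + 1))⁻¹)
  rw [← hS] at hb
  rw [mul_right_comm]
  refine tsum_of_norm_bounded hb fun n => ?_
  by_cases hn : n = 0
  · simp only [hn, if_true, norm_zero]; positivity
  simp only [hn, if_false]
  rw [norm_mul, norm_altSign, one_mul, Complex.norm_real, Real.norm_eq_abs]
  have h1 := (h t ht (x + period L n)).1
  have h2 := norm_add_period_ge_half hL hx n hn
  have h3 : |conv (heat t) ρ (x + period L n)| * (L * ((1 + ‖n‖) / 2)) ^ (d + m + 1) ≤ C :=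
    le_trans (by gcongr) h1
  rw [← le_div_iff₀ (by positivity)] at h3
  refine h3.trans (le_of_eq ?_)
  rw [mul_pow, div_pow]
  field_simp

/-! ### The midpoint rule on the whole frequency space -/

lemma integrable_and_hasSum_integral {α ι : Type*} [MeasurableSpace α] {μ : Measure α} [Countable ι]
    {F : ι → α → ℂ} {G : α → ℂ} (hF : ∀ i, Integrable (F i) μ)
    (hsum : Summable fun i => ∫ a, ‖F i a‖ ∂μ) (hG : ∀ᵐ a ∂μ, HasSum (fun i => F i a) (G a)) :
    Integrable G μ ∧ HasSum (fun i => ∫ a, F i a ∂μ) (∫ a, G a ∂μ) := by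
  have hmeas : AEStronglyMeasurable G μ :=
    aestronglyMeasurable_of_tendsto_ae (u := (Filter.atTop : Filter (Finset ι)))
      (f := fun s a => ∑ i ∈ s, F i a)
      (fun s => (integrable_finsetSum s fun i _ => hF i).aestronglyMeasurable) hG
  refine ⟨⟨hmeas, ?_⟩, ?_⟩
  · have h1 : ∫⁻ a, ‖G a‖ₑ ∂μ ≤ ∫⁻ a, ∑' i, ‖F i a‖ₑ ∂μ := by
      refine lintegral_mono_ae ?_
      filter_upwards [hG] with a ha
      rw [← ha.tsum_eq]
      exact enorm_tsum_le_tsum_enorm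
    rw [lintegral_tsum fun i => (hF i).aestronglyMeasurable.enorm] at h1
    refine lt_of_le_of_lt h1 ?_
    have h2 : ∀ i, ∫⁻ a, ‖F i a‖ₑ ∂μ = ENNReal.ofReal (∫ a, ‖F i a‖ ∂μ) := fun i =>
      (ofReal_integral_norm_eq_lintegral_enorm (hF i)).symm
    simp_rw [h2]
    rw [← ENNReal.ofReal_tsum_of_nonneg (fun i => integral_nonneg fun _ => norm_nonneg _) hsum]
    exact ENNReal.ofReal_lt_top
  · have h3 := hasSum_integral_of_summable_integral_norm hF hsum
    rwa [integral_congr_ae (hG.mono fun a ha => ha.tsum_eq)] at h3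

/-- The midpoint rule with dual mesh size `π / L` on the whole frequency space, for the
Fourier multiplier `f`. -/
def fullSum (f : E d → ℝ) (ρ : E d → ℝ) (L : ℝ) (x : E d) : ℂ :=
  ∑' p : Fin d → ℤ, 1 / (2 * (L : ℂ)) ^ d * ((f (node L p) : ℂ) * fourier ρ (node L p) *
      Complex.exp (Complex.I * (inner ℝ (node L p) x : ℝ)))

lemma node_ne_zero {L : ℝ} (hL : 0 < L) (hd : 0 < d) (p : Fin d → ℤ) : node L p ≠ 0 := by
  have h := (norm_node_ge hL hd p).1
  have : 0 < 1 / L := by positivity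
  exact norm_pos_iff.1 (this.trans_le h)

/-- The nonnegative function `w` represents the Fourier multiplier `f` as a superposition
of heat semigroups. -/
def IsHeatWeight (w : ℝ → ℝ) (f : E d → ℝ) : Prop :=
  (∀ t, 0 < t → 0 ≤ w t) ∧ ∀ k : E d, k ≠ 0 →
    IntegrableOn (fun t => w t * Real.exp (-(t * ‖k‖ ^ 2))) (Set.Ioi 0) ∧
    ∫ t in Set.Ioi 0, w t * Real.exp (-(t * ‖k‖ ^ 2)) = f k

lemma IsHeatWeight.integrable_and_integral_eq {w : ℝ → ℝ} {f : E d → ℝ} (hw : IsHeatWeight w f)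
    {ρ : E d → ℝ} (hρ : ContDiff ℝ ∞ ρ) (hs : HasCompactSupport ρ) {L : ℝ} (hL : 0 < L)
    (hd : 0 < d) {B : ℝ} (hB : ∀ p, |f (node L p)| ≤ B) (x : E d) :
    IntegrableOn (fun t => (w t : ℂ) * theta ρ L t x) (Set.Ioi 0) ∧
      ∫ t in Set.Ioi 0, (w t : ℂ) * theta ρ L t x = fullSum f ρ L x := by
  have hc := hρ.continuous
  set F : (Fin d → ℤ) → ℝ → ℂ := fun p t => ((w t * Real.exp (-(t * ‖node L p‖ ^ 2)) : ℝ) : ℂ) *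
    (1 / (2 * (L : ℂ)) ^ d * (fourier ρ (node L p) *
      Complex.exp (Complex.I * (inner ℝ (node L p) x : ℝ)))) with hF
  have hwk := fun p => hw.2 (node L p) (node_ne_zero hL hd p)
  have hint : ∀ p, IntegrableOn (F p) (Set.Ioi 0) := fun p => ((hwk p).1.ofReal).mul_const _
  have heq : ∀ p, ∫ t in Set.Ioi 0, F p t = 1 / (2 * (L : ℂ)) ^ d *
      ((f (node L p) : ℂ) * fourier ρ (node L p) *
      Complex.exp (Complex.I * (inner ℝ (node L p) x : ℝ))) := by
    intro p
    rw [hF]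
    simp only
    rw [integral_mul_const, integral_complex_ofReal, (hwk p).2]
    ring
  have hnorm : ∀ p, ∫ t in Set.Ioi 0, ‖F p t‖ = ‖1 / (2 * (L : ℂ)) ^ d‖ *
      ‖(f (node L p) : ℂ) * fourier ρ (node L p)‖ := by
    intro p
    have : ∀ t ∈ Set.Ioi (0 : ℝ), ‖F p t‖ = w t * Real.exp (-(t * ‖node L p‖ ^ 2)) *
        (‖1 / (2 * (L : ℂ)) ^ d‖ * ‖fourier ρ (node L p)‖) := by
      intro t ht
      rw [hF]
      simp only
      rw [norm_mul, norm_mul (1 / _), norm_mul (fourier _ _), mul_comm Complex.I,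
        Complex.norm_exp_ofReal_mul_I, mul_one, Complex.norm_real,
        Real.norm_of_nonneg (mul_nonneg (hw.1 t ht) (Real.exp_pos _).le)]
    rw [setIntegral_congr_fun measurableSet_Ioi this, integral_mul_const, (hwk p).2]
    have hf0 : 0 ≤ f (node L p) := by
      rw [← (hwk p).2]
      exact setIntegral_nonneg measurableSet_Ioi fun t ht =>
        mul_nonneg (hw.1 t ht) (Real.exp_pos _).le
    rw [norm_mul, Complex.norm_real, Real.norm_of_nonneg hf0]
    ring
  have hsum : Summable fun p => ∫ t in Set.Ioi 0, ‖F p t‖ := by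
    simp_rw [hnorm]
    exact (summable_symbol_mul_fourier hρ hs hL hd hB).mul_left _
  have h := integrable_and_hasSum_integral (μ := volume.restrict (Set.Ioi 0)) hint hsum
    (G := fun t => (w t : ℂ) * theta ρ L t x) (by
      refine (ae_restrict_iff' measurableSet_Ioi).2 (.of_forall fun t ht => ?_)
      refine ((hasSum_theta hc hs hL ht x).2.mul_left (w t : ℂ)).congr_fun fun p => ?_
      rw [hF]
      push_cast
      ring)
  refine ⟨h.1, ?_⟩
  rw [← h.2.tsum_eq, fullSum]
  exact tsum_congr heq

lemma integral_Ioc_rpow_sq {L κ : ℝ} (hL : 0 < L) (hκ : 0 < κ) :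
    IntegrableOn (fun t : ℝ => t ^ (κ - 1)) (Set.Ioc 0 (L ^ 2)) ∧
      ∫ t in Set.Ioc 0 (L ^ 2), t ^ (κ - 1) = L ^ (2 * κ) / κ := by
  have h0 : (0 : ℝ) ≤ L ^ 2 := by positivity
  constructor
  · rw [← intervalIntegrable_iff_integrableOn_Ioc_of_le h0]
    exact intervalIntegral.intervalIntegrable_rpow' (by linarith)
  · rw [← intervalIntegral.integral_of_le h0, integral_rpow (Or.inl (by linarith)),
      sub_add_cancel, Real.zero_rpow hκ.ne', sub_zero, Real.rpow_mul hL.le, Real.rpow_two]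

/-- Comparison of the midpoint rule with a potential that is a superposition of (renormalized)
heat potentials. -/
lemma IsHeatWeight.exists_fullSum_sub_le {w : ℝ → ℝ} {f : E d → ℝ} (hw : IsHeatWeight w f)
    {κ A : ℝ} (hκ : 0 < κ) (hA : 0 ≤ A) (hwA : ∀ t, 0 < t → w t ≤ A * t ^ (κ - 1))
    {m : ℕ} {ρ : E d → ℝ} (hm : VanishingMoments m ρ)
    (hρ : ContDiff ℝ ∞ ρ) (hs : HasCompactSupport ρ) (hd : 0 < d) :
    ∃ C : ℝ, 0 ≤ C ∧ ∀ L : ℝ, 0 < L → ∀ x ∈ box d L, ∀ B : ℝ, (∀ p, |f (node L p)| ≤ B) →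
      ∀ r : ℝ → ℝ, IntegrableOn (fun t => w t * conv (heat t) ρ x + r t) (Set.Ioi 0) →
      IntegrableOn r (Set.Ioc 0 (L ^ 2)) →
      ‖fullSum f ρ L x - ((∫ t in Set.Ioi 0, (w t * conv (heat t) ρ x + r t) : ℝ) : ℂ)‖ ≤
        C * L ^ (2 * κ - (d + m + 1)) + |(∫ t in Set.Ioc 0 (L ^ 2), r t) +
          ∫ t in Set.Ioi (L ^ 2), (w t * conv (heat t) ρ x + r t)| := by
  have hc := hρ.continuous
  obtain ⟨C1, hC1, h1⟩ := hm.exists_theta_sub_le hc hs hd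
  obtain ⟨C2, hC2, h2⟩ := hm.exists_theta_le hc hs hd
  have hG := Real.Gamma_pos_of_pos hκ
  refine ⟨A * C1 / κ + A * C2 * (2 ^ κ * Real.Gamma κ), by positivity,
    fun L hL x hx B hB r hr hr0 => ?_⟩
  have hL2 : (0 : ℝ) < L ^ 2 := by positivity
  obtain ⟨hi, he⟩ := hw.integrable_and_integral_eq hρ hs hL hd hB x
  have hsplit : Set.Ioi (0 : ℝ) = Set.Ioc 0 (L ^ 2) ∪ Set.Ioi (L ^ 2) :=
    (Set.Ioc_union_Ioi_eq_Ioi hL2.le).symm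
  have hdisj : Disjoint (Set.Ioc (0 : ℝ) (L ^ 2)) (Set.Ioi (L ^ 2)) := by
    rw [Set.disjoint_left]; intro t ht ht'; exact absurd ht.2 (not_le.2 ht')
  have hi1 : IntegrableOn (fun t => (w t : ℂ) * theta ρ L t x) (Set.Ioc 0 (L ^ 2)) :=
    hi.mono_set Set.Ioc_subset_Ioi_self
  have hi2 : IntegrableOn (fun t => (w t : ℂ) * theta ρ L t x) (Set.Ioi (L ^ 2)) :=
    hi.mono_set (Set.Ioi_subset_Ioi hL2.le)
  have hr1 : IntegrableOn (fun t => w t * conv (heat t) ρ x + r t) (Set.Ioc 0 (L ^ 2)) :=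
    hr.mono_set Set.Ioc_subset_Ioi_self
  have hr2 : IntegrableOn (fun t => w t * conv (heat t) ρ x + r t) (Set.Ioi (L ^ 2)) :=
    hr.mono_set (Set.Ioi_subset_Ioi hL2.le)
  have hu1 : IntegrableOn (fun t => w t * conv (heat t) ρ x) (Set.Ioc 0 (L ^ 2)) := by
    refine (hr1.sub hr0).congr_fun (fun t _ => ?_) measurableSet_Ioc
    simp
  have eΘ : fullSum f ρ L x = (∫ t in Set.Ioc 0 (L ^ 2), (w t : ℂ) * theta ρ L t x) +
      ∫ t in Set.Ioi (L ^ 2), (w t : ℂ) * theta ρ L t x := by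
    rw [← he, hsplit, setIntegral_union hdisj measurableSet_Ioi hi1 hi2]
  have eΦ : ∫ t in Set.Ioi 0, (w t * conv (heat t) ρ x + r t) =
      (∫ t in Set.Ioc 0 (L ^ 2), w t * conv (heat t) ρ x) + ((∫ t in Set.Ioc 0 (L ^ 2), r t) +
      ∫ t in Set.Ioi (L ^ 2), (w t * conv (heat t) ρ x + r t)) := by
    rw [hsplit, setIntegral_union hdisj measurableSet_Ioi hr1 hr2, integral_add hu1 hr0, add_assoc]
  have eS : (∫ t in Set.Ioc 0 (L ^ 2), (w t : ℂ) * theta ρ L t x) -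
      ((∫ t in Set.Ioc 0 (L ^ 2), w t * conv (heat t) ρ x : ℝ) : ℂ) =
      ∫ t in Set.Ioc 0 (L ^ 2), (w t : ℂ) * (theta ρ L t x - (conv (heat t) ρ x : ℂ)) := by
    have hu1' : IntegrableOn (fun t => ((w t * conv (heat t) ρ x : ℝ) : ℂ)) (Set.Ioc 0 (L ^ 2)) :=
      hu1.ofReal
    rw [← integral_complex_ofReal, ← integral_sub hi1 hu1']
    refine integral_congr_ae (.of_forall fun t => ?_)
    push_cast
    ring
  set D : ℝ := (∫ t in Set.Ioc 0 (L ^ 2), r t) +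
    ∫ t in Set.Ioi (L ^ 2), (w t * conv (heat t) ρ x + r t) with hD
  have etot : fullSum f ρ L x - ((∫ t in Set.Ioi 0, (w t * conv (heat t) ρ x + r t) : ℝ) : ℂ) =
      (∫ t in Set.Ioc 0 (L ^ 2), (w t : ℂ) * (theta ρ L t x - (conv (heat t) ρ x : ℂ))) +
      (∫ t in Set.Ioi (L ^ 2), (w t : ℂ) * theta ρ L t x) - (D : ℂ) := by
    rw [← eS, eΘ, eΦ]
    push_cast
    ring
  rw [etot]
  have hLK : L ^ (2 * κ - (d + m + 1)) = L ^ (2 * κ) * (L ^ (d + m + 1))⁻¹ := by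
    rw [Real.rpow_sub hL, div_eq_mul_inv]
    congr 2
    exact_mod_cast Real.rpow_natCast L (d + m + 1)
  have b1 : ‖∫ t in Set.Ioc 0 (L ^ 2), (w t : ℂ) * (theta ρ L t x - (conv (heat t) ρ x : ℂ))‖ ≤
      A * C1 / κ * L ^ (2 * κ - (d + m + 1)) := by
    refine (norm_integral_le_of_norm_le (g := fun t => A * C1 * (L ^ (d + m + 1))⁻¹ * t ^ (κ - 1))
      ((integral_Ioc_rpow_sq hL hκ).1.const_mul _) ?_).trans (le_of_eq ?_)
    · refine (ae_restrict_iff' measurableSet_Ioc).2 (.of_forall fun t ht => ?_)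
      rw [norm_mul, Complex.norm_real, Real.norm_of_nonneg (hw.1 t ht.1)]
      calc w t * ‖theta ρ L t x - (conv (heat t) ρ x : ℂ)‖
          ≤ (A * t ^ (κ - 1)) * (C1 * (L ^ (d + m + 1))⁻¹) :=
            mul_le_mul (hwA t ht.1) (h1 L hL t ht.1 x hx) (norm_nonneg _)
              (mul_nonneg hA (Real.rpow_nonneg ht.1.le _))
        _ = _ := by ring
    · rw [integral_const_mul, (integral_Ioc_rpow_sq hL hκ).2, hLK]
      ring
  have b2 : ‖∫ t in Set.Ioi (L ^ 2), (w t : ℂ) * theta ρ L t x‖ ≤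
      A * C2 * (2 ^ κ * Real.Gamma κ) * L ^ (2 * κ - (d + m + 1)) := by
    have hg := Real.integral_rpow_mul_exp_neg_mul_Ioi hκ (r := 1 / (2 * L ^ 2)) (by positivity)
    have hgi : IntegrableOn (fun t : ℝ => t ^ (κ - 1) * Real.exp (-(1 / (2 * L ^ 2) * t)))
        (Set.Ioi 0) := by
      have := integrableOn_rpow_mul_exp_neg_mul_rpow (p := 1) (s := κ - 1) (b := 1 / (2 * L ^ 2))
        (by linarith) one_pos (by positivity)
      simpa using this
    refine (norm_integral_le_of_norm_le (g := fun t => A * C2 * (L ^ (d + m + 1))⁻¹ *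
      (t ^ (κ - 1) * Real.exp (-(1 / (2 * L ^ 2) * t))))
      ((hgi.mono_set (Set.Ioi_subset_Ioi hL2.le)).const_mul _) ?_).trans ?_
    · refine (ae_restrict_iff' measurableSet_Ioi).2 (.of_forall fun t ht => ?_)
      have ht0 : 0 < t := hL2.trans ht
      rw [norm_mul, Complex.norm_real, Real.norm_of_nonneg (hw.1 t ht0)]
      calc w t * ‖theta ρ L t x‖
          ≤ (A * t ^ (κ - 1)) * (C2 * (L ^ (d + m + 1))⁻¹ * Real.exp (-(t / (2 * L ^ 2)))) :=
            mul_le_mul (hwA t ht0) (h2 L hL t ht.le x) (norm_nonneg _)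
              (mul_nonneg hA (Real.rpow_nonneg ht0.le _))
        _ = _ := by
            rw [show 1 / (2 * L ^ 2) * t = t / (2 * L ^ 2) by ring]; ring
    · rw [integral_const_mul]
      have : ∫ t in Set.Ioi (L ^ 2), t ^ (κ - 1) * Real.exp (-(1 / (2 * L ^ 2) * t)) ≤
          (2 * L ^ 2) ^ κ * Real.Gamma κ := by
        rw [one_div_one_div] at hg
        rw [← hg]
        refine setIntegral_mono_set hgi ?_ (Set.Ioi_subset_Ioi hL2.le).eventuallyLE
        refine (ae_restrict_iff' measurableSet_Ioi).2 (.of_forall fun t ht => ?_)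
        have : (0 : ℝ) < t := ht
        simp only [Pi.zero_apply]
        positivity
      rw [Real.mul_rpow (by positivity) hL2.le, ← Real.rpow_two, ← Real.rpow_mul hL.le] at this
      calc A * C2 * (L ^ (d + m + 1))⁻¹ *
            ∫ t in Set.Ioi (L ^ 2), t ^ (κ - 1) * Real.exp (-(1 / (2 * L ^ 2) * t))
          ≤ A * C2 * (L ^ (d + m + 1))⁻¹ * (2 ^ κ * L ^ (2 * κ) * Real.Gamma κ) := by
            refine mul_le_mul_of_nonneg_left ?_ (by positivity)
            exact_mod_cast this
        _ = _ := by rw [hLK]; ring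
  refine (norm_sub_le _ _).trans ?_
  rw [Complex.norm_real, Real.norm_eq_abs, add_mul]
  refine add_le_add_left ((norm_add_le _ _).trans (add_le_add b1 b2)) _

/-- The contribution of large times is small when the heat potentials decay fast enough. -/
lemma VanishingMoments.exists_integral_heat_le {m : ℕ} {ρ : E d → ℝ} (hm : VanishingMoments m ρ)
    (hc : Continuous ρ) (hs : HasCompactSupport ρ) {w : ℝ → ℝ} {κ A : ℝ} (hA : 0 ≤ A)
    (hw0 : ∀ t, 0 < t → 0 ≤ w t)
    (hwA : ∀ t, 0 < t → w t ≤ A * t ^ (κ - 1)) (hκ : 2 * κ < d + m + 1) :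
    ∃ C : ℝ, 0 ≤ C ∧ ∀ L : ℝ, 0 < L → ∀ x,
      |∫ t in Set.Ioi (L ^ 2), w t * conv (heat t) ρ x| ≤ C * L ^ (2 * κ - (d + m + 1)) := by
  obtain ⟨C, hC, h⟩ := hm.exists_conv_heat_le hc hs
  set e : ℝ := κ - (d + m + 1) / 2 with he
  have he0 : e < 0 := by rw [he]; linarith
  refine ⟨A * C / (-e), div_nonneg (by positivity) (by linarith), fun L hL x => ?_⟩
  have hL2 : (0 : ℝ) < L ^ 2 := by positivity
  rw [← Real.norm_eq_abs]
  refine (norm_integral_le_of_norm_le (g := fun t : ℝ => A * C * t ^ (e - 1))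
      ((integrableOn_Ioi_rpow_of_lt (by linarith) hL2).const_mul _) ?_).trans (le_of_eq ?_)
  · refine (ae_restrict_iff' measurableSet_Ioi).2 (.of_forall fun t ht => ?_)
    have ht0 : 0 < t := hL2.trans ht
    rw [Real.norm_eq_abs, abs_mul, abs_of_nonneg (hw0 t ht0)]
    have h3 := (h t ht0 x).2
    have hst : 0 < √t := Real.sqrt_pos.2 ht0
    rw [← le_div_iff₀ (by positivity)] at h3
    have e1 : √t ^ (d + m + 1) = t ^ (((d : ℝ) + m + 1) / 2) := by
      rw [Real.sqrt_eq_rpow, ← Real.rpow_natCast, ← Real.rpow_mul ht0.le]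
      congr 1
      push_cast
      ring
    calc w t * |conv (heat t) ρ x| ≤ (A * t ^ (κ - 1)) * (C / √t ^ (d + m + 1)) :=
          mul_le_mul (hwA t ht0) h3 (abs_nonneg _) (mul_nonneg hA (Real.rpow_nonneg ht0.le _))
      _ = A * C * t ^ (e - 1) := by
          rw [e1, he, show κ - ((d : ℝ) + m + 1) / 2 - 1 = κ - 1 - (d + m + 1) / 2 by ring,
            Real.rpow_sub ht0 (κ - 1)]
          ring
  · rw [integral_const_mul, integral_Ioi_rpow_of_lt (by linarith) hL2, sub_add_cancel,
      ← Real.rpow_two, ← Real.rpow_mul hL.le, show 2 * e = 2 * κ - (d + m + 1) by rw [he]; ring]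
    have : e ≠ 0 := he0.ne
    field_simp

/-! ### One-dimensional integrals -/

lemma integrableOn_Ioi_zero_of_le {f : ℝ → ℝ} (hf : Measurable f) {α β C : ℝ} (hα : -1 < α)
    (hβ : β < -1) (h0 : ∀ t, 0 < t → t ≤ 1 → |f t| ≤ C * t ^ α)
    (h1 : ∀ t, 1 < t → |f t| ≤ C * t ^ β) : IntegrableOn f (Set.Ioi 0) := by
  rw [← Set.Ioc_union_Ioi_eq_Ioi zero_le_one, integrableOn_union]
  constructor
  · have h : IntegrableOn (fun t : ℝ => t ^ α) (Set.Ioc 0 1) := by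
      rw [← intervalIntegrable_iff_integrableOn_Ioc_of_le zero_le_one]
      exact intervalIntegral.intervalIntegrable_rpow' hα
    refine (h.const_mul C).mono' hf.aestronglyMeasurable ?_
    exact (ae_restrict_iff' measurableSet_Ioc).2 (.of_forall fun t ht => h0 t ht.1 ht.2)
  · refine ((integrableOn_Ioi_rpow_of_lt hβ one_pos).const_mul C).mono' hf.aestronglyMeasurable ?_
    exact (ae_restrict_iff' measurableSet_Ioi).2 (.of_forall fun t ht => h1 t ht)

lemma exp_neg_bounds {y : ℝ} (hy : 0 ≤ y) :
    0 ≤ 1 - Real.exp (-y) ∧ 1 - Real.exp (-y) ≤ y ∧ Real.exp (-y) ≤ 1 ∧ y * Real.exp (-y) ≤ 1 ∧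
      (1 + y) * Real.exp (-y) ≤ 1 := by
  have h1 : Real.exp (-y) ≤ 1 := Real.exp_le_one_iff.2 (by linarith)
  have h2 := Real.add_one_le_exp (-y)
  have h3 := Real.add_one_le_exp y
  have h4 : Real.exp y * Real.exp (-y) = 1 := by rw [← Real.exp_add]; simp
  have h5 := Real.exp_pos (-y)
  refine ⟨by linarith, by linarith, h1, ?_, ?_⟩ <;> nlinarith

lemma integral_rpow_mul_exp_neg_div {a : ℝ} (ha : 0 < a) :
    ∫ t in Set.Ioi (0 : ℝ), t ^ (-(3 / 2) : ℝ) * Real.exp (-(a / t)) = √(Real.pi / a) := by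
  have h := Real.integral_rpow_mul_exp_neg_mul_Ioi (a := 1 / 2) (r := a) (by norm_num) ha
  rw [← integral_comp_rpow_Ioi _ (p := -1) (by norm_num)] at h
  rw [Real.Gamma_one_half_eq, ← Real.sqrt_eq_rpow, ← Real.sqrt_mul (by positivity),
    one_div_mul_eq_div] at h
  rw [← h]
  refine setIntegral_congr_fun measurableSet_Ioi fun t ht => ?_
  have ht : (0 : ℝ) < t := ht
  simp only [smul_eq_mul, abs_neg, abs_one, one_mul]
  rw [← Real.rpow_mul ht.le, ← mul_assoc, ← Real.rpow_add ht, Real.rpow_neg_one, ← div_eq_mul_inv]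
  norm_num

lemma integrableOn_rpow_mul_exp_neg_div {a : ℝ} (ha : 0 < a) :
    IntegrableOn (fun t : ℝ => t ^ (-(3 / 2) : ℝ) * Real.exp (-(a / t))) (Set.Ioi 0) := by
  by_contra h
  have h1 := integral_rpow_mul_exp_neg_div ha
  rw [integral_undef h] at h1
  have : 0 < √(Real.pi / a) := Real.sqrt_pos.2 (div_pos Real.pi_pos ha)
  exact this.ne h1

lemma abs_exp_neg_sub_exp_neg_le {x y : ℝ} (hx : 0 ≤ x) (hy : 0 ≤ y) :
    |Real.exp (-x) - Real.exp (-y)| ≤ |x - y| := by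
  wlog h : x ≤ y generalizing x y
  · rw [abs_sub_comm, abs_sub_comm x]
    exact this hy hx (by linarith)
  have h1 : Real.exp (-y) ≤ Real.exp (-x) := Real.exp_le_exp.2 (by linarith)
  have h2 := (exp_neg_bounds (sub_nonneg.2 h)).2.1
  have h3 : Real.exp (-y) = Real.exp (-x) * Real.exp (-(y - x)) := by
    rw [← Real.exp_add]; ring_nf
  have h4 := (exp_neg_bounds hx).2.2.1
  have h5 := (exp_neg_bounds (sub_nonneg.2 h)).1
  rw [abs_of_nonneg (by linarith), abs_of_nonpos (by linarith), h3]
  nlinarith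

lemma integrableOn_inv_mul_exp_sub_exp {a b : ℝ} (ha : 0 < a) (hb : 0 < b) :
    IntegrableOn (fun t : ℝ => t⁻¹ * (Real.exp (-(a / t)) - Real.exp (-(b / t)))) (Set.Ioi 0) := by
  refine integrableOn_Ioi_zero_of_le (α := 0) (β := -2) (C := 1 / a + 1 / b + |a - b|)
    (by fun_prop) (by norm_num) (by norm_num) ?_ ?_
  · intro t ht _
    have h1 := (exp_neg_bounds (div_nonneg ha.le ht.le)).2.2.2.1
    have h2 := (exp_neg_bounds (div_nonneg hb.le ht.le)).2.2.2.1
    have h3 : t⁻¹ * Real.exp (-(a / t)) ≤ 1 / a := by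
      rw [le_div_iff₀ ha]; calc _ = a / t * Real.exp (-(a / t)) := by ring
        _ ≤ 1 := h1
    have h4 : t⁻¹ * Real.exp (-(b / t)) ≤ 1 / b := by
      rw [le_div_iff₀ hb]; calc _ = b / t * Real.exp (-(b / t)) := by ring
        _ ≤ 1 := h2
    have h5 : 0 ≤ t⁻¹ * Real.exp (-(a / t)) := by positivity
    have h6 : 0 ≤ t⁻¹ * Real.exp (-(b / t)) := by positivity
    rw [Real.rpow_zero, mul_one, mul_sub, abs_le]
    constructor <;> linarith [abs_nonneg (a - b), one_div_pos.2 ha, one_div_pos.2 hb]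
  · intro t ht
    have ht0 : 0 < t := by linarith
    have h1 := abs_exp_neg_sub_exp_neg_le (div_nonneg ha.le ht0.le) (div_nonneg hb.le ht0.le)
    rw [← sub_div, abs_div, abs_of_pos ht0] at h1
    rw [abs_mul, abs_of_pos (inv_pos.2 ht0), Real.rpow_neg ht0.le, Real.rpow_two]
    calc t⁻¹ * |Real.exp (-(a / t)) - Real.exp (-(b / t))| ≤ t⁻¹ * (|a - b| / t) := by gcongr
      _ = |a - b| * (t ^ 2)⁻¹ := by field_simp
      _ ≤ _ := by
        gcongr
        linarith [one_div_pos.2 ha, one_div_pos.2 hb]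

lemma integral_inv_mul_exp_sub_exp {a b : ℝ} (ha : 0 < a) (hb : 0 < b) :
    ∫ t in Set.Ioi (0 : ℝ), t⁻¹ * (Real.exp (-(a / t)) - Real.exp (-(b / t))) =
      Real.log (b / a) := by
  have hcont : ContinuousOn (fun x : ℝ => Real.exp (-x⁻¹)) (Set.Ioi 0) := by
    refine Real.continuous_exp.comp_continuousOn (ContinuousOn.neg (continuousOn_inv₀.mono ?_))
    intro x hx
    exact (ne_of_gt hx)
  have e : ∀ c : ℝ, ∀ t : ℝ, Real.exp (-(c⁻¹ * t)⁻¹) = Real.exp (-(c / t)) := by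
    intro c t; rw [mul_inv, inv_inv, div_eq_mul_inv]
  have h := Frullani.integral_Ioi_eq (f := fun x : ℝ => Real.exp (-x⁻¹)) (a := a⁻¹) (b := b⁻¹)
    (L := 0) (R := 1) (hcont.locallyIntegrableOn measurableSet_Ioi)
    (inv_pos.2 ha) (inv_pos.2 hb)
    (Real.tendsto_exp_neg_atTop_nhds_zero.comp tendsto_inv_nhdsGT_zero)
    (by
      have := (Real.continuous_exp.tendsto (-0)).comp (tendsto_inv_atTop_zero (𝕜 := ℝ)).neg
      simpa [Function.comp_def] using this)
    (by
      simp only [e, smul_eq_mul]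
      exact integrableOn_inv_mul_exp_sub_exp ha hb)
  simp only [e, smul_eq_mul] at h
  rw [h, zero_sub, mul_neg_one, ← Real.log_inv, inv_div, inv_div_inv]

lemma integral_rpow_mul_exp_sub_one {a : ℝ} (ha : 0 < a) :
    ∫ t in Set.Ioi (0 : ℝ), t ^ (-(1 / 2) : ℝ) * (Real.exp (-(a / t)) - 1) =
      -(2 * a * √(Real.pi / a)) := by
  have hi1 : IntegrableOn (fun t : ℝ => t ^ (-(1 / 2) : ℝ) * (Real.exp (-(a / t)) - 1))
      (Set.Ioi 0) := by
    refine integrableOn_Ioi_zero_of_le (α := -(1 / 2)) (β := -(3 / 2)) (C := 1 + a)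
      (by fun_prop) (by norm_num) (by norm_num) ?_ ?_
    · intro t ht _
      have h1 := exp_neg_bounds (div_nonneg ha.le ht.le)
      have h2 := Real.exp_pos (-(a / t))
      rw [abs_mul, abs_of_nonneg (by positivity), mul_comm]
      gcongr
      rw [abs_le]; constructor <;> linarith
    · intro t ht
      have ht0 : 0 < t := by linarith
      have h1 := exp_neg_bounds (div_nonneg ha.le ht0.le)
      rw [abs_mul, abs_of_nonneg (by positivity)]
      have h2 : |Real.exp (-(a / t)) - 1| ≤ a / t := by rw [abs_le]; constructor <;> linarith
      calc t ^ (-(1 / 2) : ℝ) * |Real.exp (-(a / t)) - 1| ≤ t ^ (-(1 / 2) : ℝ) * (a / t) := by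
            gcongr
        _ = a * t ^ (-(3 / 2) : ℝ) := by
            rw [show (-(3 / 2) : ℝ) = -(1 / 2) - 1 by norm_num, Real.rpow_sub_one ht0.ne']; ring
        _ ≤ _ := by gcongr; linarith
  have hi2 := (integrableOn_rpow_mul_exp_neg_div ha).const_mul (2 * a)
  have hd : ∀ t ∈ Set.Ioi (0 : ℝ), HasDerivAt
      (fun t : ℝ => 2 * t ^ (1 / 2 : ℝ) * (Real.exp (-(a / t)) - 1))
      (t ^ (-(1 / 2) : ℝ) * (Real.exp (-(a / t)) - 1) +
        2 * a * (t ^ (-(3 / 2) : ℝ) * Real.exp (-(a / t)))) t := by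
    intro t ht
    have ht0 : (0 : ℝ) < t := ht
    have h1 := (Real.hasDerivAt_rpow_const (x := t) (p := 1 / 2) (Or.inl ht0.ne')).const_mul 2
    have h2 := (((hasDerivAt_inv ht0.ne').const_mul a).neg.exp.sub_const 1)
    have h3 := h1.mul h2
    refine (h3.congr_deriv ?_)
    rw [show (1 / 2 - 1 : ℝ) = -(1 / 2) by norm_num,
      show (-(3 / 2) : ℝ) = 1 / 2 - 2 by norm_num, Real.rpow_sub ht0, Real.rpow_two]
    simp only [div_eq_mul_inv, Pi.neg_apply]
    ring
  have hlim : Filter.Tendsto (fun t : ℝ => 2 * t ^ (1 / 2 : ℝ) * (Real.exp (-(a / t)) - 1))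
      Filter.atTop (nhds 0) := by
    refine squeeze_zero_norm' (a := fun t : ℝ => 2 * a * t ^ (-(1 / 2) : ℝ)) ?_ ?_
    · filter_upwards [Filter.eventually_gt_atTop 0] with t ht
      have h1 := exp_neg_bounds (div_nonneg ha.le ht.le)
      rw [Real.norm_eq_abs, abs_mul, abs_of_nonneg (by positivity)]
      have h2 : |Real.exp (-(a / t)) - 1| ≤ a / t := by rw [abs_le]; constructor <;> linarith
      calc 2 * t ^ (1 / 2 : ℝ) * |Real.exp (-(a / t)) - 1| ≤ 2 * t ^ (1 / 2 : ℝ) * (a / t) := by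
            gcongr
        _ = _ := by
            rw [show (-(1 / 2) : ℝ) = 1 / 2 - 1 by norm_num, Real.rpow_sub_one ht.ne']; ring
    · have := (tendsto_rpow_neg_atTop (y := 1 / 2) (by norm_num)).const_mul (2 * a)
      simpa using this
  have hcont : ContinuousWithinAt (fun t : ℝ => 2 * t ^ (1 / 2 : ℝ) * (Real.exp (-(a / t)) - 1))
      (Set.Ici 0) 0 := by
    rw [ContinuousWithinAt]
    rw [Real.zero_rpow (by norm_num), mul_zero, zero_mul]
    refine squeeze_zero_norm' (a := fun t : ℝ => 2 * t ^ (1 / 2 : ℝ)) ?_ ?_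
    · filter_upwards [self_mem_nhdsWithin] with t ht
      have ht0 : (0 : ℝ) ≤ t := ht
      have h1 := exp_neg_bounds (div_nonneg ha.le ht0)
      have h2 := Real.exp_pos (-(a / t))
      rw [Real.norm_eq_abs, abs_mul, abs_of_nonneg (by positivity)]
      refine mul_le_of_le_one_right (by positivity) ?_
      rw [abs_le]; constructor <;> linarith
    · have : Filter.Tendsto (fun t : ℝ => 2 * t ^ (1 / 2 : ℝ)) (nhds 0) (nhds (2 * 0 ^ (1 / 2 : ℝ))) :=
        ((Real.continuousAt_rpow_const 0 (1 / 2) (Or.inr (by norm_num))).tendsto).const_mul 2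
      rw [Real.zero_rpow (by norm_num), mul_zero] at this
      exact this.mono_left nhdsWithin_le_nhds
  have h := integral_Ioi_of_hasDerivAt_of_tendsto hcont hd (hi1.add hi2) hlim
  rw [integral_add hi1 hi2, integral_const_mul, integral_rpow_mul_exp_neg_div ha,
    Real.zero_rpow (by norm_num)] at h
  linarith

lemma integral_exp_sub_one_add {a b : ℝ} (ha : 0 < a) (hb : 0 < b) :
    ∫ t in Set.Ioi (0 : ℝ), (Real.exp (-(a / t)) - 1 + a / t * Real.exp (-(b / t))) =
      a * Real.log (a / b) - a := by
  have hi1 : IntegrableOn (fun t : ℝ => Real.exp (-(a / t)) - 1 + a / t * Real.exp (-(a / t)))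
      (Set.Ioi 0) := by
    refine integrableOn_Ioi_zero_of_le (α := 0) (β := -2) (C := 1 + a ^ 2)
      (by fun_prop) (by norm_num) (by norm_num) ?_ ?_
    · intro t ht _
      have h1 := exp_neg_bounds (div_nonneg ha.le ht.le)
      have h2 := Real.exp_pos (-(a / t))
      have h3 : 0 ≤ a / t * Real.exp (-(a / t)) := by positivity
      rw [Real.rpow_zero, mul_one, abs_le]
      constructor <;> nlinarith
    · intro t ht
      have ht0 : 0 < t := by linarith
      have hy : 0 ≤ a / t := by positivity
      have h1 := exp_neg_bounds hy
      have h2 := Real.exp_pos (-(a / t))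
      rw [Real.rpow_neg ht0.le, Real.rpow_two]
      have h4 : |Real.exp (-(a / t)) - 1 + a / t * Real.exp (-(a / t))| ≤ (a / t) ^ 2 := by
        rw [abs_le]; constructor <;> nlinarith
      refine h4.trans ?_
      rw [div_pow, div_eq_mul_inv]
      gcongr
      linarith
  have hi2 := (integrableOn_inv_mul_exp_sub_exp hb ha).const_mul a
  have hd : ∀ t ∈ Set.Ioi (0 : ℝ), HasDerivAt (fun t : ℝ => t * (Real.exp (-(a / t)) - 1))
      (Real.exp (-(a / t)) - 1 + a / t * Real.exp (-(a / t))) t := by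
    intro t ht
    have ht0 : (0 : ℝ) < t := ht
    have h2 := (((hasDerivAt_inv ht0.ne').const_mul a).neg.exp.sub_const 1)
    have h3 := (hasDerivAt_id t).mul h2
    refine h3.congr_deriv ?_
    simp only [div_eq_mul_inv, Pi.neg_apply, id]
    field_simp
  have hlim : Filter.Tendsto (fun t : ℝ => t * (Real.exp (-(a / t)) - 1))
      Filter.atTop (nhds (-a)) := by
    have hu : Filter.Tendsto (fun t : ℝ => -(a / (1 + a / t))) Filter.atTop (nhds (-a)) := by
      have h1 : Filter.Tendsto (fun t : ℝ => a / t) Filter.atTop (nhds 0) :=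
        tendsto_const_nhds.div_atTop Filter.tendsto_id
      have h2 := (tendsto_const_nhds (x := a)).div (h1.const_add 1) (by norm_num)
      simpa using h2.neg
    refine tendsto_of_tendsto_of_tendsto_of_le_of_le' tendsto_const_nhds hu ?_ ?_
    · filter_upwards [Filter.eventually_gt_atTop 0] with t ht
      have h1 := (exp_neg_bounds (div_nonneg ha.le ht.le)).2.1
      calc -a = t * (-(a / t)) := by field_simp
        _ ≤ _ := by gcongr; linarith
    · filter_upwards [Filter.eventually_gt_atTop 0] with t ht
      have hy : 0 ≤ a / t := by positivity
      have h1 := (exp_neg_bounds hy).2.2.2.2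
      rw [← le_div_iff₀' (by positivity)] at h1
      calc t * (Real.exp (-(a / t)) - 1) ≤ t * (1 / (1 + a / t) - 1) := by gcongr
        _ = _ := by field_simp; ring
  have hcont : ContinuousWithinAt (fun t : ℝ => t * (Real.exp (-(a / t)) - 1)) (Set.Ici 0) 0 := by
    rw [ContinuousWithinAt, zero_mul]
    refine squeeze_zero_norm' (a := fun t : ℝ => t) ?_
      (Filter.tendsto_id.mono_left nhdsWithin_le_nhds)
    filter_upwards [self_mem_nhdsWithin] with t ht
    have ht0 : (0 : ℝ) ≤ t := ht
    have h1 := exp_neg_bounds (div_nonneg ha.le ht0)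
    have h2 := Real.exp_pos (-(a / t))
    rw [Real.norm_eq_abs, abs_mul, abs_of_nonneg ht0]
    refine mul_le_of_le_one_right ht0 ?_
    rw [abs_le]; constructor <;> linarith
  have h := integral_Ioi_of_hasDerivAt_of_tendsto hcont hd hi1 hlim
  have e : ∀ t : ℝ, Real.exp (-(a / t)) - 1 + a / t * Real.exp (-(b / t)) =
      (Real.exp (-(a / t)) - 1 + a / t * Real.exp (-(a / t))) +
        a * (t⁻¹ * (Real.exp (-(b / t)) - Real.exp (-(a / t)))) := by
    intro t; ring
  simp_rw [e]
  rw [integral_add hi1 hi2, h, integral_const_mul, integral_inv_mul_exp_sub_exp hb ha, zero_mul]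
  ring

/-! ### Integral representations of the kernels by the heat kernel -/

lemma isHeatWeight_rpow {A κ : ℝ} (hA : 0 ≤ A) (hκ : 0 < κ) :
    IsHeatWeight (d := d) (fun t => A * t ^ (κ - 1))
      (fun k => A * ((1 / ‖k‖ ^ 2) ^ κ * Real.Gamma κ)) := by
  refine ⟨fun t ht => by positivity, fun k hk => ?_⟩
  have hk2 : 0 < ‖k‖ ^ 2 := by have := norm_pos_iff.2 hk; positivity
  have e : ∀ t : ℝ, A * t ^ (κ - 1) * Real.exp (-(t * ‖k‖ ^ 2)) =
      A * (t ^ (κ - 1) * Real.exp (-(‖k‖ ^ 2 * t))) := by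
    intro t; rw [mul_comm t (‖k‖ ^ 2)]; ring
  simp_rw [e]
  constructor
  · have := integrableOn_rpow_mul_exp_neg_mul_rpow (p := 1) (s := κ - 1) (b := ‖k‖ ^ 2)
      (by linarith) one_pos hk2
    simp only [Real.rpow_one, neg_mul] at this
    exact this.const_mul A
  · rw [integral_const_mul, Real.integral_rpow_mul_exp_neg_mul_Ioi hκ hk2]

lemma isHeatWeight_exp {lam : ℝ} (hlam : 0 < lam) :
    IsHeatWeight (d := d) (fun t => Real.exp (-(lam ^ 2 * t)))
      (fun k => 1 / (‖k‖ ^ 2 + lam ^ 2)) := by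
  refine ⟨fun t ht => by positivity, fun k hk => ?_⟩
  have hk2 : 0 < ‖k‖ ^ 2 + lam ^ 2 := by positivity
  have e : ∀ t : ℝ, Real.exp (-(lam ^ 2 * t)) * Real.exp (-(t * ‖k‖ ^ 2)) =
      Real.exp (-(‖k‖ ^ 2 + lam ^ 2) * t) := by
    intro t; rw [← Real.exp_add]; congr 1; ring
  simp_rw [e]
  refine ⟨integrableOn_exp_mul_Ioi (by linarith) 0, ?_⟩
  rw [integral_exp_mul_Ioi (by linarith), mul_zero, Real.exp_zero, neg_div_neg_eq]

lemma heat_two_eq {t : ℝ} (ht : 0 < t) (z : E 2) :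
    heat t z = (4 * Real.pi * t)⁻¹ * Real.exp (-(‖z‖ ^ 2 / 4 / t)) := by
  have := Real.pi_pos
  rw [heat, inv_pow, Real.sq_sqrt (by positivity), div_div]

lemma heat_three_eq {t : ℝ} (ht : 0 < t) (z : E 3) :
    heat t z = (√(4 * Real.pi))⁻¹ ^ 3 * (t ^ (-(3 / 2) : ℝ) * Real.exp (-(‖z‖ ^ 2 / 4 / t))) := by
  have := Real.pi_pos
  rw [heat, Real.sqrt_mul (by positivity), mul_inv, mul_pow, div_div, mul_assoc]
  congr 2
  rw [Real.sqrt_eq_rpow t, ← Real.rpow_neg ht.le, ← Real.rpow_natCast, ← Real.rpow_mul ht.le]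
  norm_num

lemma sqrt_pi_div_norm_sq (z : E d) : √(Real.pi / (‖z‖ ^ 2 / 4)) = √Real.pi * 2 / ‖z‖ := by
  rw [div_div_eq_mul_div, Real.sqrt_div (by have := Real.pi_pos; positivity),
    Real.sqrt_sq (norm_nonneg _), Real.sqrt_mul Real.pi_pos.le]
  congr 2
  rw [show (4 : ℝ) = 2 ^ 2 by norm_num, Real.sqrt_sq (by norm_num)]

lemma sqrt_four_pi_pow_three : √(4 * Real.pi) ^ 3 = 8 * Real.pi * √Real.pi := by
  have hpi := Real.pi_pos
  have h : √(4 * Real.pi) = 2 * √Real.pi := by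
    rw [Real.sqrt_mul (by norm_num), show (4 : ℝ) = 2 ^ 2 by norm_num, Real.sqrt_sq (by norm_num)]
  rw [h, mul_pow, pow_succ √Real.pi, Real.sq_sqrt hpi.le]
  ring

lemma coulomb_eq_integral {z : E 2} (hz : z ≠ 0) :
    1 / (2 * Real.pi * ‖z‖) =
      ∫ t in Set.Ioi (0 : ℝ), 1 / √Real.pi * t ^ (1 / 2 - 1 : ℝ) * heat t z := by
  have hpi := Real.pi_pos
  have hz' := norm_pos_iff.2 hz
  have e : ∀ t ∈ Set.Ioi (0 : ℝ), 1 / √Real.pi * t ^ (1 / 2 - 1 : ℝ) * heat t z =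
      1 / (4 * Real.pi * √Real.pi) * (t ^ (-(3 / 2) : ℝ) * Real.exp (-(‖z‖ ^ 2 / 4 / t))) := by
    intro t ht
    have ht0 : (0 : ℝ) < t := ht
    have h1 : t ^ (-(3 / 2) : ℝ) = t ^ (1 / 2 - 1 : ℝ) / t := by
      rw [← Real.rpow_sub_one ht0.ne']
      norm_num
    rw [heat_two_eq ht, h1]
    field_simp
  rw [setIntegral_congr_fun measurableSet_Ioi e, integral_const_mul,
    integral_rpow_mul_exp_neg_div (by positivity), sqrt_pi_div_norm_sq]
  field_simp
  norm_num

lemma poisson_three_eq_integral {z : E 3} (hz : z ≠ 0) :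
    1 / (4 * Real.pi * ‖z‖) = ∫ t in Set.Ioi (0 : ℝ), heat t z := by
  have hpi := Real.pi_pos
  have hz' := norm_pos_iff.2 hz
  rw [setIntegral_congr_fun measurableSet_Ioi fun t ht => heat_three_eq ht z, integral_const_mul,
    integral_rpow_mul_exp_neg_div (by positivity), sqrt_pi_div_norm_sq, inv_pow,
    sqrt_four_pi_pow_three]
  field_simp
  norm_num

lemma poisson_two_eq_integral {z : E 2} (hz : z ≠ 0) :
    -(1 / (2 * Real.pi)) * Real.log ‖z‖ = ∫ t in Set.Ioi (0 : ℝ),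
      (heat t z - (4 * Real.pi * t)⁻¹ * Real.exp (-(1 / 4 / t))) := by
  have hpi := Real.pi_pos
  have hz' := norm_pos_iff.2 hz
  have e : ∀ t ∈ Set.Ioi (0 : ℝ), heat t z - (4 * Real.pi * t)⁻¹ * Real.exp (-(1 / 4 / t)) =
      1 / (4 * Real.pi) * (t⁻¹ * (Real.exp (-(‖z‖ ^ 2 / 4 / t)) - Real.exp (-(1 / 4 / t)))) := by
    intro t ht
    rw [heat_two_eq ht, mul_inv]
    ring
  rw [setIntegral_congr_fun measurableSet_Ioi e, integral_const_mul,
    integral_inv_mul_exp_sub_exp (by positivity) (by norm_num), div_div_div_cancel_right₀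
    (by norm_num), one_div (‖z‖ ^ 2), Real.log_inv, Real.log_pow]
  push_cast
  field_simp
  ring

lemma biharmonic_three_eq_integral {z : E 3} (hz : z ≠ 0) :
    ‖z‖ / (8 * Real.pi) = -∫ t in Set.Ioi (0 : ℝ),
      (t * heat t z - (√(4 * Real.pi))⁻¹ ^ 3 * t ^ (-(1 / 2) : ℝ)) := by
  have hpi := Real.pi_pos
  have hz' := norm_pos_iff.2 hz
  have e : ∀ t ∈ Set.Ioi (0 : ℝ), t * heat t z - (√(4 * Real.pi))⁻¹ ^ 3 * t ^ (-(1 / 2) : ℝ) =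
      (√(4 * Real.pi))⁻¹ ^ 3 * (t ^ (-(1 / 2) : ℝ) * (Real.exp (-(‖z‖ ^ 2 / 4 / t)) - 1)) := by
    intro t ht
    have ht0 : (0 : ℝ) < t := ht
    rw [heat_three_eq ht, show (-(3 / 2) : ℝ) = -(1 / 2) - 1 by norm_num,
      Real.rpow_sub_one ht0.ne']
    field_simp
  rw [setIntegral_congr_fun measurableSet_Ioi e, integral_const_mul,
    integral_rpow_mul_exp_sub_one (by positivity), sqrt_pi_div_norm_sq, inv_pow,
    sqrt_four_pi_pow_three]
  field_simp
  ring

lemma biharmonic_two_eq_integral {z : E 2} (hz : z ≠ 0) :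
    -(‖z‖ ^ 2 / (8 * Real.pi)) * (Real.log ‖z‖ - 1) = -∫ t in Set.Ioi (0 : ℝ),
      (t * heat t z - 1 / (4 * Real.pi) -
        -(1 / (16 * Real.pi)) * t⁻¹ * Real.exp (-(Real.exp 1 / 4 / t)) * ‖z‖ ^ 2) := by
  have hpi := Real.pi_pos
  have hz' := norm_pos_iff.2 hz
  have e : ∀ t ∈ Set.Ioi (0 : ℝ), t * heat t z - 1 / (4 * Real.pi) -
        -(1 / (16 * Real.pi)) * t⁻¹ * Real.exp (-(Real.exp 1 / 4 / t)) * ‖z‖ ^ 2 =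
      1 / (4 * Real.pi) * (Real.exp (-(‖z‖ ^ 2 / 4 / t)) - 1 +
        ‖z‖ ^ 2 / 4 / t * Real.exp (-(Real.exp 1 / 4 / t))) := by
    intro t ht
    have ht0 : (0 : ℝ) < t := ht
    rw [heat_two_eq ht]
    field_simp
    ring
  rw [setIntegral_congr_fun measurableSet_Ioi e, integral_const_mul,
    integral_exp_sub_one_add (by positivity) (by positivity), div_div_div_cancel_right₀
    (by norm_num), Real.log_div (by positivity) (by positivity), Real.log_exp, Real.log_pow]
  push_cast
  field_simp
  ring

lemma integral_Ioi_eq_integral_exp {c : ℝ} (hc : 0 < c) (g : ℝ → ℝ) :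
    ∫ t in Set.Ioi (0 : ℝ), g t = ∫ u : ℝ, c * Real.exp u * g (c * Real.exp u) := by
  have himg : (fun u : ℝ => c * Real.exp u) '' Set.univ = Set.Ioi 0 := by
    ext t
    simp only [Set.image_univ, Set.mem_range, Set.mem_Ioi]
    constructor
    · rintro ⟨u, rfl⟩; positivity
    · intro ht
      refine ⟨Real.log (t / c), ?_⟩
      rw [Real.exp_log (by positivity)]
      field_simp
  have h := integral_image_eq_integral_abs_deriv_smul (s := Set.univ)
    (f := fun u : ℝ => c * Real.exp u) (f' := fun u => c * Real.exp u) MeasurableSet.univ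
    (fun u _ => ((Real.hasDerivAt_exp u).const_mul c).hasDerivWithinAt)
    (fun u _ v _ huv => Real.exp_injective (mul_left_cancel₀ hc.ne' huv)) g
  rw [himg, setIntegral_univ] at h
  rw [h]
  refine integral_congr_ae (.of_forall fun u => ?_)
  simp only [smul_eq_mul]
  rw [abs_of_pos (by positivity)]

lemma yukawa_exponent {lam r : ℝ} (hlam : 0 < lam) (hr : 0 < r) (u : ℝ) :
    Real.exp (-(lam ^ 2 * (r / (2 * lam) * Real.exp u))) *
      Real.exp (-(r ^ 2 / 4 / (r / (2 * lam) * Real.exp u))) =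
      Real.exp (-(lam * r * Real.cosh u)) := by
  rw [← Real.exp_add, Real.cosh_eq, Real.exp_neg u]
  congr 1
  have := Real.exp_pos u
  field_simp
  ring

lemma yukawa_two_eq_integral {lam : ℝ} (hlam : 0 < lam) {z : E 2} (hz : z ≠ 0) :
    1 / (2 * Real.pi) * besselK0 (lam * ‖z‖) =
      ∫ t in Set.Ioi (0 : ℝ), Real.exp (-(lam ^ 2 * t)) * heat t z := by
  have hpi := Real.pi_pos
  have hz' := norm_pos_iff.2 hz
  have e : ∀ t ∈ Set.Ioi (0 : ℝ), Real.exp (-(lam ^ 2 * t)) * heat t z =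
      Real.exp (-(lam ^ 2 * t)) * ((4 * Real.pi * t)⁻¹ * Real.exp (-(‖z‖ ^ 2 / 4 / t))) :=
    fun t ht => by rw [heat_two_eq ht]
  rw [setIntegral_congr_fun measurableSet_Ioi e, integral_Ioi_eq_integral_exp
    (c := ‖z‖ / (2 * lam)) (by positivity)]
  have e2 : ∀ u : ℝ, ‖z‖ / (2 * lam) * Real.exp u *
      (Real.exp (-(lam ^ 2 * (‖z‖ / (2 * lam) * Real.exp u))) *
        ((4 * Real.pi * (‖z‖ / (2 * lam) * Real.exp u))⁻¹ *
          Real.exp (-(‖z‖ ^ 2 / 4 / (‖z‖ / (2 * lam) * Real.exp u))))) =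
      1 / (4 * Real.pi) * Real.exp (-(lam * ‖z‖ * Real.cosh |u|)) := by
    intro u
    rw [Real.cosh_abs, ← yukawa_exponent hlam hz' u]
    have := Real.exp_pos u
    field_simp
  simp_rw [e2]
  rw [integral_const_mul, integral_comp_abs (f := fun u => Real.exp (-(lam * ‖z‖ * Real.cosh u))),
    besselK0]
  ring

lemma integral_cosh_half_mul_exp (s : ℝ) :
    ∫ u : ℝ, Real.cosh (u / 2) * Real.exp (-(s * Real.cosh u)) =
      2 * (Real.exp (-s) * √(Real.pi / (2 * s))) := by
  have himg : (fun u : ℝ => Real.sinh (u / 2)) '' Set.univ = Set.univ := by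
    rw [Set.image_univ, Set.range_eq_univ]
    intro v
    obtain ⟨u, hu⟩ := Real.sinh_surjective v
    exact ⟨2 * u, by simpa using hu⟩
  have h := integral_image_eq_integral_abs_deriv_smul (s := Set.univ)
    (f := fun u : ℝ => Real.sinh (u / 2)) (f' := fun u => Real.cosh (u / 2) * (1 / 2))
    MeasurableSet.univ
    (fun u _ => (((hasDerivAt_id u).div_const 2).sinh).hasDerivWithinAt)
    (fun u _ v _ huv => by
      have := Real.sinh_injective huv
      linarith) (fun v => Real.exp (-(2 * s) * v ^ 2))
  rw [himg, setIntegral_univ, setIntegral_univ, integral_gaussian] at h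
  rw [h, ← integral_const_mul, ← integral_const_mul]
  refine integral_congr_ae (.of_forall fun u => ?_)
  simp only [smul_eq_mul]
  have hc := Real.cosh_pos (u / 2)
  rw [abs_of_pos (by positivity)]
  have e : Real.exp (-(s * Real.cosh u)) =
      Real.exp (-s) * Real.exp (-(2 * s) * Real.sinh (u / 2) ^ 2) := by
    rw [← Real.exp_add]
    congr 1
    have h1 := Real.cosh_two_mul (u / 2)
    have h2 := Real.cosh_sq (u / 2)
    rw [show 2 * (u / 2) = u by ring] at h1
    rw [h1, h2]
    ring
  rw [e]
  ring

lemma integral_exp_neg_half_mul_exp {s : ℝ} (hs : 0 < s) :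
    ∫ u : ℝ, Real.exp (-(u / 2)) * Real.exp (-(s * Real.cosh u)) =
      2 * (Real.exp (-s) * √(Real.pi / (2 * s))) := by
  have hpos : 0 < 2 * (Real.exp (-s) * √(Real.pi / (2 * s))) := by
    have : 0 < √(Real.pi / (2 * s)) := Real.sqrt_pos.2 (div_pos Real.pi_pos (by positivity))
    positivity
  have hi1 : Integrable fun u : ℝ => Real.cosh (u / 2) * Real.exp (-(s * Real.cosh u)) := by
    by_contra h
    have h1 := integral_cosh_half_mul_exp s
    rw [integral_undef h] at h1
    exact hpos.ne h1
  have hi2 : Integrable fun u : ℝ => Real.sinh (u / 2) * Real.exp (-(s * Real.cosh u)) := by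
    refine hi1.mono' (by fun_prop) (.of_forall fun u => ?_)
    rw [norm_mul, Real.norm_of_nonneg (Real.exp_pos _).le, Real.norm_eq_abs]
    gcongr
    have h1 := Real.cosh_sq (u / 2)
    exact abs_le_of_sq_le_sq (by linarith) (Real.cosh_pos _).le
  have hodd : ∫ u : ℝ, Real.sinh (u / 2) * Real.exp (-(s * Real.cosh u)) = 0 := by
    have h := integral_neg_eq_self
      (fun u : ℝ => Real.sinh (u / 2) * Real.exp (-(s * Real.cosh u))) volume
    have e : ∀ u : ℝ, Real.sinh (-u / 2) * Real.exp (-(s * Real.cosh (-u))) =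
        -(Real.sinh (u / 2) * Real.exp (-(s * Real.cosh u))) := by
      intro u; rw [neg_div, Real.sinh_neg, Real.cosh_neg]; ring
    simp_rw [e] at h
    rw [integral_neg] at h
    linarith
  rw [← integral_cosh_half_mul_exp s]
  have e : ∀ u : ℝ, Real.exp (-(u / 2)) * Real.exp (-(s * Real.cosh u)) =
      Real.cosh (u / 2) * Real.exp (-(s * Real.cosh u)) -
        Real.sinh (u / 2) * Real.exp (-(s * Real.cosh u)) := by
    intro u; rw [← sub_mul, Real.cosh_sub_sinh]
  simp_rw [e]
  rw [integral_sub hi1 hi2, hodd, sub_zero]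

lemma yukawa_three_eq_integral {lam : ℝ} (hlam : 0 < lam) {z : E 3} (hz : z ≠ 0) :
    1 / (4 * Real.pi * ‖z‖) * Real.exp (-(lam * ‖z‖)) =
      ∫ t in Set.Ioi (0 : ℝ), Real.exp (-(lam ^ 2 * t)) * heat t z := by
  have hpi := Real.pi_pos
  have hz' := norm_pos_iff.2 hz
  have e : ∀ t ∈ Set.Ioi (0 : ℝ), Real.exp (-(lam ^ 2 * t)) * heat t z =
      Real.exp (-(lam ^ 2 * t)) * ((√(4 * Real.pi))⁻¹ ^ 3 * (t ^ (-(3 / 2) : ℝ) *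
        Real.exp (-(‖z‖ ^ 2 / 4 / t)))) :=
    fun t ht => by rw [heat_three_eq ht]
  set c : ℝ := ‖z‖ / (2 * lam) with hc
  have hc0 : 0 < c := by positivity
  rw [setIntegral_congr_fun measurableSet_Ioi e, integral_Ioi_eq_integral_exp hc0]
  have e2 : ∀ u : ℝ, c * Real.exp u * (Real.exp (-(lam ^ 2 * (c * Real.exp u))) *
        ((√(4 * Real.pi))⁻¹ ^ 3 * ((c * Real.exp u) ^ (-(3 / 2) : ℝ) *
          Real.exp (-(‖z‖ ^ 2 / 4 / (c * Real.exp u)))))) =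
      (√(4 * Real.pi))⁻¹ ^ 3 * (√c)⁻¹ *
        (Real.exp (-(u / 2)) * Real.exp (-(lam * ‖z‖ * Real.cosh u))) := by
    intro u
    rw [← yukawa_exponent hlam hz' u, ← hc]
    have hp : c * Real.exp u * (c * Real.exp u) ^ (-(3 / 2) : ℝ) =
        (√c)⁻¹ * Real.exp (-(u / 2)) := by
      have h0 : 0 < c * Real.exp u := by positivity
      rw [show (-(3 / 2) : ℝ) = -(1 / 2) - 1 by norm_num, Real.rpow_sub_one h0.ne',
        mul_div_cancel₀ _ h0.ne', Real.mul_rpow hc0.le (Real.exp_pos u).le, ← Real.exp_mul,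
        Real.sqrt_eq_rpow, ← Real.rpow_neg hc0.le]
      congr 2
      ring
    linear_combination (√(4 * Real.pi))⁻¹ ^ 3 * Real.exp (-(lam ^ 2 * (c * Real.exp u))) *
      Real.exp (-(‖z‖ ^ 2 / 4 / (c * Real.exp u))) * hp
  simp_rw [e2]
  rw [integral_const_mul, integral_exp_neg_half_mul_exp (by positivity), inv_pow,
    sqrt_four_pi_pow_three]
  have h3 : √(Real.pi / (2 * (lam * ‖z‖))) = √Real.pi * √c / ‖z‖ := by
    rw [← Real.sqrt_mul hpi.le]
    have : Real.pi / (2 * (lam * ‖z‖)) = (Real.pi * c) / ‖z‖ ^ 2 := by rw [hc]; field_simp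
    rw [this, Real.sqrt_div (by positivity), Real.sqrt_sq hz'.le]
  have h4 : √c ≠ 0 := (Real.sqrt_pos.2 hc0).ne'
  have h5 : √Real.pi ≠ 0 := (Real.sqrt_pos.2 hpi).ne'
  rw [h3]
  field_simp
  norm_num

/-! ### Potentials as superpositions of heat potentials -/

lemma IsHeatWeight.abs_node_le {w : ℝ → ℝ} {f : E d → ℝ} (hw : IsHeatWeight w f) (hd : 0 < d)
    {L : ℝ} (hL : 0 < L) (p : Fin d → ℤ) :
    |f (node L p)| ≤ f (EuclideanSpace.single ⟨0, hd⟩ (1 / L)) := by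
  have h1 : ‖EuclideanSpace.single (⟨0, hd⟩ : Fin d) (1 / L)‖ = 1 / L := by
    rw [PiLp.norm_single, Real.norm_of_nonneg (by positivity)]
  have h0 : EuclideanSpace.single (⟨0, hd⟩ : Fin d) (1 / L) ≠ 0 := by
    rw [← norm_pos_iff, h1]; positivity
  obtain ⟨hi, he⟩ := hw.2 _ (node_ne_zero hL hd p)
  obtain ⟨hi', he'⟩ := hw.2 _ h0
  rw [← he, ← he', abs_of_nonneg (setIntegral_nonneg measurableSet_Ioi fun t ht =>
        mul_nonneg (hw.1 t ht) (Real.exp_pos _).le)]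
  refine setIntegral_mono_on hi hi' measurableSet_Ioi fun t ht => ?_
  have ht0 : (0 : ℝ) < t := ht
  refine mul_le_mul_of_nonneg_left (Real.exp_le_exp.2 ?_) (hw.1 t ht)
  have := (norm_node_ge hL hd p).1
  rw [h1]
  gcongr

/-- The kernel `U` is the superposition, with weight `w`, of heat kernels that are renormalized
by subtracting `c₀ t + c₂ t |z|²`. -/
structure IsHeatRepresentation (U : E d → ℝ) (w c₀ c₂ : ℝ → ℝ) : Prop where
  measurable_w : Measurable w
  measurable_c₀ : Measurable c₀
  measurable_c₂ : Measurable c₂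
  nonneg : ∀ t, 0 < t → 0 ≤ w t
  integrable_w : IntegrableOn w (Set.Ioc 0 1)
  integrable_c₀ : IntegrableOn c₀ (Set.Ioc 0 1)
  integrable_c₂ : IntegrableOn c₂ (Set.Ioc 0 1)
  eq_integral : ∀ z, z ≠ 0 → U z = ∫ t in Set.Ioi 0, (w t * heat t z - c₀ t - c₂ t * ‖z‖ ^ 2)
  bound : ∀ R : ℝ, ∃ G : ℝ → ℝ, IntegrableOn G (Set.Ioi 1) ∧ ∀ t, 1 < t → ∀ z : E d, ‖z‖ ≤ R →
    |w t * heat t z - c₀ t - c₂ t * ‖z‖ ^ 2| ≤ G t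

/-- The integral `∫ |x - y|² ρ(y) dy`. -/
def secondMoment (ρ : E d → ℝ) (x : E d) : ℝ := ∫ y, ‖x - y‖ ^ 2 * ρ y

lemma measurable_heat_uncurry (x : E d) :
    Measurable fun q : ℝ × E d => heat q.1 (x - q.2) := by
  unfold heat
  fun_prop

lemma IsHeatRepresentation.integrable_and_conv_eq {U : E d → ℝ} {w c₀ c₂ : ℝ → ℝ}
    (h : IsHeatRepresentation U w c₀ c₂) (hd : 0 < d) {ρ : E d → ℝ} (hc : Continuous ρ)
    (hs : HasCompactSupport ρ) (h0 : ∫ y, ρ y = 0) (x : E d) :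
    IntegrableOn (fun t => w t * conv (heat t) ρ x + -(c₂ t * secondMoment ρ x)) (Set.Ioi 0) ∧
      conv U ρ x =
        ∫ t in Set.Ioi 0, (w t * conv (heat t) ρ x + -(c₂ t * secondMoment ρ x)) := by
  obtain ⟨R, hR, hRρ⟩ := exists_norm_le_of_hasCompactSupport hs
  obtain ⟨B, hB⟩ := hc.bounded_above_of_compact_support hs
  have hint : Integrable ρ := hc.integrable_of_hasCompactSupport hs
  set I : ℝ := ∫ y, |ρ y| with hI
  obtain ⟨G, hG, hGb⟩ := h.bound (‖x‖ + R)
  set f : ℝ → E d → ℝ := fun t y =>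
    (w t * heat t (x - y) - c₀ t - c₂ t * ‖x - y‖ ^ 2) * ρ y with hf
  have hmeas : Measurable (Function.uncurry f) := by
    have h1 := h.measurable_w
    have h2 := h.measurable_c₀
    have h3 := h.measurable_c₂
    have h4 := measurable_heat_uncurry x
    have h5 := hc.measurable
    refine Measurable.mul (((h1.comp measurable_fst).mul h4).sub (h2.comp measurable_fst) |>.sub
      ((h3.comp measurable_fst).mul ?_)) (h5.comp measurable_snd)
    fun_prop
  have hfint : ∀ t, Integrable (f t) := fun t =>
    Continuous.integrable_of_hasCompactSupport (by fun_prop) hs.mul_left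
  have hfeq : ∀ t, ∫ y, f t y = w t * conv (heat t) ρ x + -(c₂ t * secondMoment ρ x) := by
    intro t
    have e : ∀ y, f t y = w t * (heat t (x - y) * ρ y) - c₀ t * ρ y -
        c₂ t * (‖x - y‖ ^ 2 * ρ y) := fun y => by rw [hf]; ring
    have i1 : Integrable fun y => heat t (x - y) * ρ y :=
      Continuous.integrable_of_hasCompactSupport (by fun_prop) hs.mul_left
    have i2 : Integrable fun y => ‖x - y‖ ^ 2 * ρ y :=
      Continuous.integrable_of_hasCompactSupport (by fun_prop) hs.mul_left
    have i3 : Integrable fun y => w t * (heat t (x - y) * ρ y) - c₀ t * ρ y :=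
      (i1.const_mul _).sub (hint.const_mul _)
    simp_rw [e]
    rw [integral_sub i3 (i2.const_mul _),
      integral_sub (i1.const_mul _) (hint.const_mul _), integral_const_mul, integral_const_mul,
      integral_const_mul, h0, conv, secondMoment]
    ring
  have hprod : Integrable (Function.uncurry f) ((volume.restrict (Set.Ioi 0)).prod volume) := by
    rw [integrable_prod_iff hmeas.aestronglyMeasurable]
    refine ⟨.of_forall hfint, ?_⟩
    have hm : AEStronglyMeasurable (fun t => ∫ y, ‖Function.uncurry f (t, y)‖)
        (volume.restrict (Set.Ioi 0)) := by
      have h1 : AEStronglyMeasurable (fun q : ℝ × E d => ‖Function.uncurry f q‖)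
          ((volume.restrict (Set.Ioi 0)).prod volume) := hmeas.norm.aestronglyMeasurable
      exact h1.integral_prod_right'
    change IntegrableOn _ (Set.Ioi (0 : ℝ)) volume
    rw [← Set.Ioc_union_Ioi_eq_Ioi (zero_le_one (α := ℝ)), integrableOn_union]
    constructor
    · refine Integrable.mono' (g := fun t => w t * B + |c₀ t| * I + |c₂ t| * ((‖x‖ + R) ^ 2 * I))
        (((h.integrable_w.mul_const B).add (h.integrable_c₀.abs.mul_const I)).add
          (h.integrable_c₂.abs.mul_const _))
        (hm.mono_measure (Measure.restrict_mono Set.Ioc_subset_Ioi_self le_rfl)) ?_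
      refine (ae_restrict_iff' measurableSet_Ioc).2 (.of_forall fun t ht => ?_)
      rw [Real.norm_of_nonneg (integral_nonneg fun y => norm_nonneg _)]
      have i1 : Integrable fun y => heat t (x - y) * |ρ y| :=
        Continuous.integrable_of_hasCompactSupport (by fun_prop)
          (HasCompactSupport.mul_left (f' := fun y => |ρ y|) hs.norm)
      have i2 : Integrable fun y => w t * (heat t (x - y) * |ρ y|) + |c₀ t| * |ρ y| +
          |c₂ t| * ((‖x‖ + R) ^ 2 * |ρ y|) :=
        ((i1.const_mul _).add (hint.abs.const_mul _)).add ((hint.abs.const_mul _).const_mul _)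
      calc ∫ y, ‖Function.uncurry f (t, y)‖ ≤ ∫ y, (w t * (heat t (x - y) * |ρ y|) +
            |c₀ t| * |ρ y| + |c₂ t| * ((‖x‖ + R) ^ 2 * |ρ y|)) := by
            refine integral_mono (hfint t).norm i2 fun y => ?_
            simp only [Function.uncurry, hf]
            by_cases hy : ρ y = 0
            · simp [hy]
            have hxy : ‖x - y‖ ^ 2 ≤ (‖x‖ + R) ^ 2 := by
              have := norm_sub_le x y
              have := hRρ y hy
              gcongr
              linarith
            rw [norm_mul, Real.norm_eq_abs (ρ y)]
            have h1 : ‖w t * heat t (x - y) - c₀ t - c₂ t * ‖x - y‖ ^ 2‖ ≤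
                w t * heat t (x - y) + |c₀ t| + |c₂ t| * (‖x‖ + R) ^ 2 := by
              refine (norm_sub_le _ _).trans (add_le_add ((norm_sub_le _ _).trans ?_) ?_)
              · rw [Real.norm_of_nonneg (mul_nonneg (h.nonneg t ht.1) (heat_nonneg _ _)),
                  Real.norm_eq_abs]
              · rw [norm_mul, Real.norm_eq_abs, Real.norm_of_nonneg (by positivity)]
                gcongr
            calc _ ≤ (w t * heat t (x - y) + |c₀ t| + |c₂ t| * (‖x‖ + R) ^ 2) * |ρ y| := by gcongr
              _ = _ := by ring
        _ = w t * (∫ y, heat t (x - y) * |ρ y|) + |c₀ t| * I + |c₂ t| * ((‖x‖ + R) ^ 2 * I) := by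
            have i3 : Integrable fun y => w t * (heat t (x - y) * |ρ y|) + |c₀ t| * |ρ y| :=
              (i1.const_mul _).add (hint.abs.const_mul _)
            rw [integral_add i3 ((hint.abs.const_mul _).const_mul _), integral_add (i1.const_mul _)
              (hint.abs.const_mul _), integral_const_mul, integral_const_mul, integral_const_mul,
              integral_const_mul]
        _ ≤ _ := by
            have := h.nonneg t ht.1
            gcongr
            exact integral_heat_mul_abs_le (fun y => hB y) ht.1 x
    · refine Integrable.mono' (g := fun t => G t * I) (hG.mul_const I)
        (hm.mono_measure (Measure.restrict_mono (Set.Ioi_subset_Ioi zero_le_one) le_rfl)) ?_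
      refine (ae_restrict_iff' measurableSet_Ioi).2 (.of_forall fun t ht => ?_)
      rw [Real.norm_of_nonneg (integral_nonneg fun y => norm_nonneg _), hI, ← integral_const_mul]
      refine integral_mono (hfint t).norm (hint.abs.const_mul _) fun y => ?_
      simp only [Function.uncurry, hf]
      by_cases hy : ρ y = 0
      · simp [hy]
      rw [norm_mul, Real.norm_eq_abs, Real.norm_eq_abs]
      gcongr
      exact hGb t ht _ ((norm_sub_le x y).trans (by linarith [hRρ y hy]))
  constructor
  · have := hprod.integral_prod_left
    simp only [Function.uncurry] at this
    simp_rw [hfeq] at this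
    exact this
  · simp_rw [← hfeq]
    rw [integral_integral_swap hprod, conv]
    have : Nonempty (Fin d) := ⟨⟨0, hd⟩⟩
    have hne : ∀ᵐ y : E d, y ≠ x := by
      rw [ae_iff]
      simp
    refine integral_congr_ae ?_
    filter_upwards [hne] with y hy
    rw [h.eq_integral _ (sub_ne_zero.2 hy.symm), ← integral_mul_const]

lemma IsHeatRepresentation.exists_fullSum_sub_conv_le {U f : E d → ℝ} {w c₀ c₂ : ℝ → ℝ}
    (h : IsHeatRepresentation U w c₀ c₂) (hw : IsHeatWeight w f)
    (hd : 0 < d) {κ A : ℝ} (hκ : 0 < κ) (hA : 0 ≤ A) (hwA : ∀ t, 0 < t → w t ≤ A * t ^ (κ - 1))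
    (hc₂ : ∀ L : ℝ, IntegrableOn c₂ (Set.Ioc 0 L))
    {m : ℕ} {ρ : E d → ℝ} (hm : VanishingMoments m ρ)
    (hρ : ContDiff ℝ ∞ ρ) (hs : HasCompactSupport ρ) :
    ∃ C : ℝ, 0 ≤ C ∧ ∀ L : ℝ, 0 < L → ∀ x ∈ box d L,
      ‖fullSum f ρ L x - (conv U ρ x : ℂ)‖ ≤
        C * L ^ (2 * κ - (d + m + 1)) +
          |(∫ t in Set.Ioc 0 (L ^ 2), -(c₂ t * secondMoment ρ x)) +
          ∫ t in Set.Ioi (L ^ 2), (w t * conv (heat t) ρ x + -(c₂ t * secondMoment ρ x))| := by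
  obtain ⟨C, hC, hb⟩ := hw.exists_fullSum_sub_le hκ hA hwA hm hρ hs hd
  have h0 : ∫ y, ρ y = 0 := by
    have := hm 0 (by simp)
    simpa [monomial] using this
  refine ⟨C, hC, fun L hL x hx => ?_⟩
  obtain ⟨hi, he⟩ := h.integrable_and_conv_eq hd hρ.continuous hs h0 x
  rw [he]
  exact hb L hL x hx _ (hw.abs_node_le hd hL) _ hi ((hc₂ _).mul_const _).neg

/-- If the heat potentials decay fast enough, no renormalization enters the error. -/
lemma IsHeatRepresentation.exists_fullSum_sub_conv_le_rpow {U f : E d → ℝ} {w c₀ c₂ : ℝ → ℝ}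
    (h : IsHeatRepresentation U w c₀ c₂) (hw : IsHeatWeight w f)
    (hd : 0 < d) {κ A : ℝ} (hκ : 0 < κ) (hA : 0 ≤ A) (hwA : ∀ t, 0 < t → w t ≤ A * t ^ (κ - 1))
    (hc₂ : ∀ L : ℝ, IntegrableOn c₂ (Set.Ioc 0 L))
    {m : ℕ} {ρ : E d → ℝ} (hm : VanishingMoments m ρ)
    (hρ : ContDiff ℝ ∞ ρ) (hs : HasCompactSupport ρ) (hκm : 2 * κ < d + m + 1)
    (hc₂ρ : ∀ t x, c₂ t * secondMoment ρ x = 0) :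
    ∃ C : ℝ, 0 ≤ C ∧ ∀ L : ℝ, 0 < L → ∀ x ∈ box d L,
      ‖fullSum f ρ L x - (conv U ρ x : ℂ)‖ ≤ C * L ^ (2 * κ - (d + m + 1)) := by
  obtain ⟨C, hC, hb⟩ := h.exists_fullSum_sub_conv_le hw hd hκ hA hwA hc₂ hm hρ hs
  obtain ⟨C', hC', hb'⟩ := hm.exists_integral_heat_le hρ.continuous hs hA h.nonneg hwA hκm
  refine ⟨C + C', by positivity, fun L hL x hx => ?_⟩
  have h1 := hb L hL x hx
  simp only [hc₂ρ, neg_zero, add_zero, integral_zero, zero_add] at h1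
  rw [add_mul]
  exact h1.trans (add_le_add_right (hb' L hL x) _)

/-! ### Heat representations of the kernels without screening -/

lemma heat_two_le {t : ℝ} (ht : 0 < t) (z : E 2) : heat t z ≤ t⁻¹ := by
  have hpi := Real.pi_gt_three
  rw [heat_two_eq ht]
  have h1 : Real.exp (-(‖z‖ ^ 2 / 4 / t)) ≤ 1 := (exp_neg_bounds (by positivity)).2.2.1
  calc (4 * Real.pi * t)⁻¹ * Real.exp (-(‖z‖ ^ 2 / 4 / t)) ≤ (4 * Real.pi * t)⁻¹ * 1 := by gcongr
    _ ≤ t⁻¹ := by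
      rw [mul_one]
      exact inv_anti₀ ht (by nlinarith)

lemma inv_sqrt_four_pi_pow_le : (√(4 * Real.pi))⁻¹ ^ 3 ≤ 1 := by
  refine pow_le_one₀ (by positivity) (inv_le_one_of_one_le₀ ?_)
  rw [Real.one_le_sqrt]
  linarith [Real.pi_gt_three]

lemma heat_three_le {t : ℝ} (ht : 0 < t) (z : E 3) : heat t z ≤ t ^ (-(3 / 2) : ℝ) := by
  rw [heat_three_eq ht]
  have h1 : Real.exp (-(‖z‖ ^ 2 / 4 / t)) ≤ 1 := (exp_neg_bounds (by positivity)).2.2.1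
  have h2 := inv_sqrt_four_pi_pow_le
  calc (√(4 * Real.pi))⁻¹ ^ 3 * (t ^ (-(3 / 2) : ℝ) * Real.exp (-(‖z‖ ^ 2 / 4 / t)))
      ≤ 1 * (t ^ (-(3 / 2) : ℝ) * 1) := by gcongr
    _ = _ := by ring

lemma integrableOn_Ioc_rpow {s : ℝ} (hs : -1 < s) : IntegrableOn (fun t : ℝ => t ^ s) (Set.Ioc 0 1) := by
  rw [← intervalIntegrable_iff_integrableOn_Ioc_of_le zero_le_one]
  exact intervalIntegral.intervalIntegrable_rpow' hs

lemma integrableOn_Ioc_of_bounded {f : ℝ → ℝ} (hf : Measurable f) {C : ℝ}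
    (h : ∀ t, 0 < t → |f t| ≤ C) (L : ℝ) : IntegrableOn f (Set.Ioc 0 L) := by
  refine Integrable.mono' (g := fun _ => C) (by simp) hf.aestronglyMeasurable ?_
  exact (ae_restrict_iff' measurableSet_Ioc).2 (.of_forall fun t ht => h t ht.1)

lemma inv_mul_exp_neg_div_le {b t : ℝ} (hb : 0 < b) (ht : 0 < t) :
    t⁻¹ * Real.exp (-(b / t)) ≤ 1 / b := by
  have h1 := (exp_neg_bounds (div_nonneg hb.le ht.le)).2.2.2.1
  rw [le_div_iff₀ hb]
  calc _ = b / t * Real.exp (-(b / t)) := by ring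
    _ ≤ 1 := h1

lemma isHeatRepresentation_coulomb :
    IsHeatRepresentation (Kernel.U .coulomb2) (fun t => 1 / √Real.pi * t ^ (1 / 2 - 1 : ℝ))
      (fun _ => 0) (fun _ => 0) where
  measurable_w := by fun_prop
  measurable_c₀ := by fun_prop
  measurable_c₂ := by fun_prop
  nonneg t ht := by positivity
  integrable_w := (integrableOn_Ioc_rpow (by norm_num)).const_mul _
  integrable_c₀ := by simp
  integrable_c₂ := by simp
  eq_integral z hz := by
    simp only [zero_mul, sub_zero]
    exact coulomb_eq_integral hz
  bound R := by
    refine ⟨fun t => t ^ (-(3 / 2) : ℝ), integrableOn_Ioi_rpow_of_lt (by norm_num) one_pos, ?_⟩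
    intro t ht z _
    have ht0 : 0 < t := by linarith
    have h1 : 1 / √Real.pi ≤ 1 := by
      rw [div_le_one (Real.sqrt_pos.2 Real.pi_pos), Real.one_le_sqrt]
      linarith [Real.pi_gt_three]
    have h0 := heat_nonneg t z
    rw [zero_mul, sub_zero, sub_zero, abs_of_nonneg (by positivity)]
    calc 1 / √Real.pi * t ^ (1 / 2 - 1 : ℝ) * heat t z ≤ 1 * t ^ (1 / 2 - 1 : ℝ) * t⁻¹ := by
          gcongr
          exact heat_two_le ht0 z
      _ = _ := by
          rw [one_mul, ← Real.rpow_neg_one, ← Real.rpow_add ht0]; norm_num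

lemma isHeatRepresentation_poisson_three :
    IsHeatRepresentation (Kernel.U .poisson3) (fun t => 1 * t ^ (1 - 1 : ℝ))
      (fun _ => 0) (fun _ => 0) where
  measurable_w := by fun_prop
  measurable_c₀ := by fun_prop
  measurable_c₂ := by fun_prop
  nonneg t ht := by positivity
  integrable_w := by simp
  integrable_c₀ := by simp
  integrable_c₂ := by simp
  eq_integral z hz := by
    simp only [zero_mul, sub_zero, sub_self, Real.rpow_zero, one_mul]
    exact poisson_three_eq_integral hz
  bound R := by
    refine ⟨fun t => t ^ (-(3 / 2) : ℝ), integrableOn_Ioi_rpow_of_lt (by norm_num) one_pos, ?_⟩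
    intro t ht z _
    have ht0 : 0 < t := by linarith
    simp only [zero_mul, sub_zero, sub_self, Real.rpow_zero, one_mul]
    rw [abs_of_nonneg (heat_nonneg t z)]
    exact heat_three_le ht0 z

lemma isHeatRepresentation_poisson_two :
    IsHeatRepresentation (Kernel.U .poisson2) (fun t => 1 * t ^ (1 - 1 : ℝ))
      (fun t => (4 * Real.pi * t)⁻¹ * Real.exp (-(1 / 4 / t))) (fun _ => 0) where
  measurable_w := by fun_prop
  measurable_c₀ := by fun_prop
  measurable_c₂ := by fun_prop
  nonneg t ht := by positivity
  integrable_w := by simp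
  integrable_c₀ := by
    refine integrableOn_Ioc_of_bounded (by fun_prop) (C := (4 * Real.pi)⁻¹ * (1 / (1 / 4)))
      (fun t ht => ?_) 1
    have hpi := Real.pi_pos
    rw [abs_of_nonneg (by positivity), mul_inv, mul_assoc]
    gcongr
    exact inv_mul_exp_neg_div_le (by norm_num) ht
  integrable_c₂ := by simp
  eq_integral z hz := by
    simp only [zero_mul, sub_zero, sub_self, Real.rpow_zero, one_mul]
    exact poisson_two_eq_integral hz
  bound R := by
    refine ⟨fun t => (R ^ 2 / 4 + 1 / 4) * t ^ (-2 : ℝ),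
      (integrableOn_Ioi_rpow_of_lt (by norm_num) one_pos).const_mul _, ?_⟩
    intro t ht z hz
    have ht0 : 0 < t := by linarith
    have hpi := Real.pi_gt_three
    simp only [zero_mul, sub_zero, sub_self, Real.rpow_zero, one_mul]
    rw [heat_two_eq ht0, ← mul_sub, abs_mul, abs_of_nonneg (by positivity), Real.rpow_neg ht0.le,
      Real.rpow_two]
    have h1 := abs_exp_neg_sub_exp_neg_le (x := ‖z‖ ^ 2 / 4 / t) (y := 1 / 4 / t) (by positivity)
      (by positivity)
    have h2 : |‖z‖ ^ 2 / 4 / t - 1 / 4 / t| ≤ (R ^ 2 / 4 + 1 / 4) / t := by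
      rw [← sub_div, abs_div, abs_of_pos ht0]
      have : ‖z‖ ^ 2 ≤ R ^ 2 := by gcongr
      gcongr
      rw [abs_le]
      constructor <;> nlinarith [sq_nonneg ‖z‖]
    calc (4 * Real.pi * t)⁻¹ * |Real.exp (-(‖z‖ ^ 2 / 4 / t)) - Real.exp (-(1 / 4 / t))|
        ≤ t⁻¹ * ((R ^ 2 / 4 + 1 / 4) / t) := by
          gcongr
          · nlinarith
          · exact h1.trans h2
      _ = _ := by field_simp

lemma isHeatRepresentation_biharmonic_three :
    IsHeatRepresentation (fun z => -Kernel.U .biharmonic3 z) (fun t => 1 * t ^ (2 - 1 : ℝ))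
      (fun t => (√(4 * Real.pi))⁻¹ ^ 3 * t ^ (-(1 / 2) : ℝ)) (fun _ => 0) where
  measurable_w := by fun_prop
  measurable_c₀ := by fun_prop
  measurable_c₂ := by fun_prop
  nonneg t ht := by positivity
  integrable_w := (integrableOn_Ioc_rpow (by norm_num)).const_mul _
  integrable_c₀ := (integrableOn_Ioc_rpow (by norm_num)).const_mul _
  integrable_c₂ := by simp
  eq_integral z hz := by
    norm_num only [zero_mul, sub_zero, Real.rpow_one, one_mul]
    rw [Kernel.U, biharmonic_three_eq_integral hz, neg_neg]
  bound R := by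
    refine ⟨fun t => R ^ 2 / 4 * t ^ (-(3 / 2) : ℝ),
      (integrableOn_Ioi_rpow_of_lt (by norm_num) one_pos).const_mul _, ?_⟩
    intro t ht z hz
    have ht0 : 0 < t := by linarith
    norm_num only [zero_mul, sub_zero, Real.rpow_one, one_mul]
    have e : t * heat t z - (√(4 * Real.pi))⁻¹ ^ 3 * t ^ (-(1 / 2) : ℝ) =
        (√(4 * Real.pi))⁻¹ ^ 3 * (t ^ (-(1 / 2) : ℝ) * (Real.exp (-(‖z‖ ^ 2 / 4 / t)) - 1)) := by
      rw [heat_three_eq ht0, show (-(3 / 2) : ℝ) = -(1 / 2) - 1 by norm_num,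
        Real.rpow_sub_one ht0.ne']
      field_simp
    rw [e, abs_mul, abs_mul, abs_of_nonneg (by positivity), abs_of_nonneg (by positivity)]
    have h1 := exp_neg_bounds (y := ‖z‖ ^ 2 / 4 / t) (by positivity)
    have h2 : |Real.exp (-(‖z‖ ^ 2 / 4 / t)) - 1| ≤ R ^ 2 / 4 / t := by
      have : ‖z‖ ^ 2 / 4 / t ≤ R ^ 2 / 4 / t := by gcongr
      rw [abs_le]; constructor <;> linarith
    calc (√(4 * Real.pi))⁻¹ ^ 3 * (t ^ (-(1 / 2) : ℝ) * |Real.exp (-(‖z‖ ^ 2 / 4 / t)) - 1|)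
        ≤ 1 * (t ^ (-(1 / 2) : ℝ) * (R ^ 2 / 4 / t)) := by
          gcongr
          exact inv_sqrt_four_pi_pow_le
      _ = _ := by
          rw [show (-(3 / 2) : ℝ) = -(1 / 2) - 1 by norm_num, Real.rpow_sub_one ht0.ne']; ring

/-- The coefficient of `|z|²` in the renormalization of the planar biharmonic kernel. -/
def biharmonicCoeff (t : ℝ) : ℝ := -(1 / (16 * Real.pi)) * t⁻¹ * Real.exp (-(Real.exp 1 / 4 / t))

lemma measurable_biharmonicCoeff : Measurable biharmonicCoeff := by
  unfold biharmonicCoeff; fun_prop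

lemma abs_biharmonicCoeff_le {t : ℝ} (ht : 0 < t) :
    |biharmonicCoeff t| ≤ 4 ∧ |biharmonicCoeff t| ≤ t⁻¹ := by
  have hpi := Real.pi_gt_three
  have hb : 0 < Real.exp 1 / 4 := by positivity
  have h1 := inv_mul_exp_neg_div_le hb ht
  have h2 : 1 / (Real.exp 1 / 4) ≤ 4 := by
    rw [one_div_div]
    exact div_le_self (by norm_num) (Real.one_le_exp zero_le_one)
  have h3 : Real.exp (-(Real.exp 1 / 4 / t)) ≤ 1 := (exp_neg_bounds (by positivity)).2.2.1
  have h4 : 1 / (16 * Real.pi) ≤ 1 := by rw [div_le_one (by positivity)]; linarith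
  have h5 : 0 ≤ t⁻¹ * Real.exp (-(Real.exp 1 / 4 / t)) := by positivity
  have e : |biharmonicCoeff t| =
      1 / (16 * Real.pi) * (t⁻¹ * Real.exp (-(Real.exp 1 / 4 / t))) := by
    rw [biharmonicCoeff, mul_assoc, neg_mul, abs_neg, abs_of_nonneg (by positivity)]
  rw [e]
  constructor
  · calc _ ≤ 1 * (1 / (Real.exp 1 / 4)) := by gcongr
      _ ≤ 4 := by linarith
  · calc _ ≤ 1 * (t⁻¹ * 1) := by gcongr
      _ = _ := by ring

lemma biharmonic_two_integrand_eq {t : ℝ} (ht : 0 < t) (z : E 2) :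
    t * heat t z - biharmonicCoeff t * ‖z‖ ^ 2 =
      1 / (4 * Real.pi) * (Real.exp (-(‖z‖ ^ 2 / 4 / t)) +
        ‖z‖ ^ 2 / 4 / t * Real.exp (-(Real.exp 1 / 4 / t))) := by
  have hpi := Real.pi_pos
  rw [heat_two_eq ht, biharmonicCoeff]
  field_simp
  ring

lemma isHeatRepresentation_biharmonic_two :
    IsHeatRepresentation (fun z => -Kernel.U .biharmonic2 z) (fun t => 1 * t ^ (2 - 1 : ℝ))
      (fun _ => 1 / (4 * Real.pi)) biharmonicCoeff where
  measurable_w := by fun_prop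
  measurable_c₀ := by fun_prop
  measurable_c₂ := measurable_biharmonicCoeff
  nonneg t ht := by positivity
  integrable_w := (integrableOn_Ioc_rpow (by norm_num)).const_mul _
  integrable_c₀ := integrableOn_Ioc_of_bounded measurable_const (fun _ _ => le_rfl) 1
  integrable_c₂ := integrableOn_Ioc_of_bounded measurable_biharmonicCoeff
    (fun t ht => (abs_biharmonicCoeff_le ht).1) 1
  eq_integral z hz := by
    norm_num only [Real.rpow_one, one_mul]
    rw [Kernel.U, biharmonic_two_eq_integral hz, neg_neg]
    rfl
  bound R := by
    refine ⟨fun t => (R ^ 4 / 16 + R ^ 2 / 4 * (Real.exp 1 / 4)) * t ^ (-2 : ℝ),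
      (integrableOn_Ioi_rpow_of_lt (by norm_num) one_pos).const_mul _, ?_⟩
    intro t ht z hz
    have ht0 : 0 < t := by linarith
    have hpi := Real.pi_gt_three
    norm_num only [Real.rpow_one, one_mul]
    rw [sub_right_comm, biharmonic_two_integrand_eq ht0]
    set q : ℝ := ‖z‖ ^ 2 / 4 / t with hq
    have hq0 : 0 ≤ q := by positivity
    have hqR : q ≤ R ^ 2 / 4 / t := by rw [hq]; gcongr
    set β : ℝ := Real.exp 1 / 4 / t with hβ
    have hβ0 : 0 ≤ β := by positivity
    have h1 := exp_neg_bounds hq0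
    have h2 := exp_neg_bounds hβ0
    have e : 1 / (4 * Real.pi) * (Real.exp (-q) + q * Real.exp (-β)) - 1 / (4 * Real.pi) =
        1 / (4 * Real.pi) * ((Real.exp (-q) - 1 + q) - q * (1 - Real.exp (-β))) := by ring
    have h3 : Real.exp (-q) - 1 + q ≤ q ^ 2 := by
      have : Real.exp (-q) ≤ 1 / (1 + q) := by
        rw [le_div_iff₀ (by positivity)]; linarith [h1.2.2.2.2]
      have h4 : 1 / (1 + q) ≤ 1 - q + q ^ 2 := by
        rw [div_le_iff₀ (by positivity)]
        nlinarith [pow_nonneg hq0 3]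
      linarith
    have h5 : |(Real.exp (-q) - 1 + q) - q * (1 - Real.exp (-β))| ≤ q ^ 2 + q * β := by
      have h6 : q * (1 - Real.exp (-β)) ≤ q * β := by gcongr; exact h2.2.1
      have h7 : 0 ≤ q * (1 - Real.exp (-β)) := mul_nonneg hq0 h2.1
      have h8 : 0 ≤ q * β := by positivity
      rw [abs_le]
      constructor <;> nlinarith [h1.2.1]
    rw [e, abs_mul, abs_of_nonneg (by positivity), Real.rpow_neg ht0.le, Real.rpow_two]
    have h9 : 1 / (4 * Real.pi) ≤ 1 := by rw [div_le_one (by positivity)]; linarith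
    calc 1 / (4 * Real.pi) * |(Real.exp (-q) - 1 + q) - q * (1 - Real.exp (-β))|
        ≤ 1 * ((R ^ 2 / 4 / t) ^ 2 + (R ^ 2 / 4 / t) * β) := by
          refine mul_le_mul h9 (h5.trans ?_) (abs_nonneg _) zero_le_one
          gcongr
      _ = _ := by rw [hβ]; field_simp; ring

/-! ### Upper bounds for the error of the full midpoint sum -/

lemma exists_error_coulomb {m : ℕ} {ρ : E 2 → ℝ} (hm : VanishingMoments m ρ)
    (hρ : ContDiff ℝ ∞ ρ) (hs : HasCompactSupport ρ) :
    ∃ C : ℝ, 0 ≤ C ∧ ∀ L : ℝ, 0 < L → ∀ x ∈ box 2 L,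
      ‖fullSum (Kernel.symbol .coulomb2) ρ L x - (Kernel.potential .coulomb2 ρ x : ℂ)‖ ≤
        C * L ^ (-(m + 2) : ℝ) := by
  have hf : (fun k : E 2 => 1 / √Real.pi * ((1 / ‖k‖ ^ 2) ^ (1 / 2 : ℝ) * Real.Gamma (1 / 2))) =
      Kernel.symbol .coulomb2 := by
    funext k
    have : √Real.pi ≠ 0 := (Real.sqrt_pos.2 Real.pi_pos).ne'
    rw [Kernel.symbol, Real.Gamma_one_half_eq, ← Real.sqrt_eq_rpow, Real.sqrt_div zero_le_one,
      Real.sqrt_one, Real.sqrt_sq (norm_nonneg _)]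
    field_simp
  have hw := isHeatWeight_rpow (d := 2) (A := 1 / √Real.pi) (κ := 1 / 2) (by positivity)
    (by norm_num)
  rw [hf] at hw
  obtain ⟨C, hC, h⟩ := isHeatRepresentation_coulomb.exists_fullSum_sub_conv_le_rpow hw two_pos
    (κ := 1 / 2) (by norm_num) (by positivity) (fun t _ => le_rfl) (fun L => by simp) hm hρ hs
    (by push_cast; linarith [Nat.cast_nonneg (α := ℝ) m]) (by simp)
  refine ⟨C, hC, fun L hL x hx => ?_⟩
  rw [show (-(m + 2) : ℝ) = 2 * (1 / 2) - ((2 : ℕ) + m + 1) by push_cast; ring]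
  exact h L hL x hx

lemma symbol_poisson_eq : (fun k : E d => (1 : ℝ) * ((1 / ‖k‖ ^ 2) ^ (1 : ℝ) * Real.Gamma 1)) =
    fun k => 1 / ‖k‖ ^ 2 := by
  funext k
  rw [Real.rpow_one, Real.Gamma_one]
  ring

lemma exists_error_poisson_two {m : ℕ} {ρ : E 2 → ℝ} (hm : VanishingMoments m ρ)
    (hρ : ContDiff ℝ ∞ ρ) (hs : HasCompactSupport ρ) :
    ∃ C : ℝ, 0 ≤ C ∧ ∀ L : ℝ, 0 < L → ∀ x ∈ box 2 L,
      ‖fullSum (Kernel.symbol .poisson2) ρ L x - (Kernel.potential .poisson2 ρ x : ℂ)‖ ≤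
        C * L ^ (-(m + 1) : ℝ) := by
  have hw := isHeatWeight_rpow (d := 2) (A := 1) (κ := 1) zero_le_one one_pos
  rw [symbol_poisson_eq] at hw
  obtain ⟨C, hC, h⟩ := isHeatRepresentation_poisson_two.exists_fullSum_sub_conv_le_rpow hw two_pos
    one_pos zero_le_one (fun t _ => le_rfl) (fun L => by simp) hm hρ hs
    (by push_cast; linarith [Nat.cast_nonneg (α := ℝ) m]) (by simp)
  refine ⟨C, hC, fun L hL x hx => ?_⟩
  rw [show (-(m + 1) : ℝ) = 2 * 1 - ((2 : ℕ) + m + 1) by push_cast; ring]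
  exact h L hL x hx

lemma exists_error_poisson_three {m : ℕ} {ρ : E 3 → ℝ} (hm : VanishingMoments m ρ)
    (hρ : ContDiff ℝ ∞ ρ) (hs : HasCompactSupport ρ) :
    ∃ C : ℝ, 0 ≤ C ∧ ∀ L : ℝ, 0 < L → ∀ x ∈ box 3 L,
      ‖fullSum (Kernel.symbol .poisson3) ρ L x - (Kernel.potential .poisson3 ρ x : ℂ)‖ ≤
        C * L ^ (-(m + 2) : ℝ) := by
  have hw := isHeatWeight_rpow (d := 3) (A := 1) (κ := 1) zero_le_one one_pos
  rw [symbol_poisson_eq] at hw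
  obtain ⟨C, hC, h⟩ := isHeatRepresentation_poisson_three.exists_fullSum_sub_conv_le_rpow hw
    three_pos one_pos zero_le_one (fun t _ => le_rfl) (fun L => by simp) hm hρ hs
    (by push_cast; linarith [Nat.cast_nonneg (α := ℝ) m]) (by simp)
  refine ⟨C, hC, fun L hL x hx => ?_⟩
  rw [show (-(m + 2) : ℝ) = 2 * 1 - ((3 : ℕ) + m + 1) by push_cast; ring]
  exact h L hL x hx

lemma symbol_biharmonic_eq :
    (fun k : E d => (1 : ℝ) * ((1 / ‖k‖ ^ 2) ^ (2 : ℝ) * Real.Gamma 2)) =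
    fun k => 1 / ‖k‖ ^ 4 := by
  funext k
  rw [Real.rpow_two, Real.Gamma_two]
  ring

lemma fullSum_neg (f ρ : E d → ℝ) (L : ℝ) (x : E d) :
    fullSum (fun k => -f k) ρ L x = -fullSum f ρ L x := by
  rw [fullSum, fullSum, ← tsum_neg]
  refine tsum_congr fun p => ?_
  push_cast
  ring

lemma conv_neg (U ρ : E d → ℝ) (x : E d) : conv (fun z => -U z) ρ x = -conv U ρ x := by
  rw [conv, conv, ← integral_neg]
  simp

lemma norm_le_of_mem_box {L : ℝ} (hL : 0 < L) {x : E d} (hx : x ∈ box d L) : ‖x‖ ≤ d * L := by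
  refine abs_le_of_sq_le_sq' ?_ (by positivity) |>.2
  rw [EuclideanSpace.real_norm_sq_eq]
  calc ∑ i, x i ^ 2 ≤ ∑ _i : Fin d, L ^ 2 :=
        Finset.sum_le_sum fun i _ => sq_le_sq' (hx i).1 (hx i).2
    _ = d * L ^ 2 := by simp
    _ ≤ (d * L) ^ 2 := by
        rcases Nat.eq_zero_or_pos d with h | h
        · simp [h]
        · have : (1 : ℝ) ≤ d := by exact_mod_cast h
          rw [mul_pow]
          gcongr
          nlinarith

/-- Points of the box and of the support have norms of order `L`, uniformly in `L ≥ L₀`. -/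
lemma exists_norm_le_mul {ρ : E d → ℝ} (hs : HasCompactSupport ρ) {L₀ : ℝ} (hL₀ : 0 < L₀) :
    ∃ R β : ℝ, 0 < R ∧ 0 < β ∧ (∀ y, ρ y ≠ 0 → ‖y‖ ≤ R) ∧ ∀ L, L₀ ≤ L → ∀ x ∈ box d L,
      R ≤ β * L ∧ ‖x‖ ≤ β * L ∧ ∀ y, ρ y ≠ 0 → ‖x - y‖ ≤ β * L := by
  obtain ⟨R, hR, hRρ⟩ := exists_norm_le_of_hasCompactSupport hs
  refine ⟨R, d + R / L₀, hR, by positivity, hRρ, fun L hL x hx => ?_⟩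
  have hL' : 0 < L := by linarith
  have h1 := norm_le_of_mem_box hL' hx
  have h2 : R ≤ R / L₀ * L := by
    rw [div_mul_eq_mul_div, le_div_iff₀ hL₀]; gcongr
  have h3 : 0 ≤ d * L := by positivity
  have h4 : 0 ≤ R / L₀ * L := by positivity
  rw [add_mul]
  refine ⟨by linarith, by linarith, fun y hy => ?_⟩
  have := norm_sub_le x y
  have := hRρ y hy
  linarith

lemma abs_norm_sub_sq_sub_le {x y : E d} {R M : ℝ} (hx : ‖x‖ ≤ M) (hxy : ‖x - y‖ ≤ M)
    (hy : ‖y‖ ≤ R) : |‖x - y‖ ^ 2 - ‖x‖ ^ 2| ≤ 2 * R * M := by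
  have h1 : |‖x - y‖ - ‖x‖| ≤ R := by
    have := abs_norm_sub_norm_le (x - y) x
    rw [sub_sub_cancel_left, norm_neg] at this
    linarith
  rw [sq_sub_sq, abs_mul, abs_of_nonneg (by positivity)]
  have h0 : 0 ≤ M := (norm_nonneg x).trans hx
  calc (‖x - y‖ + ‖x‖) * |‖x - y‖ - ‖x‖| ≤ (M + M) * R := by
        gcongr
    _ = _ := by ring

lemma integral_eq_zero_of_moments {m : ℕ} {ρ : E d → ℝ} (hm : VanishingMoments m ρ) :
    ∫ y, ρ y = 0 := by
  have := hm 0 (by simp)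
  simpa [monomial] using this

lemma exists_error_biharmonic_three {m : ℕ} {ρ : E 3 → ℝ} (hm : VanishingMoments m ρ)
    (hρ : ContDiff ℝ ∞ ρ) (hs : HasCompactSupport ρ) {L₀ : ℝ} (hL₀ : 0 < L₀) :
    ∃ C : ℝ, 0 ≤ C ∧ ∀ L : ℝ, L₀ ≤ L → ∀ x ∈ box 3 L,
      ‖fullSum (Kernel.symbol .biharmonic3) ρ L x - (Kernel.potential .biharmonic3 ρ x : ℂ)‖ ≤
        C * L ^ (-m : ℝ) := by
  have hw := isHeatWeight_rpow (d := 3) (A := 1) (κ := 2) zero_le_one two_pos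
  rw [symbol_biharmonic_eq] at hw
  have hneg : ∀ L x, ‖fullSum (Kernel.symbol .biharmonic3) ρ L x -
      (Kernel.potential .biharmonic3 ρ x : ℂ)‖ = ‖fullSum (fun k : E 3 => 1 / ‖k‖ ^ 4) ρ L x -
      (conv (fun z => -Kernel.U .biharmonic3 z) ρ x : ℂ)‖ := by
    intro L x
    rw [conv_neg, show (Kernel.symbol .biharmonic3 : E 3 → ℝ) = fun k => -(1 / ‖k‖ ^ 4) from rfl,
      fullSum_neg, ← norm_neg]
    simp only [Kernel.potential]
    congr 1
    push_cast
    ring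
  rcases Nat.eq_zero_or_pos m with hm0 | hm1
  · subst hm0
    obtain ⟨C, hC, h⟩ := isHeatRepresentation_biharmonic_three.exists_fullSum_sub_conv_le hw
      three_pos two_pos zero_le_one (fun t _ => le_rfl) (fun L => by simp) hm hρ hs
    obtain ⟨R, β, hR, hβ, hRρ, hβL⟩ := exists_norm_le_mul hs hL₀
    have hc := hρ.continuous
    have hint : Integrable ρ := hc.integrable_of_hasCompactSupport hs
    have h0 := integral_eq_zero_of_moments hm
    set I : ℝ := ∫ y, |ρ y| with hI
    have hI0 : 0 ≤ I := integral_nonneg fun y => abs_nonneg _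
    refine ⟨C + R * β * I, by positivity, fun L hL x hx => ?_⟩
    have hL' : 0 < L := by linarith
    have hL2 : (0 : ℝ) < L ^ 2 := by positivity
    obtain ⟨-, hxM, hxyM⟩ := hβL L hL x hx
    have hu : ∀ t : ℝ, 0 < t → |1 * t ^ (2 - 1 : ℝ) * conv (heat t) ρ x| ≤
        R * β * L / 2 * I * t ^ (-(3 / 2) : ℝ) := by
      intro t ht
      have e1 : conv (heat t) ρ x = ∫ y, (heat t (x - y) - heat t x) * ρ y := by
        simp_rw [sub_mul]
        rw [integral_sub _ (hint.const_mul _), integral_const_mul, h0, mul_zero, sub_zero, conv]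
        exact Continuous.integrable_of_hasCompactSupport (by fun_prop) hs.mul_left
      have e2 : |conv (heat t) ρ x| ≤ (t ^ (-(3 / 2) : ℝ) * (2 * R * (β * L) / 4 / t)) * I := by
        rw [e1, hI, ← integral_const_mul, ← Real.norm_eq_abs]
        refine norm_integral_le_of_norm_le (hint.abs.const_mul _) (.of_forall fun y => ?_)
        by_cases hy : ρ y = 0
        · simp [hy]
        rw [norm_mul, Real.norm_eq_abs, Real.norm_eq_abs]
        refine mul_le_mul_of_nonneg_right ?_ (abs_nonneg _)
        rw [heat_three_eq ht, heat_three_eq ht, ← mul_sub, ← mul_sub, abs_mul, abs_mul,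
          abs_of_nonneg (by positivity), abs_of_nonneg (by positivity)]
        have h1 := abs_exp_neg_sub_exp_neg_le (x := ‖x - y‖ ^ 2 / 4 / t) (y := ‖x‖ ^ 2 / 4 / t)
          (by positivity) (by positivity)
        rw [← sub_div, ← sub_div, abs_div, abs_div, abs_of_pos ht,
          abs_of_pos (by norm_num : (0 : ℝ) < 4)] at h1
        have h2 := abs_norm_sub_sq_sub_le hxM (hxyM y hy) (hRρ y hy)
        calc (√(4 * Real.pi))⁻¹ ^ 3 * (t ^ (-(3 / 2) : ℝ) *
              |Real.exp (-(‖x - y‖ ^ 2 / 4 / t)) - Real.exp (-(‖x‖ ^ 2 / 4 / t))|)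
            ≤ 1 * (t ^ (-(3 / 2) : ℝ) * (2 * R * (β * L) / 4 / t)) := by
              gcongr
              · exact inv_sqrt_four_pi_pow_le
              · exact h1.trans (by gcongr)
          _ = _ := one_mul _
      have e3 : (1 : ℝ) * t ^ (2 - 1 : ℝ) = t := by norm_num
      rw [e3, abs_mul, abs_of_pos ht]
      calc t * |conv (heat t) ρ x|
          ≤ t * ((t ^ (-(3 / 2) : ℝ) * (2 * R * (β * L) / 4 / t)) * I) := by gcongr
        _ = _ := by field_simp; norm_num
    have h1 := h L hL' x hx
    rw [hneg]
    refine h1.trans ?_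
    simp only [zero_mul, neg_zero, add_zero, integral_zero, zero_add]
    rw [show (2 * 2 - (((3 : ℕ) : ℝ) + ((0 : ℕ) : ℝ) + 1) : ℝ) = 0 by norm_num, Nat.cast_zero,
      neg_zero, Real.rpow_zero, mul_one, mul_one]
    gcongr
    rw [← Real.norm_eq_abs]
    refine (norm_integral_le_of_norm_le (g := fun t : ℝ => R * β * L / 2 * I * t ^ (-(3 / 2) : ℝ))
      ((integrableOn_Ioi_rpow_of_lt (by norm_num) hL2).const_mul _)
      ((ae_restrict_iff' measurableSet_Ioi).2 (.of_forall fun t ht =>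
        hu t (hL2.trans ht)))).trans (le_of_eq ?_)
    rw [integral_const_mul, integral_Ioi_rpow_of_lt (by norm_num) hL2, ← Real.rpow_two,
      ← Real.rpow_mul hL'.le]
    norm_num
    rw [Real.rpow_neg_one]
    field_simp
  · have hm1' : (1 : ℝ) ≤ m := by exact_mod_cast hm1
    obtain ⟨C, hC, h⟩ := isHeatRepresentation_biharmonic_three.exists_fullSum_sub_conv_le_rpow hw
      three_pos two_pos zero_le_one (fun t _ => le_rfl) (fun L => by simp) hm hρ hs
      (by push_cast; linarith) (by simp)
    refine ⟨C, hC, fun L hL x hx => ?_⟩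
    rw [hneg]
    rw [show (-m : ℝ) = 2 * 2 - ((3 : ℕ) + m + 1) by push_cast; ring]
    exact h L (by linarith) x hx

lemma secondMoment_eq {m : ℕ} {ρ : E d → ℝ} (hm : VanishingMoments m ρ) (hc : Continuous ρ)
    (hs : HasCompactSupport ρ) (x : E d) :
    secondMoment ρ x = (∫ y, ‖y‖ ^ 2 * ρ y) - 2 * ∫ y, inner ℝ x y * ρ y := by
  have hint : Integrable ρ := hc.integrable_of_hasCompactSupport hs
  have i1 : Integrable fun y => ‖y‖ ^ 2 * ρ y :=
    Continuous.integrable_of_hasCompactSupport (by fun_prop) hs.mul_left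
  have i2 : Integrable fun y => inner ℝ x y * ρ y :=
    Continuous.integrable_of_hasCompactSupport (by fun_prop) hs.mul_left
  have e : ∀ y, ‖x - y‖ ^ 2 * ρ y = ‖x‖ ^ 2 * ρ y + (‖y‖ ^ 2 * ρ y - 2 * (inner ℝ x y * ρ y)) := by
    intro y
    rw [norm_sub_sq_real]
    ring
  simp_rw [secondMoment, e]
  have i3 : Integrable fun y => ‖y‖ ^ 2 * ρ y - 2 * (inner ℝ x y * ρ y) :=
    i1.sub (i2.const_mul 2)
  rw [integral_add (hint.const_mul _) i3, integral_sub i1 (i2.const_mul 2),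
    integral_const_mul, integral_const_mul, integral_eq_zero_of_moments hm]
  ring

lemma integral_inner_eq_zero {m : ℕ} {ρ : E d → ℝ} (hm : VanishingMoments m ρ)
    (hc : Continuous ρ) (hs : HasCompactSupport ρ) (h1 : 1 ≤ m) (x : E d) :
    ∫ y, inner ℝ x y * ρ y = 0 := by
  have := hm.integral_inner_pow hc hs h1 x
  simpa [mul_comm] using this

lemma secondMoment_eq_zero {m : ℕ} {ρ : E d → ℝ} (hm : VanishingMoments m ρ) (hc : Continuous ρ)
    (hs : HasCompactSupport ρ) (h2 : 2 ≤ m) (x : E d) : secondMoment ρ x = 0 := by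
  rw [secondMoment_eq hm hc hs, integral_inner_eq_zero hm hc hs (by omega)]
  have e : ∀ y : E d, ‖y‖ ^ 2 * ρ y =
      ∑ i, ρ y * inner ℝ (EuclideanSpace.single i (1 : ℝ)) y ^ 2 := by
    intro y
    rw [EuclideanSpace.real_norm_sq_eq, mul_comm, Finset.mul_sum]
    simp only [EuclideanSpace.inner_single_left, map_one, one_mul]
  simp_rw [e]
  rw [integral_finsetSum]
  · simp [fun i => hm.integral_inner_pow hc hs h2 (EuclideanSpace.single i (1 : ℝ))]
  · intro i _
    exact Continuous.integrable_of_hasCompactSupport (by fun_prop) hs.mul_right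

lemma exists_secondMoment_le {m : ℕ} {ρ : E d → ℝ} (hm : VanishingMoments m ρ)
    (hc : Continuous ρ) (hs : HasCompactSupport ρ) (h1 : m ≤ 1) {L₀ : ℝ} (hL₀ : 0 < L₀) :
    ∃ C : ℝ, 0 ≤ C ∧ ∀ L : ℝ, L₀ ≤ L → ∀ x ∈ box d L,
      |secondMoment ρ x| ≤ C * L ^ (1 - m : ℝ) := by
  obtain ⟨R, β, hR, hβ, hRρ, hβL⟩ := exists_norm_le_mul hs hL₀
  have hint : Integrable ρ := hc.integrable_of_hasCompactSupport hs
  set I : ℝ := ∫ y, |ρ y| with hI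
  have hI0 : 0 ≤ I := integral_nonneg fun y => abs_nonneg _
  have b1 : |∫ y, ‖y‖ ^ 2 * ρ y| ≤ R ^ 2 * I := by
    rw [hI, ← integral_const_mul, ← Real.norm_eq_abs]
    refine norm_integral_le_of_norm_le (hint.abs.const_mul _) (.of_forall fun y => ?_)
    by_cases hy : ρ y = 0
    · simp [hy]
    rw [norm_mul, Real.norm_of_nonneg (by positivity), Real.norm_eq_abs]
    have := hRρ y hy
    gcongr
  have b2 : ∀ x : E d, |∫ y, inner ℝ x y * ρ y| ≤ ‖x‖ * R * I := by
    intro x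
    rw [hI, ← integral_const_mul, ← Real.norm_eq_abs]
    refine norm_integral_le_of_norm_le (hint.abs.const_mul _) (.of_forall fun y => ?_)
    by_cases hy : ρ y = 0
    · simp [hy]
    rw [norm_mul, Real.norm_eq_abs (ρ y)]
    have h3 := hRρ y hy
    have h4 := norm_inner_le_norm (𝕜 := ℝ) x y
    gcongr
    exact h4.trans (by gcongr)
  refine ⟨3 * R * β * I + R ^ 2 * I, by positivity, fun L hL x hx => ?_⟩
  have hL' : 0 < L := by linarith
  obtain ⟨hRL, hxM, -⟩ := hβL L hL x hx
  rw [secondMoment_eq hm hc hs]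
  interval_cases m
  · rw [Nat.cast_zero, sub_zero, Real.rpow_one]
    have h3 : |(∫ y, ‖y‖ ^ 2 * ρ y) - 2 * ∫ y, inner ℝ x y * ρ y| ≤
        R ^ 2 * I + 2 * (‖x‖ * R * I) := by
      refine (abs_sub _ _).trans (add_le_add b1 ?_)
      rw [abs_mul, abs_two]
      gcongr
      exact b2 x
    refine h3.trans ?_
    have h5 : R ^ 2 * I ≤ R * (β * L) * I := by rw [sq]; gcongr
    have h6 : 2 * (‖x‖ * R * I) ≤ 2 * ((β * L) * R * I) := by gcongr
    have h7 : 0 ≤ R ^ 2 * I * L := by positivity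
    nlinarith
  · rw [integral_inner_eq_zero hm hc hs le_rfl, mul_zero, sub_zero, Nat.cast_one, sub_self,
      Real.rpow_zero, mul_one]
    have : 0 ≤ 3 * R * β * I := by positivity
    linarith

lemma abs_exp_neg_sub_linear_le (a b : ℝ) (ha : 0 ≤ a) (hb : 0 ≤ b) :
    |Real.exp (-a) - Real.exp (-b) + Real.exp (-b) * (a - b)| ≤ (a - b) ^ 2 := by
  have h1 : Real.exp (-b) * (b - a + 1) ≤ Real.exp (-a) := by
    have := mul_le_mul_of_nonneg_left (Real.add_one_le_exp (b - a)) (Real.exp_pos (-b)).le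
    rwa [← Real.exp_add, show -b + (b - a) = -a by ring] at this
  have h2 : Real.exp (-a) * (a - b + 1) ≤ Real.exp (-b) := by
    have := mul_le_mul_of_nonneg_left (Real.add_one_le_exp (a - b)) (Real.exp_pos (-a)).le
    rwa [← Real.exp_add, show -a + (a - b) = -b by ring] at this
  have h3 := abs_exp_neg_sub_exp_neg_le ha hb
  rw [abs_of_nonneg (by linarith)]
  calc Real.exp (-a) - Real.exp (-b) + Real.exp (-b) * (a - b)
      ≤ -(Real.exp (-a) - Real.exp (-b)) * (a - b) := by linarith
    _ ≤ |(Real.exp (-a) - Real.exp (-b)) * (a - b)| := by rw [neg_mul]; exact neg_le_abs _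
    _ ≤ |a - b| * |a - b| := by rw [abs_mul]; gcongr
    _ = (a - b) ^ 2 := by rw [abs_mul_abs_self, sq]

lemma abs_biharmonic_two_integrand_le {ρ : E 2 → ℝ} (hc : Continuous ρ) (hs : HasCompactSupport ρ)
    (h0 : ∫ y, ρ y = 0) {x : E 2} {R M : ℝ} (hR : ∀ y, ρ y ≠ 0 → ‖y‖ ≤ R) (hx : ‖x‖ ≤ M)
    (hxy : ∀ y, ρ y ≠ 0 → ‖x - y‖ ≤ M) {t : ℝ} (ht : 0 < t) :
    |t * conv (heat t) ρ x - biharmonicCoeff t * secondMoment ρ x| ≤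
      ((2 * R * M) ^ 2 * (∫ y, |ρ y|) + (1 + M ^ 2) * |secondMoment ρ x|) * t ^ (-2 : ℝ) := by
  set q : E 2 → ℝ := fun z => ‖z‖ ^ 2 / 4 / t with hq
  set b : ℝ := Real.exp 1 / 4 with hb
  set P := secondMoment ρ x with hP
  set G : E 2 → ℝ := fun y => Real.exp (-q (x - y)) - Real.exp (-q x) +
    Real.exp (-q x) * (q (x - y) - q x) with hG
  have hb0 : 0 ≤ b := by positivity
  have hb1 : b ≤ 1 := by rw [hb]; linarith [Real.exp_one_lt_d9]
  have hqn : ∀ z, 0 ≤ q z := fun z => by positivity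
  have hint : Integrable ρ := hc.integrable_of_hasCompactSupport hs
  have iG : Integrable fun y => G y * ρ y :=
    Continuous.integrable_of_hasCompactSupport (by fun_prop) hs.mul_left
  have iq : Integrable fun y => ‖x - y‖ ^ 2 * ρ y :=
    Continuous.integrable_of_hasCompactSupport (by fun_prop) hs.mul_left
  have ih : Integrable fun y => heat t (x - y) * ρ y :=
    Continuous.integrable_of_hasCompactSupport (by fun_prop) hs.mul_left
  have e1 : t * conv (heat t) ρ x - biharmonicCoeff t * P =
      1 / (4 * Real.pi) * ((∫ y, G y * ρ y) +
        (Real.exp (-(b / t)) - Real.exp (-q x)) / (4 * t) * P) := by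
    rw [hP, conv, secondMoment, ← integral_const_mul, ← integral_const_mul, ← integral_const_mul,
      ← integral_sub (ih.const_mul _) (iq.const_mul _), ← integral_add iG (iq.const_mul _)]
    have e2 : ∀ y, t * (heat t (x - y) * ρ y) - biharmonicCoeff t * (‖x - y‖ ^ 2 * ρ y) =
        1 / (4 * Real.pi) * (G y * ρ y + (Real.exp (-(b / t)) - Real.exp (-q x)) / (4 * t) *
          (‖x - y‖ ^ 2 * ρ y)) + 1 / (4 * Real.pi) * (Real.exp (-q x) * (1 + q x)) * ρ y := by
      intro y
      have := biharmonic_two_integrand_eq ht (x - y)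
      rw [← hb] at this
      rw [show t * (heat t (x - y) * ρ y) - biharmonicCoeff t * (‖x - y‖ ^ 2 * ρ y) =
        (t * heat t (x - y) - biharmonicCoeff t * ‖x - y‖ ^ 2) * ρ y by ring, this]
      simp only [hG, hq]
      field_simp
      ring
    have iGP : Integrable fun y => G y * ρ y +
        (Real.exp (-(b / t)) - Real.exp (-q x)) / (4 * t) * (‖x - y‖ ^ 2 * ρ y) :=
      iG.add (iq.const_mul _)
    simp_rw [e2]
    rw [integral_add (iGP.const_mul _) (hint.const_mul _), integral_const_mul, integral_const_mul,
      h0, mul_zero, add_zero]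
  have hb2 : |∫ y, G y * ρ y| ≤ (2 * R * M) ^ 2 * (∫ y, |ρ y|) * (t ^ 2)⁻¹ := by
    rw [mul_right_comm, ← integral_const_mul, ← Real.norm_eq_abs]
    refine norm_integral_le_of_norm_le (hint.abs.const_mul _) (.of_forall fun y => ?_)
    by_cases hy : ρ y = 0
    · simp [hy]
    rw [norm_mul, Real.norm_eq_abs, Real.norm_eq_abs]
    refine mul_le_mul_of_nonneg_right ?_ (abs_nonneg _)
    refine (abs_exp_neg_sub_linear_le _ _ (hqn _) (hqn _)).trans ?_
    have h2 := abs_norm_sub_sq_sub_le hx (hxy y hy) (hR y hy)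
    have h3 : (q (x - y) - q x) ^ 2 = (‖x - y‖ ^ 2 - ‖x‖ ^ 2) ^ 2 * (1 / 16) * (t ^ 2)⁻¹ := by
      simp only [hq]; field_simp; ring
    rw [h3]
    refine mul_le_mul_of_nonneg_right ?_ (by positivity)
    have h4 := sq_le_sq' (abs_le.1 h2).1 (abs_le.1 h2).2
    nlinarith [sq_nonneg (‖x - y‖ ^ 2 - ‖x‖ ^ 2)]
  have hb3 : |(Real.exp (-(b / t)) - Real.exp (-q x)) / (4 * t) * P| ≤
      (1 + M ^ 2) * |P| * (t ^ 2)⁻¹ := by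
    have h4 := abs_exp_neg_sub_exp_neg_le (div_nonneg hb0 ht.le) (hqn x)
    have h5 : |b / t - q x| ≤ (1 + M ^ 2) * t⁻¹ := by
      have h6 : ‖x‖ ^ 2 ≤ M ^ 2 := by gcongr
      have h7 : b / t - q x = (b - ‖x‖ ^ 2 / 4) * t⁻¹ := by simp only [hq]; field_simp
      rw [h7, abs_mul, abs_of_pos (inv_pos.2 ht)]
      gcongr
      rw [abs_le]
      constructor <;> nlinarith [sq_nonneg ‖x‖]
    rw [abs_mul, abs_div, abs_of_pos (by positivity : 0 < 4 * t)]
    calc |Real.exp (-(b / t)) - Real.exp (-q x)| / (4 * t) * |P|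
        ≤ (1 + M ^ 2) * t⁻¹ / (1 * t) * |P| := by
          gcongr
          · exact h4.trans h5
          · norm_num
      _ = _ := by field_simp
  have hpi := Real.pi_gt_three
  have h8 : |1 / (4 * Real.pi)| ≤ 1 := by
    rw [abs_of_pos (by positivity), div_le_one (by positivity)]; linarith
  rw [e1, abs_mul, Real.rpow_neg ht.le, Real.rpow_two, add_mul]
  calc _ ≤ 1 * |(∫ y, G y * ρ y) + (Real.exp (-(b / t)) - Real.exp (-q x)) / (4 * t) * P| := by
        gcongr
    _ ≤ _ := by rw [one_mul]; exact (abs_add_le _ _).trans (add_le_add hb2 hb3)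

lemma abs_integral_biharmonicCoeff_le {T : ℝ} (hT : 0 < T) :
    |∫ t in Set.Ioc 0 T, biharmonicCoeff t| ≤ 4 + |Real.log T| := by
  have hm := measurable_biharmonicCoeff
  have i1 : ∀ T, IntegrableOn biharmonicCoeff (Set.Ioc 0 T) := fun T =>
    integrableOn_Ioc_of_bounded hm (fun t ht => (abs_biharmonicCoeff_le ht).1) T
  have b1 : ∀ T, 0 < T → T ≤ 1 → |∫ t in Set.Ioc 0 T, biharmonicCoeff t| ≤ 4 := by
    intro T hT0 hT
    rw [← Real.norm_eq_abs]
    refine (norm_setIntegral_le_of_norm_le_const (by simp) fun t ht =>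
      (abs_biharmonicCoeff_le ht.1).1).trans ?_
    rw [Real.volume_real_Ioc_of_le hT0.le]
    linarith
  rcases le_total T 1 with h | h
  · exact (b1 T hT h).trans (by linarith [abs_nonneg (Real.log T)])
  · rw [← Set.Ioc_union_Ioc_eq_Ioc zero_le_one h,
      setIntegral_union (Set.Ioc_disjoint_Ioc_of_le le_rfl) measurableSet_Ioc (i1 1)
        ((i1 T).mono_set (Set.Ioc_subset_Ioc_left zero_le_one))]
    refine (abs_add_le _ _).trans (add_le_add (b1 1 one_pos le_rfl) ?_)
    rw [← Real.norm_eq_abs, ← intervalIntegral.integral_of_le h]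
    refine (intervalIntegral.norm_integral_le_of_norm_le h (g := fun t => t⁻¹)
      (.of_forall fun t ht => (abs_biharmonicCoeff_le (by linarith [ht.1])).2) ?_).trans ?_
    · rw [intervalIntegrable_iff, Set.uIoc_of_le h]
      refine ContinuousOn.integrableOn_Icc (f := fun t : ℝ => t⁻¹) (a := 1) (b := T) ?_ |>.mono_set
        Set.Ioc_subset_Icc_self
      exact continuousOn_id.inv₀ fun t ht => by
        have : (1 : ℝ) ≤ t := ht.1
        simp only [id]; linarith
    · rw [integral_inv_of_pos one_pos hT, div_one]
      exact le_abs_self _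

lemma norm_biharmonic_two_sub_eq (ρ : E 2 → ℝ) (L : ℝ) (x : E 2) :
    ‖fullSum (Kernel.symbol .biharmonic2) ρ L x - (Kernel.potential .biharmonic2 ρ x : ℂ)‖ =
      ‖fullSum (fun k : E 2 => 1 / ‖k‖ ^ 4) ρ L x -
        (conv (fun z => -Kernel.U .biharmonic2 z) ρ x : ℂ)‖ := by
  rw [conv_neg, show (Kernel.symbol .biharmonic2 : E 2 → ℝ) = fun k => -(1 / ‖k‖ ^ 4) from rfl,
    fullSum_neg, ← norm_neg]
  simp only [Kernel.potential]
  congr 1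
  push_cast
  ring

lemma exists_error_biharmonic_two_of_two_le {m : ℕ} {ρ : E 2 → ℝ} (hm : VanishingMoments m ρ)
    (hρ : ContDiff ℝ ∞ ρ) (hs : HasCompactSupport ρ) (h2 : 2 ≤ m) :
    ∃ C : ℝ, 0 ≤ C ∧ ∀ L : ℝ, 0 < L → ∀ x ∈ box 2 L,
      ‖fullSum (Kernel.symbol .biharmonic2) ρ L x - (Kernel.potential .biharmonic2 ρ x : ℂ)‖ ≤
        C * L ^ (1 - m : ℝ) := by
  have hw := isHeatWeight_rpow (d := 2) (A := 1) (κ := 2) zero_le_one two_pos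
  rw [symbol_biharmonic_eq] at hw
  have h2' : (2 : ℝ) ≤ m := by exact_mod_cast h2
  obtain ⟨C, hC, h⟩ := isHeatRepresentation_biharmonic_two.exists_fullSum_sub_conv_le_rpow hw
    two_pos two_pos zero_le_one (fun t _ => le_rfl)
    (fun L => integrableOn_Ioc_of_bounded measurable_biharmonicCoeff
      (fun t ht => (abs_biharmonicCoeff_le ht).1) L) hm hρ hs
    (by push_cast; linarith) (fun t x => by
      rw [secondMoment_eq_zero hm hρ.continuous hs h2, mul_zero])
  refine ⟨C, hC, fun L hL x hx => ?_⟩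
  rw [norm_biharmonic_two_sub_eq, show (1 - m : ℝ) = 2 * 2 - ((2 : ℕ) + m + 1) by push_cast; ring]
  exact h L hL x hx

lemma exists_error_biharmonic_two_of_le_one {m : ℕ} {ρ : E 2 → ℝ} (hm : VanishingMoments m ρ)
    (hρ : ContDiff ℝ ∞ ρ) (hs : HasCompactSupport ρ) (h1 : m ≤ 1) {L₀ : ℝ} (hL₀ : 0 < L₀) :
    ∃ C : ℝ, 0 ≤ C ∧ ∀ L : ℝ, L₀ ≤ L → ∀ x ∈ box 2 L,
      ‖fullSum (Kernel.symbol .biharmonic2) ρ L x - (Kernel.potential .biharmonic2 ρ x : ℂ)‖ ≤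
        C * (L ^ (1 - m : ℝ) * (1 + |Real.log L|)) := by
  have hw := isHeatWeight_rpow (d := 2) (A := 1) (κ := 2) zero_le_one two_pos
  rw [symbol_biharmonic_eq] at hw
  have hc := hρ.continuous
  obtain ⟨C, hC, h⟩ := isHeatRepresentation_biharmonic_two.exists_fullSum_sub_conv_le hw
    two_pos two_pos zero_le_one (fun t _ => le_rfl)
    (fun L => integrableOn_Ioc_of_bounded measurable_biharmonicCoeff
      (fun t ht => (abs_biharmonicCoeff_le ht).1) L) hm hρ hs
  obtain ⟨R, β, hR, hβ, hRρ, hβL⟩ := exists_norm_le_mul hs hL₀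
  obtain ⟨D, hD, hDP⟩ := exists_secondMoment_le hm hc hs h1 hL₀
  have h0 := integral_eq_zero_of_moments hm
  set I : ℝ := ∫ y, |ρ y| with hI
  have hI0 : 0 ≤ I := integral_nonneg fun y => abs_nonneg _
  have hone : ∃ D' : ℝ, 0 ≤ D' ∧ ∀ L, L₀ ≤ L → 1 ≤ D' * L ^ (1 - m : ℝ) := by
    interval_cases m
    · refine ⟨L₀⁻¹, by positivity, fun L hL => ?_⟩
      rw [Nat.cast_zero, sub_zero, Real.rpow_one, ← div_eq_inv_mul, le_div_iff₀ hL₀]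
      linarith
    · exact ⟨1, zero_le_one, fun L hL => by simp⟩
  obtain ⟨D', hD', hone⟩ := hone
  refine ⟨C + D * 4 + ((2 * R * β) ^ 2 * I * D' + ((L₀ ^ 2)⁻¹ + β ^ 2) * D), by positivity,
    fun L hL x hx => ?_⟩
  have hL' : 0 < L := by linarith
  have hL2 : (0 : ℝ) < L ^ 2 := by positivity
  obtain ⟨-, hxM, hxyM⟩ := hβL L hL x hx
  set P := secondMoment ρ x with hP
  set X := L ^ (1 - m : ℝ) with hX
  have hX0 : 0 ≤ X := by positivity
  have hPX : |P| ≤ D * X := hDP L hL x hx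
  have h1X := hone L hL
  have hlog := abs_nonneg (Real.log L)
  have p1 : |∫ t in Set.Ioc 0 (L ^ 2), -(biharmonicCoeff t * P)| ≤
      D * 4 * (X * (1 + |Real.log L|)) := by
    rw [integral_neg, abs_neg, integral_mul_const, abs_mul]
    have h2 := abs_integral_biharmonicCoeff_le hL2
    rw [Real.log_pow, abs_mul, Nat.cast_ofNat, abs_two] at h2
    calc _ ≤ (4 + 2 * |Real.log L|) * (D * X) := by gcongr
      _ ≤ (4 + 4 * |Real.log L|) * (D * X) := by gcongr; norm_num
      _ = _ := by ring
  have p2 : |∫ t in Set.Ioi (L ^ 2), (1 * t ^ (2 - 1 : ℝ) * conv (heat t) ρ x +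
      -(biharmonicCoeff t * P))| ≤ ((2 * R * β) ^ 2 * I * D' + ((L₀ ^ 2)⁻¹ + β ^ 2) * D) * X := by
    rw [← Real.norm_eq_abs]
    refine (norm_integral_le_of_norm_le (g := fun t : ℝ =>
      ((2 * R * (β * L)) ^ 2 * I + (1 + (β * L) ^ 2) * |P|) * t ^ (-2 : ℝ))
      ((integrableOn_Ioi_rpow_of_lt (by norm_num) hL2).const_mul _)
      ((ae_restrict_iff' measurableSet_Ioi).2 (.of_forall fun t ht => ?_))).trans ?_
    · have := abs_biharmonic_two_integrand_le hc hs h0 hRρ hxM hxyM (hL2.trans ht)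
      rw [show (2 : ℝ) - 1 = 1 by norm_num, Real.rpow_one, one_mul, Real.norm_eq_abs,
        ← sub_eq_add_neg]
      exact this
    · rw [integral_const_mul, integral_Ioi_rpow_of_lt (by norm_num) hL2,
        show (-2 + 1 : ℝ) = -1 by norm_num, Real.rpow_neg_one]
      have e : ((2 * R * (β * L)) ^ 2 * I + (1 + (β * L) ^ 2) * |P|) * (-(L ^ 2)⁻¹ / -1) =
          (2 * R * β) ^ 2 * I * 1 + ((L ^ 2)⁻¹ + β ^ 2) * |P| := by
        field_simp
      rw [e, add_mul _ _ X]
      refine add_le_add ?_ ?_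
      · rw [mul_assoc _ D' X]
        gcongr
      · rw [mul_assoc _ D X]
        gcongr
  rw [norm_biharmonic_two_sub_eq]
  refine (h L hL' x hx).trans ?_
  rw [show (2 * 2 - (((2 : ℕ) : ℝ) + m + 1) : ℝ) = 1 - m by push_cast; ring]
  have hXl : X ≤ X * (1 + |Real.log L|) := le_mul_of_one_le_right hX0 (by linarith)
  grw [abs_add_le, p1, p2]
  rw [add_mul, add_mul]
  have : 0 ≤ (2 * R * β) ^ 2 * I * D' + ((L₀ ^ 2)⁻¹ + β ^ 2) * D := by positivity
  have := mul_le_mul_of_nonneg_left hXl this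
  have := mul_le_mul_of_nonneg_left hXl hC
  linarith

/-! ### Partial derivatives along coordinate lines -/

lemma iterate_pderiv_eq_iteratedDeriv (i : Fin d) (f : E d → ℝ) (n : ℕ) (x : E d) (s : ℝ) :
    (pderiv i)^[n] f (x + s • EuclideanSpace.single i 1) =
      iteratedDeriv n (fun t => f (x + t • EuclideanSpace.single i 1)) s := by
  induction n generalizing s with
  | zero => simp
  | succ n ih =>
    rw [Function.iterate_succ_apply', iteratedDeriv_succ, pderiv, lineDeriv]
    simp_rw [add_assoc x, ← add_smul, ih]
    rw [deriv_comp_const_add (f := iteratedDeriv n fun t => f (x + t • EuclideanSpace.single i 1)),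
      add_zero]

lemma iterate_pderiv_smul_single (i : Fin d) (f : E d → ℝ) (n : ℕ) (s : ℝ) :
    (pderiv i)^[n] f (s • EuclideanSpace.single i 1) =
      iteratedDeriv n (fun t => f (t • EuclideanSpace.single i 1)) s := by
  simpa using iterate_pderiv_eq_iteratedDeriv i f n 0 s

lemma mderiv_three (β : Fin 3 → ℕ) (f : E 3 → ℝ) :
    mderiv β f = (pderiv 0)^[β 0] ((pderiv 1)^[β 1] ((pderiv 2)^[β 2] f)) := rfl

lemma foldr_iterate_pderiv_single (l : List (Fin d)) (hl : l.Nodup) (i : Fin d) (n : ℕ)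
    (f : E d → ℝ) :
    l.foldr (fun j g => (pderiv j)^[(Pi.single i n : Fin d → ℕ) j] g) f =
      if i ∈ l then (pderiv i)^[n] f else f := by
  induction l with
  | nil => simp
  | cons a l ih =>
    rw [List.nodup_cons] at hl
    rw [List.foldr_cons, ih hl.2]
    by_cases h : a = i
    · subst h
      simp [hl.1]
    · simp [Ne.symm h]

lemma mderiv_single (i : Fin d) (n : ℕ) (f : E d → ℝ) :
    mderiv (Pi.single i n) f = (pderiv i)^[n] f := by
  rw [mderiv, foldr_iterate_pderiv_single _ (List.nodup_finRange d)]
  simp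

lemma mem_frontier_box {L : ℝ} (hL : 0 < L) {x : E d} (hx : x ∈ box d L) {i : Fin d}
    (hi : |x i| = L) : x ∈ frontier (box d L) := by
  refine ⟨subset_closure hx, fun hint => ?_⟩
  have h1 : Filter.Tendsto (fun s : ℝ => (1 + s) • x) (nhdsWithin 0 (Set.Ioi 0)) (nhds x) := by
    have : Continuous fun s : ℝ => (1 + s) • x := by fun_prop
    have h := this.tendsto 0
    simp only [add_zero, one_smul] at h
    exact h.mono_left nhdsWithin_le_nhds
  have h2 := h1.eventually (mem_interior_iff_mem_nhds.1 hint)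
  obtain ⟨s, hs, hs0⟩ := (h2.and self_mem_nhdsWithin).exists
  have hs0' : (0 : ℝ) < s := hs0
  have h3 : |(1 + s) * x i| ≤ L := abs_le.2 (hs i)
  rw [abs_mul, hi, abs_of_pos (by linarith)] at h3
  nlinarith

lemma norm_mderiv_le_farField (K : Kernel d) {m : ℕ} {ρ : E d → ℝ} {L : ℝ} {β : Fin d → ℕ}
    (hβ : ∑ i, β i = m + 1) {x y : E d} (hx : x ∈ frontier (box d L)) (hy : y ∈ tsupport ρ)
    {s : ℝ} (hs : s ∈ Set.Icc (0 : ℝ) 1) :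
    ‖mderiv β K.U (x - s • y)‖ₑ ≤ K.farField m ρ L := by
  have h1 : β ∈ multiIndices d (m + 1) := by
    rw [multiIndices, Finset.mem_piAntidiag]
    exact ⟨hβ, fun i _ => Finset.mem_univ i⟩
  refine le_trans ?_ (Finset.single_le_sum (f := fun β => ⨆ x ∈ frontier (box d L),
    ⨆ y ∈ tsupport ρ, ⨆ s ∈ Set.Icc (0 : ℝ) 1, ‖mderiv β K.U (x - s • y)‖ₑ)
    (fun _ _ => zero_le) h1)
  exact le_iSup₂_of_le x hx (le_iSup₂_of_le y hy (le_iSup₂_of_le s hs le_rfl))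

lemma ofReal_le_farField (K : Kernel d) {m : ℕ} {ρ : E d → ℝ} {L b : ℝ} {β : Fin d → ℕ}
    (hβ : ∑ i, β i = m + 1) {x y : E d} (hx : x ∈ frontier (box d L)) (hy : y ∈ tsupport ρ)
    (h : b ≤ |mderiv β K.U x|) : ENNReal.ofReal b ≤ K.farField m ρ L := by
  refine le_trans ?_ (norm_mderiv_le_farField K hβ hx hy (s := 0) (by simp))
  rw [zero_smul, sub_zero, Real.enorm_eq_ofReal_abs]
  exact ENNReal.ofReal_le_ofReal h

lemma smul_single_mem_frontier {L : ℝ} (hL : 0 < L) (i : Fin d) :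
    L • EuclideanSpace.single i (1 : ℝ) ∈ frontier (box d L) := by
  refine mem_frontier_box hL (i := i) (fun j => ?_) (by simp [abs_of_pos hL])
  by_cases h : j = i
  · subst h; simp [hL.le]
  · simp [h, hL.le]

lemma norm_smul_single_of_pos {s : ℝ} (hs : 0 < s) (i : Fin d) :
    ‖s • EuclideanSpace.single i (1 : ℝ)‖ = s := by
  rw [norm_smul, PiLp.norm_single, norm_one, mul_one, Real.norm_of_nonneg hs.le]

/-- The factor `k (k + 1) ⋯ (k + n - 1)` in the derivatives of `t ^ (-k)`. -/
def zpowFactor (k n : ℕ) : ℝ := |∏ i ∈ Finset.range n, (((-k : ℤ) : ℝ) - i)|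

lemma zpowFactor_pos {k : ℕ} (hk : 0 < k) (n : ℕ) : 0 < zpowFactor k n := by
  rw [zpowFactor, abs_pos, Finset.prod_ne_zero_iff]
  intro i _
  have : (0 : ℝ) < k := by exact_mod_cast hk
  have : (0 : ℝ) ≤ i := Nat.cast_nonneg i
  push_cast
  linarith

lemma abs_iteratedDeriv_zpow {k n : ℕ} {A s : ℝ} (hs : 0 < s) {f : ℝ → ℝ}
    (h : ∀ t, 0 < t → f t = A * t ^ (-k : ℤ)) :
    |iteratedDeriv n f s| = |A| * zpowFactor k n * s ^ (-(k + n) : ℝ) := by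
  have h1 : f =ᶠ[nhds s] fun t => A * t ^ (-k : ℤ) := by
    filter_upwards [lt_mem_nhds hs] with t ht using h t ht
  rw [h1.iteratedDeriv_eq, iteratedDeriv_const_mul_field, iteratedDeriv_eq_iterate,
    iter_deriv_zpow, abs_mul, abs_mul, zpowFactor, mul_assoc, ← Real.rpow_intCast,
    abs_of_pos (Real.rpow_pos_of_pos hs _)]
  congr 3
  push_cast
  ring

/-- Lower bound for the far field of a kernel that is a multiple of `t ^ (-k)` after `n`
derivatives on a coordinate axis. -/
lemma ofReal_rpow_le_farField_of_axis (K : Kernel d) {m : ℕ} {ρ : E d → ℝ} {y : E d}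
    (hy : y ∈ tsupport ρ) {β : Fin d → ℕ} (hβ : ∑ i, β i = m + 1) (i : Fin d) {n k : ℕ} {A : ℝ}
    {g : ℝ → ℝ} (hg : ∀ t, 0 < t → g t = A * t ^ (-k : ℤ)) {L : ℝ} (hL : 0 < L)
    (h : mderiv β K.U (L • EuclideanSpace.single i 1) = iteratedDeriv n g L) :
    ENNReal.ofReal (|A| * zpowFactor k n * L ^ (-(k + n) : ℝ)) ≤ K.farField m ρ L :=
  ofReal_le_farField K hβ (smul_single_mem_frontier hL i) hy
    (by rw [h, abs_iteratedDeriv_zpow hL hg])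

lemma exists_le_farField_coulomb (m : ℕ) (ρ : E 2 → ℝ) {y : E 2} (hy : y ∈ tsupport ρ) :
    ∃ c : ℝ, 0 < c ∧ ∀ L : ℝ, 0 < L →
      ENNReal.ofReal (c * L ^ (-(m + 2) : ℝ)) ≤ Kernel.farField .coulomb2 m ρ L := by
  have hpi := Real.pi_pos
  refine ⟨|1 / (2 * Real.pi)| * zpowFactor 1 (m + 1),
    mul_pos (by positivity) (zpowFactor_pos one_pos _), fun L hL => ?_⟩
  have := ofReal_rpow_le_farField_of_axis .coulomb2 (m := m) hy
    (β := Pi.single 0 (m + 1)) (by simp) 0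
    (n := m + 1) (k := 1) (A := 1 / (2 * Real.pi)) (g := fun t => Kernel.U .coulomb2
      (t • EuclideanSpace.single 0 1)) (fun t ht => by
        rw [Kernel.U, norm_smul_single_of_pos ht]
        simp
        field_simp) hL (by
        rw [mderiv_single, iterate_pderiv_smul_single])
  rw [show (-(m + 2) : ℝ) = -((1 : ℕ) + (m + 1 : ℕ)) by push_cast; ring]
  exact this

lemma exists_le_farField_poisson_three (m : ℕ) (ρ : E 3 → ℝ) {y : E 3} (hy : y ∈ tsupport ρ) :
    ∃ c : ℝ, 0 < c ∧ ∀ L : ℝ, 0 < L →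
      ENNReal.ofReal (c * L ^ (-(m + 2) : ℝ)) ≤ Kernel.farField .poisson3 m ρ L := by
  have hpi := Real.pi_pos
  refine ⟨|1 / (4 * Real.pi)| * zpowFactor 1 (m + 1),
    mul_pos (by positivity) (zpowFactor_pos one_pos _), fun L hL => ?_⟩
  have := ofReal_rpow_le_farField_of_axis .poisson3 (m := m) hy
    (β := Pi.single 0 (m + 1)) (by simp) 0
    (n := m + 1) (k := 1) (A := 1 / (4 * Real.pi)) (g := fun t => Kernel.U .poisson3
      (t • EuclideanSpace.single 0 1)) (fun t ht => by
        rw [Kernel.U, norm_smul_single_of_pos ht]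
        simp
        field_simp) hL (by
        rw [mderiv_single, iterate_pderiv_smul_single])
  rw [show (-(m + 2) : ℝ) = -((1 : ℕ) + (m + 1 : ℕ)) by push_cast; ring]
  exact this

lemma exists_le_farField_poisson_two (m : ℕ) (ρ : E 2 → ℝ) {y : E 2} (hy : y ∈ tsupport ρ) :
    ∃ c : ℝ, 0 < c ∧ ∀ L : ℝ, 0 < L →
      ENNReal.ofReal (c * L ^ (-(m + 1) : ℝ)) ≤ Kernel.farField .poisson2 m ρ L := by
  have hpi := Real.pi_pos
  refine ⟨|-(1 / (2 * Real.pi))| * zpowFactor 1 m,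
    mul_pos (by rw [abs_neg]; positivity) (zpowFactor_pos one_pos _), fun L hL => ?_⟩
  have := ofReal_rpow_le_farField_of_axis .poisson2 (m := m) hy
    (β := Pi.single 0 (m + 1)) (by simp) 0
    (n := m) (k := 1) (A := -(1 / (2 * Real.pi))) (g := fun t => -(1 / (2 * Real.pi)) * t⁻¹)
    (fun t ht => by simp) hL (by
        rw [mderiv_single, iterate_pderiv_smul_single, iteratedDeriv_succ']
        congr 1
        funext t
        have e : (fun t : ℝ => Kernel.U .poisson2 (t • EuclideanSpace.single 0 1)) =
            fun t => -(1 / (2 * Real.pi)) * Real.log t := by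
          funext t
          rw [Kernel.U, norm_smul, PiLp.norm_single, norm_one, mul_one, Real.norm_eq_abs,
            Real.log_abs]
        rw [e, deriv_const_mul_field, Real.deriv_log])
  rw [show (-(m + 1) : ℝ) = -((1 : ℕ) + m) by push_cast; ring]
  exact this

lemma norm_smul_single_add_smul_single {i j : Fin d} (h : i ≠ j) (s t : ℝ) :
    ‖s • EuclideanSpace.single i (1 : ℝ) + t • EuclideanSpace.single j (1 : ℝ)‖ =
      √(s ^ 2 + t ^ 2) := by
  rw [norm_eq_sqrt_real_inner]
  congr 1
  simp only [inner_add_left, inner_add_right, real_inner_smul_left, real_inner_smul_right,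
    EuclideanSpace.inner_single_left]
  simp [h, h.symm]
  ring

lemma iteratedDeriv_two_sqrt {s : ℝ} (hs : 0 < s) :
    iteratedDeriv 2 (fun t => √(s ^ 2 + t ^ 2)) 0 = s⁻¹ := by
  have hp : ∀ t : ℝ, s ^ 2 + t ^ 2 ≠ 0 := fun t => by positivity
  have h1 : deriv (fun t => √(s ^ 2 + t ^ 2)) = fun t => t / √(s ^ 2 + t ^ 2) := by
    funext t
    have := ((hasDerivAt_id t).pow 2 |>.const_add (s ^ 2)).sqrt (hp t)
    refine (this.congr_deriv ?_).deriv
    simp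
    field_simp
  rw [iteratedDeriv_succ, iteratedDeriv_one, h1]
  have h2 : HasDerivAt (fun t => √(s ^ 2 + t ^ 2)) (deriv (fun t => √(s ^ 2 + t ^ 2)) 0) 0 := by
    refine DifferentiableAt.hasDerivAt ?_
    exact (((hasDerivAt_id (0 : ℝ)).pow 2 |>.const_add (s ^ 2)).sqrt (hp 0)).differentiableAt
  have h3 := (hasDerivAt_id (0 : ℝ)).div h2 (by positivity)
  refine (h3.congr_deriv ?_).deriv
  have : √(s ^ 2) = s := Real.sqrt_sq hs.le
  simp [this]
  field_simp

lemma exists_le_farField_biharmonic_three (m : ℕ) (ρ : E 3 → ℝ) {y : E 3} (hy : y ∈ tsupport ρ) :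
    ∃ c : ℝ, 0 < c ∧ ∀ L : ℝ, 0 < L →
      ENNReal.ofReal (c * L ^ (-m : ℝ)) ≤ Kernel.farField .biharmonic3 m ρ L := by
  have hpi := Real.pi_pos
  rcases m with _ | m
  · refine ⟨1 / (8 * Real.pi), by positivity, fun L hL => ?_⟩
    refine ofReal_le_farField .biharmonic3 (β := Pi.single 0 1) (by simp)
      (smul_single_mem_frontier hL 0) hy ?_
    rw [mderiv_single, iterate_pderiv_smul_single, iteratedDeriv_one]
    have e : (fun t : ℝ => Kernel.U .biharmonic3 (t • EuclideanSpace.single 0 1)) =ᶠ[nhds L]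
        fun t => t / (8 * Real.pi) := by
      filter_upwards [lt_mem_nhds hL] with t ht
      rw [Kernel.U, norm_smul_single_of_pos ht]
    rw [e.deriv_eq, deriv_div_const, deriv_id'']
    simpa using le_abs_self (1 / (8 * Real.pi))
  · refine ⟨|1 / (8 * Real.pi)| * zpowFactor 1 m,
      mul_pos (by positivity) (zpowFactor_pos one_pos _), fun L hL => ?_⟩
    have := ofReal_rpow_le_farField_of_axis .biharmonic3 hy (β := ![m, 2, 0]) (m := m + 1)
      (by simp [Fin.sum_univ_three]) 0 (n := m) (k := 1) (A := 1 / (8 * Real.pi))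
      (g := fun t => (pderiv 1)^[2] (Kernel.U .biharmonic3) (t • EuclideanSpace.single 0 1))
      (fun t ht => by
        have h1 := iterate_pderiv_eq_iteratedDeriv 1 (Kernel.U .biharmonic3) 2
          (t • EuclideanSpace.single 0 1) 0
        rw [zero_smul, add_zero] at h1
        rw [h1]
        have e : (fun r : ℝ => Kernel.U .biharmonic3
            (t • EuclideanSpace.single 0 1 + r • EuclideanSpace.single 1 1)) =
            fun r => 1 / (8 * Real.pi) * √(t ^ 2 + r ^ 2) := by
          funext r
          rw [Kernel.U, norm_smul_single_add_smul_single (by decide)]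
          ring
        rw [e, iteratedDeriv_const_mul_field, iteratedDeriv_two_sqrt ht]
        simp) hL (by
        rw [mderiv_three]
        exact iterate_pderiv_smul_single 0 _ m L)
    rw [show (-((m + 1 : ℕ) : ℝ) : ℝ) = -((1 : ℕ) + m) by push_cast; ring]
    exact this

lemma iteratedDeriv_succ_of_hasDerivAt {f f' : ℝ → ℝ} (h : ∀ t, 0 < t → HasDerivAt f (f' t) t)
    (n : ℕ) {s : ℝ} (hs : 0 < s) : iteratedDeriv (n + 1) f s = iteratedDeriv n f' s := by
  rw [iteratedDeriv_succ']
  refine Filter.EventuallyEq.iteratedDeriv_eq n ?_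
  filter_upwards [lt_mem_nhds hs] with t ht using (h t ht).deriv

lemma hasDerivAt_biharmonic_line (b t : ℝ) (ht : 0 < t) :
    HasDerivAt (fun t : ℝ => (t ^ 2 + b ^ 2) * (Real.log (t ^ 2 + b ^ 2) - 2))
      (2 * t * (Real.log (t ^ 2 + b ^ 2) - 1)) t := by
  have hp : t ^ 2 + b ^ 2 ≠ 0 := by positivity
  have h1 : HasDerivAt (fun t : ℝ => t ^ 2 + b ^ 2) (2 * t) t := by
    simpa using (hasDerivAt_pow 2 t).add_const (b ^ 2)
  refine (h1.mul ((h1.log hp).sub_const 2)).congr_deriv ?_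
  field_simp
  ring

lemma hasDerivAt_biharmonic_line_deriv (b t : ℝ) (ht : 0 < t) :
    HasDerivAt (fun t : ℝ => 2 * t * (Real.log (t ^ 2 + b ^ 2) - 1))
      (2 * (Real.log (t ^ 2 + b ^ 2) - 1) + 4 * t ^ 2 / (t ^ 2 + b ^ 2)) t := by
  have hp : t ^ 2 + b ^ 2 ≠ 0 := by positivity
  have h1 : HasDerivAt (fun t : ℝ => t ^ 2 + b ^ 2) (2 * t) t := by
    simpa using (hasDerivAt_pow 2 t).add_const (b ^ 2)
  refine (((hasDerivAt_id t).const_mul 2).mul ((h1.log hp).sub_const 1)).congr_deriv ?_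
  simp
  field_simp
  ring

lemma biharmonic_two_line (b t : ℝ) :
    Kernel.U .biharmonic2 (b • EuclideanSpace.single 1 1 + t • EuclideanSpace.single 0 1) =
      -(1 / (16 * Real.pi)) * ((t ^ 2 + b ^ 2) * (Real.log (t ^ 2 + b ^ 2) - 2)) := by
  have := Real.pi_pos
  rw [Kernel.U, norm_smul_single_add_smul_single (by decide), Real.log_sqrt (by positivity),
    Real.sq_sqrt (by positivity), add_comm (b ^ 2)]
  field_simp
  ring

lemma mderiv_biharmonic_two_line (b t : ℝ) (n : ℕ) :
    mderiv (Pi.single 0 n) (Kernel.U .biharmonic2)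
      (b • EuclideanSpace.single 1 1 + t • EuclideanSpace.single 0 1) =
      -(1 / (16 * Real.pi)) * iteratedDeriv n
        (fun t : ℝ => (t ^ 2 + b ^ 2) * (Real.log (t ^ 2 + b ^ 2) - 2)) t := by
  rw [mderiv_single, iterate_pderiv_eq_iteratedDeriv]
  simp_rw [biharmonic_two_line]
  rw [iteratedDeriv_const_mul_field]

lemma corner_mem_frontier {L : ℝ} (hL : 0 < L) :
    L • EuclideanSpace.single 1 (1 : ℝ) + L • EuclideanSpace.single 0 (1 : ℝ) ∈
      frontier (box 2 L) := by
  refine mem_frontier_box hL (i := 0) (fun j => ?_) (by simp [abs_of_pos hL])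
  fin_cases j <;> simp [hL.le]

lemma exists_le_farField_biharmonic_two_of_le_one {m : ℕ} (h1 : m ≤ 1) (ρ : E 2 → ℝ) {y : E 2}
    (hy : y ∈ tsupport ρ) :
    ∃ c : ℝ, 0 < c ∧ ∀ L : ℝ, 0 < L →
      ENNReal.ofReal (c * (L ^ (1 - m : ℝ) * (1 + |Real.log L|))) ≤
        Kernel.farField .biharmonic2 m ρ L := by
  have hpi := Real.pi_pos
  refine ⟨1 / (16 * Real.pi) * (1 / 10), by positivity, fun L hL => ?_⟩
  set ℓ := Real.log L with hℓ
  set A : ℝ := 1 / (16 * Real.pi) with hA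
  have hA0 : 0 < A := by positivity
  have e0 : Real.log (L ^ 2 + 0 ^ 2) = 2 * ℓ := by
    rw [zero_pow two_ne_zero, add_zero, Real.log_pow, Nat.cast_two]
  have e1 : Real.log (L ^ 2 + L ^ 2) = Real.log 2 + 2 * ℓ := by
    rw [← two_mul, Real.log_mul two_ne_zero (by positivity), Real.log_pow, Nat.cast_two]
  have l1 := Real.log_two_gt_d9
  have l2 := Real.log_two_lt_d9
  have key : ∀ b : ℝ, (b = 0 ∨ b = L) → ∀ z : ℝ, 1 / 10 * (L ^ (1 - m : ℝ) * (1 + |ℓ|)) ≤ |z| →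
      iteratedDeriv (m + 1) (fun t : ℝ => (t ^ 2 + b ^ 2) * (Real.log (t ^ 2 + b ^ 2) - 2)) L = z →
      ENNReal.ofReal (A * (1 / 10) * (L ^ (1 - m : ℝ) * (1 + |ℓ|))) ≤
        Kernel.farField .biharmonic2 m ρ L := by
    intro b hb z hz he
    refine ofReal_le_farField .biharmonic2 (β := Pi.single 0 (m + 1)) (by simp)
      (x := b • EuclideanSpace.single 1 1 + L • EuclideanSpace.single 0 1) ?_ hy ?_
    · rcases hb with rfl | rfl
      · simpa using smul_single_mem_frontier hL 0
      · exact corner_mem_frontier hL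
    · rw [mderiv_biharmonic_two_line, he, ← hA, abs_mul, abs_neg, abs_of_pos hA0, mul_assoc]
      gcongr
  interval_cases m
  · have f : ∀ b : ℝ, iteratedDeriv (0 + 1)
        (fun t : ℝ => (t ^ 2 + b ^ 2) * (Real.log (t ^ 2 + b ^ 2) - 2)) L =
        2 * L * (Real.log (L ^ 2 + b ^ 2) - 1) := fun b => by
      rw [iteratedDeriv_succ_of_hasDerivAt (hasDerivAt_biharmonic_line b) _ hL, iteratedDeriv_zero]
    rw [Nat.cast_zero, sub_zero, Real.rpow_one] at key ⊢
    by_cases h : 1 / 20 * (1 + |ℓ|) ≤ |2 * ℓ - 1|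
    · refine key 0 (.inl rfl) _ ?_ (f 0)
      rw [e0, abs_mul, abs_of_pos (by positivity : 0 < 2 * L)]
      nlinarith
    · refine key L (.inr rfl) _ ?_ (f L)
      rw [e1, abs_mul, abs_of_pos (by positivity : 0 < 2 * L)]
      have : 1 / 20 * (1 + |ℓ|) ≤ |Real.log 2 + 2 * ℓ - 1| := by
        rcases abs_cases ℓ with h3 | h3 <;> rcases abs_cases (2 * ℓ - 1) with h4 | h4 <;>
          rcases abs_cases (Real.log 2 + 2 * ℓ - 1) with h5 | h5 <;> linarith
      nlinarith
  · have f : ∀ b : ℝ, iteratedDeriv (1 + 1)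
        (fun t : ℝ => (t ^ 2 + b ^ 2) * (Real.log (t ^ 2 + b ^ 2) - 2)) L =
        2 * (Real.log (L ^ 2 + b ^ 2) - 1) + 4 * L ^ 2 / (L ^ 2 + b ^ 2) := fun b => by
      have h := iteratedDeriv_succ_of_hasDerivAt (hasDerivAt_biharmonic_line_deriv b) 0 hL
      rw [zero_add, iteratedDeriv_zero] at h
      rw [iteratedDeriv_succ_of_hasDerivAt (hasDerivAt_biharmonic_line b) _ hL, h]
    rw [Nat.cast_one, sub_self, Real.rpow_zero, one_mul] at key ⊢
    have q0 : 2 * (2 * ℓ - 1) + 4 * L ^ 2 / (L ^ 2 + 0 ^ 2) = 2 * (2 * ℓ + 1) := by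
      field_simp; ring
    have q1 : 2 * (Real.log 2 + 2 * ℓ - 1) + 4 * L ^ 2 / (L ^ 2 + L ^ 2) =
        2 * (Real.log 2 + 2 * ℓ) := by
      field_simp; ring
    by_cases h : 1 / 20 * (1 + |ℓ|) ≤ |2 * ℓ + 1|
    · refine key 0 (.inl rfl) _ ?_ (f 0)
      rw [e0, q0, abs_mul, abs_two]
      linarith
    · refine key L (.inr rfl) _ ?_ (f L)
      rw [e1, q1, abs_mul, abs_two]
      have : 1 / 20 * (1 + |ℓ|) ≤ |Real.log 2 + 2 * ℓ| := by
        rcases abs_cases ℓ with h3 | h3 <;> rcases abs_cases (2 * ℓ + 1) with h4 | h4 <;>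
          rcases abs_cases (Real.log 2 + 2 * ℓ) with h5 | h5 <;> linarith
      linarith

lemma exists_le_farField_biharmonic_two_of_two_le {m : ℕ} (h2 : 2 ≤ m) (ρ : E 2 → ℝ) {y : E 2}
    (hy : y ∈ tsupport ρ) :
    ∃ c : ℝ, 0 < c ∧ ∀ L : ℝ, 0 < L →
      ENNReal.ofReal (c * L ^ (1 - m : ℝ)) ≤ Kernel.farField .biharmonic2 m ρ L := by
  obtain ⟨n, rfl⟩ := Nat.exists_eq_add_of_le' h2
  have hpi := Real.pi_pos
  refine ⟨1 / (16 * Real.pi) * (|(4 : ℝ)| * zpowFactor 1 n),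
    mul_pos (by positivity) (mul_pos (by positivity) (zpowFactor_pos one_pos _)), fun L hL => ?_⟩
  refine ofReal_le_farField .biharmonic2 (β := Pi.single 0 (n + 2 + 1)) (by simp)
      (x := (0 : ℝ) • EuclideanSpace.single 1 1 + L • EuclideanSpace.single 0 1) ?_ hy ?_
  · simpa using smul_single_mem_frontier hL 0
  rw [mderiv_biharmonic_two_line, abs_mul, abs_neg,
    abs_of_pos (by positivity : 0 < 1 / (16 * Real.pi)), mul_assoc]
  refine mul_le_mul_of_nonneg_left (le_of_eq ?_) (by positivity)
  rw [iteratedDeriv_succ_of_hasDerivAt (hasDerivAt_biharmonic_line 0) _ hL,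
    iteratedDeriv_succ_of_hasDerivAt (hasDerivAt_biharmonic_line_deriv 0) _ hL,
    iteratedDeriv_succ_of_hasDerivAt (f' := fun t => 4 * t ^ (-(1 : ℕ) : ℤ)) ?_ _ hL,
    abs_iteratedDeriv_zpow hL (fun t _ => rfl)]
  · congr 2
    push_cast
    ring
  · intro t ht
    have h1 : HasDerivAt (fun t : ℝ => 4 * Real.log t + 2) (4 * t⁻¹) t :=
      ((Real.hasDerivAt_log ht.ne').const_mul 4).add_const 2
    rw [show (-(1 : ℕ) : ℤ) = -1 by norm_num, zpow_neg_one]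
    refine h1.congr_of_eventuallyEq ?_
    filter_upwards [lt_mem_nhds ht] with s hs
    rw [zero_pow two_ne_zero, add_zero, Real.log_pow]
    field_simp
    push_cast
    ring

lemma dipole_nondegenerate {a b : E 3} (ha : ‖a‖ = 1) (hb : ‖b‖ = 1) :
    (∃ i, inner ℝ a b - 3 * (a i * b i) ≠ 0) ∨ ∃ i j, i < j ∧ a i * b j + a j * b i ≠ 0 := by
  by_contra! h
  obtain ⟨h1, h2⟩ := h
  have h01 := h2 0 1 (by decide)
  have h02 := h2 0 2 (by decide)
  have h12 := h2 1 2 (by decide)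
  have i0 := h1 0
  have i1 := h1 1
  have i2 := h1 2
  have na : a 0 ^ 2 + a 1 ^ 2 + a 2 ^ 2 = 1 := by
    rw [← Fin.sum_univ_three (fun i => a i ^ 2), ← EuclideanSpace.real_norm_sq_eq, ha, one_pow]
  have nb : b 0 ^ 2 + b 1 ^ 2 + b 2 ^ 2 = 1 := by
    rw [← Fin.sum_univ_three (fun i => b i ^ 2), ← EuclideanSpace.real_norm_sq_eq, hb, one_pow]
  set κ : ℝ := inner ℝ a b / 3 with hκ
  have j0 : a 0 * b 0 = κ := by rw [hκ]; linarith
  have j1 : a 1 * b 1 = κ := by rw [hκ]; linarith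
  have j2 : a 2 * b 2 = κ := by rw [hκ]; linarith
  have k01 : (a 0 * b 1) ^ 2 = -κ ^ 2 := by
    linear_combination a 0 * b 1 * h01 - (a 1 * b 1) * j0 - κ * j1
  have k02 : (a 0 * b 2) ^ 2 = -κ ^ 2 := by
    linear_combination a 0 * b 2 * h02 - (a 2 * b 2) * j0 - κ * j2
  have k12 : (a 1 * b 2) ^ 2 = -κ ^ 2 := by
    linear_combination a 1 * b 2 * h12 - (a 2 * b 2) * j1 - κ * j2
  have k10 : (a 1 * b 0) ^ 2 = -κ ^ 2 := by
    linear_combination a 1 * b 0 * h01 - (a 1 * b 1) * j0 - κ * j1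
  have k20 : (a 2 * b 0) ^ 2 = -κ ^ 2 := by
    linear_combination a 2 * b 0 * h02 - (a 2 * b 2) * j0 - κ * j2
  have k21 : (a 2 * b 1) ^ 2 = -κ ^ 2 := by
    linear_combination a 2 * b 1 * h12 - (a 2 * b 2) * j1 - κ * j2
  have hprod : (a 0 ^ 2 + a 1 ^ 2 + a 2 ^ 2) * (b 0 ^ 2 + b 1 ^ 2 + b 2 ^ 2) = -3 * κ ^ 2 := by
    linear_combination k01 + k02 + k12 + k10 + k20 + k21 + (a 0 * b 0 + κ) * j0 +
      (a 1 * b 1 + κ) * j1 + (a 2 * b 2 + κ) * j2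
  rw [na, nb] at hprod
  nlinarith [sq_nonneg κ]

lemma dipole_axis {a b : E 3} (ha : ‖a‖ = 1) (hb : ‖b‖ = 1) (i : Fin 3) {t : ℝ} (ht : 0 < t) :
    Kernel.U (.dipole3 a b ha hb) (t • EuclideanSpace.single i 1) =
      3 / (4 * Real.pi) * (inner ℝ a b - 3 * (a i * b i)) * t ^ (-(3 : ℕ) : ℤ) := by
  rw [Kernel.U, norm_smul_single_of_pos ht, real_inner_smul_left, real_inner_smul_left,
    EuclideanSpace.inner_single_left, EuclideanSpace.inner_single_left, zpow_neg, zpow_natCast]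
  simp
  field_simp

lemma pderiv_dipole_axis {a b : E 3} (ha : ‖a‖ = 1) (hb : ‖b‖ = 1) {i j : Fin 3} (hij : i ≠ j)
    {t : ℝ} (ht : 0 < t) :
    pderiv j (Kernel.U (.dipole3 a b ha hb)) (t • EuclideanSpace.single i 1) =
      -(9 / (4 * Real.pi)) * (a i * b j + a j * b i) * t ^ (-(4 : ℕ) : ℤ) := by
  have hpi := Real.pi_pos
  have h1 : ∀ r : ℝ, Kernel.U (.dipole3 a b ha hb)
      (t • EuclideanSpace.single i 1 + r • EuclideanSpace.single j 1) =
      3 / (4 * Real.pi) * (inner ℝ a b - 3 * (t * a i + r * a j) * (t * b i + r * b j) /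
        (t ^ 2 + r ^ 2)) / √(t ^ 2 + r ^ 2) ^ 3 := by
    intro r
    rw [Kernel.U, norm_smul_single_add_smul_single hij, Real.sq_sqrt (by positivity)]
    simp only [inner_add_left, real_inner_smul_left, EuclideanSpace.inner_single_left]
    simp
  have hp : ∀ r : ℝ, t ^ 2 + r ^ 2 ≠ 0 := fun r => by positivity
  have hN : HasDerivAt (fun r : ℝ => t ^ 2 + r ^ 2) 0 0 := by
    simpa using (hasDerivAt_pow 2 (0 : ℝ)).const_add (t ^ 2)
  have hS := hN.sqrt (hp 0)
  have hA : HasDerivAt (fun r : ℝ => t * a i + r * a j) (a j) 0 := by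
    simpa using ((hasDerivAt_id (0 : ℝ)).mul_const (a j)).const_add (t * a i)
  have hB : HasDerivAt (fun r : ℝ => t * b i + r * b j) (b j) 0 := by
    simpa using ((hasDerivAt_id (0 : ℝ)).mul_const (b j)).const_add (t * b i)
  have hs : √(t ^ 2) = t := Real.sqrt_sq ht.le
  have hfin := (((((hA.const_mul 3).mul hB).div hN (hp 0)).const_sub (inner ℝ a b)).const_mul
    (3 / (4 * Real.pi))).div (hS.pow 3)
    (pow_ne_zero 3 (Real.sqrt_ne_zero'.2 (by positivity)))
  rw [pderiv, lineDeriv]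
  simp_rw [h1]
  refine (hfin.congr_deriv ?_).deriv
  simp only [Pi.mul_apply, Pi.pow_apply, zero_pow two_ne_zero, add_zero, zero_mul, zero_div,
    mul_zero, sub_zero, hs, zpow_neg, zpow_natCast]
  field_simp
  ring

lemma exists_le_farField_dipole {a b : E 3} (ha : ‖a‖ = 1) (hb : ‖b‖ = 1) (m : ℕ) (ρ : E 3 → ℝ)
    {y : E 3} (hy : y ∈ tsupport ρ) :
    ∃ c : ℝ, 0 < c ∧ ∀ L : ℝ, 0 < L →
      ENNReal.ofReal (c * L ^ (-(m + 4) : ℝ)) ≤ Kernel.farField (.dipole3 a b ha hb) m ρ L := by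
  have hpi := Real.pi_pos
  rcases dipole_nondegenerate ha hb with ⟨i, hi⟩ | ⟨i, j, hij, hc⟩
  · refine ⟨|3 / (4 * Real.pi) * (inner ℝ a b - 3 * (a i * b i))| * zpowFactor 3 (m + 1),
      mul_pos (by positivity) (zpowFactor_pos three_pos _), fun L hL => ?_⟩
    have := ofReal_rpow_le_farField_of_axis (.dipole3 a b ha hb) (m := m) hy
      (β := Pi.single i (m + 1)) (by simp) i (n := m + 1) (k := 3)
      (g := fun t => Kernel.U (.dipole3 a b ha hb) (t • EuclideanSpace.single i 1))
      (fun t ht => dipole_axis ha hb i ht) hL (by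
        rw [mderiv_single, iterate_pderiv_smul_single])
    rw [show (-(m + 4) : ℝ) = -((3 : ℕ) + (m + 1 : ℕ)) by push_cast; ring]
    exact this
  · refine ⟨|-(9 / (4 * Real.pi)) * (a i * b j + a j * b i)| * zpowFactor 4 m,
      mul_pos (by rw [abs_mul, abs_neg]; positivity) (zpowFactor_pos four_pos _), fun L hL => ?_⟩
    have := ofReal_rpow_le_farField_of_axis (.dipole3 a b ha hb) (m := m) hy
      (β := Pi.single i m + Pi.single j 1) (by simp [Finset.sum_add_distrib]) i (n := m) (k := 4)
      (g := fun t => pderiv j (Kernel.U (.dipole3 a b ha hb)) (t • EuclideanSpace.single i 1))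
      (fun t ht => pderiv_dipole_axis ha hb hij.ne ht) hL (by
        rw [mderiv_three, ← iterate_pderiv_smul_single]
        fin_cases i <;> fin_cases j <;> first | exact absurd hij (by decide) | simp)
    rw [show (-(m + 4) : ℝ) = -((4 : ℕ) + m) by push_cast; ring]
    exact this

/-! ### Directional derivatives of the density -/

lemma contDiff_lineDeriv {ρ : E d → ℝ} (hρ : ContDiff ℝ ∞ ρ) (v : E d) :
    ContDiff ℝ ∞ fun y => lineDeriv ℝ ρ y v := by
  have e : (fun y => lineDeriv ℝ ρ y v) = fun y => fderiv ℝ ρ y v := by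
    funext y
    exact ((hρ.differentiable (by simp)) y).lineDeriv_eq_fderiv
  rw [e]
  exact (hρ.fderiv_right (by simp)).clm_apply contDiff_const

lemma hasCompactSupport_lineDeriv {ρ : E d → ℝ} (hρ : ContDiff ℝ ∞ ρ) (hs : HasCompactSupport ρ)
    (v : E d) : HasCompactSupport fun y => lineDeriv ℝ ρ y v := by
  have e : (fun y => lineDeriv ℝ ρ y v) = fun y => fderiv ℝ ρ y v := by
    funext y
    exact ((hρ.differentiable (by simp)) y).lineDeriv_eq_fderiv
  rw [e]
  exact hs.fderiv_apply (𝕜 := ℝ) v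

lemma integral_lineDeriv_smul {G : Type*} [NormedAddCommGroup G] [NormedSpace ℝ G]
    {ρ : E d → ℝ} (hρ : ContDiff ℝ ∞ ρ) (hs : HasCompactSupport ρ) {v : E d} {g g' : E d → G}
    (hg : ContDiff ℝ 1 g) (hg' : ∀ x, HasLineDerivAt ℝ g (g' x) x v) :
    ∫ x, lineDeriv ℝ ρ x v • g x = -∫ x, ρ x • g' x := by
  have hd := hρ.differentiable (by simp)
  have hgd := hg.differentiable (by simp)
  have e1 : ∀ x, lineDeriv ℝ ρ x v = fderiv ℝ ρ x v := fun x => (hd x).lineDeriv_eq_fderiv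
  have e2 : ∀ x, g' x = fderiv ℝ g x v := fun x => by
    rw [← (hg' x).lineDeriv, (hgd x).lineDeriv_eq_fderiv]
  have c1 : Continuous fun x => fderiv ℝ ρ x v :=
    ((hρ.fderiv_right (m := ∞) (by simp)).clm_apply contDiff_const).continuous
  have c2 : Continuous fun x => fderiv ℝ g x v :=
    ((hg.fderiv_right (m := 0) (by simp)).clm_apply contDiff_const).continuous
  simp_rw [e1, e2]
  rw [integral_smul_fderiv_eq_neg_fderiv_smul_of_integrable (𝕜 := ℝ) _ _ _
    (fun x _ => hd x) (fun x _ => hgd x), neg_neg]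
  · exact (c1.smul hg.continuous).integrable_of_hasCompactSupport
      ((hs.fderiv_apply (𝕜 := ℝ) v).smul_right)
  · exact (hρ.continuous.smul c2).integrable_of_hasCompactSupport hs.smul_right
  · exact (hρ.continuous.smul hg.continuous).integrable_of_hasCompactSupport hs.smul_right

lemma fourier_lineDeriv {ρ : E d → ℝ} (hρ : ContDiff ℝ ∞ ρ) (hs : HasCompactSupport ρ)
    (v k : E d) :
    fourier (fun y => lineDeriv ℝ ρ y v) k = Complex.I * (inner ℝ k v : ℝ) * fourier ρ k := by
  have hg : ContDiff ℝ 1 fun x : E d => Complex.exp (-(Complex.I * (inner ℝ k x : ℝ))) := by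
    have h1 : ContDiff ℝ 1 fun x : E d => ((inner ℝ k x : ℝ) : ℂ) :=
      Complex.ofRealCLM.contDiff.comp (contDiff_const.inner ℝ contDiff_id)
    exact (contDiff_const.mul h1).neg.cexp
  have hg' : ∀ x : E d, HasLineDerivAt ℝ
      (fun x : E d => Complex.exp (-(Complex.I * (inner ℝ k x : ℝ))))
      (-(Complex.I * (inner ℝ k v : ℝ)) * Complex.exp (-(Complex.I * (inner ℝ k x : ℝ)))) x v := by
    intro x
    unfold HasLineDerivAt
    have h1 : HasDerivAt (fun t : ℝ => ((inner ℝ k (x + t • v) : ℝ) : ℂ)) (inner ℝ k v : ℝ) 0 := by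
      have : HasDerivAt (fun t : ℝ => inner ℝ k (x + t • v)) (inner ℝ k v) 0 := by
        simp_rw [inner_add_right, real_inner_smul_right]
        simpa using ((hasDerivAt_id (0 : ℝ)).mul_const (inner ℝ k v)).const_add (inner ℝ k x)
      exact this.ofReal_comp
    refine ((h1.const_mul Complex.I).neg.cexp).congr_deriv ?_
    simp
    ring
  have h := integral_lineDeriv_smul hρ hs hg hg'
  simp_rw [Complex.real_smul] at h
  rw [fourier, fourier, h, ← integral_const_mul, ← integral_neg]
  refine integral_congr_ae (.of_forall fun x => ?_)
  simp only
  ring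

lemma contDiff_monomial (α : Fin d → ℕ) : ContDiff ℝ 1 (monomial α) := by
  unfold monomial
  fun_prop

lemma hasLineDerivAt_monomial (α : Fin d → ℕ) (x v : E d) :
    HasLineDerivAt ℝ (monomial α)
      (∑ i, v i * α i * monomial (Function.update α i (α i - 1)) x) x v := by
  unfold HasLineDerivAt
  have h : ∀ i ∈ (Finset.univ : Finset (Fin d)), HasDerivAt (fun t : ℝ => (x i + t * v i) ^ α i)
      (α i * x i ^ (α i - 1) * v i) 0 := by
    intro i _
    have h1 : HasDerivAt (fun t : ℝ => x i + t * v i) (v i) 0 := by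
      simpa using ((hasDerivAt_id (0 : ℝ)).mul_const (v i)).const_add (x i)
    simpa using h1.fun_pow (α i)
  have h2 := HasDerivAt.fun_finsetProd h
  have e : (fun t : ℝ => monomial α (x + t • v)) = fun t : ℝ => ∏ i, (x i + t * v i) ^ α i := by
    funext t
    simp [monomial]
  rw [e]
  refine h2.congr_deriv (Finset.sum_congr rfl fun i _ => ?_)
  have e2 : monomial (Function.update α i (α i - 1)) x =
      x i ^ (α i - 1) * ∏ j ∈ Finset.univ.erase i, x j ^ α j := by
    rw [monomial, ← Finset.mul_prod_erase _ _ (Finset.mem_univ i), Function.update_self]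
    congr 1
    refine Finset.prod_congr rfl fun j hj => ?_
    rw [Function.update_of_ne (Finset.ne_of_mem_erase hj)]
  rw [e2]
  simp
  ring

lemma VanishingMoments.lineDeriv {m : ℕ} {ρ : E d → ℝ} (hm : VanishingMoments m ρ)
    (hρ : ContDiff ℝ ∞ ρ) (hs : HasCompactSupport ρ) (v : E d) :
    VanishingMoments (m + 1) fun y => lineDeriv ℝ ρ y v := by
  intro α hα
  have h := integral_lineDeriv_smul hρ hs (contDiff_monomial α)
    (fun x => hasLineDerivAt_monomial α x v)
  simp_rw [smul_eq_mul] at h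
  rw [h, neg_eq_zero]
  simp_rw [Finset.mul_sum]
  rw [integral_finsetSum]
  · refine Finset.sum_eq_zero fun i _ => ?_
    rcases Nat.eq_zero_or_pos (α i) with h0 | h0
    · simp [h0]
    · have h1 : ∑ j, Function.update α i (α i - 1) j ≤ m := by
        have := Finset.sum_update_of_mem (Finset.mem_univ i) α (α i - 1)
        have h2 := Finset.add_sum_erase Finset.univ α (Finset.mem_univ i)
        rw [Finset.erase_eq] at h2
        omega
      have h3 := hm _ h1
      simp_rw [show ∀ x : E d, ρ x * (v i * α i * monomial (Function.update α i (α i - 1)) x) =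
        v i * α i * (ρ x * monomial (Function.update α i (α i - 1)) x) from fun x => by ring]
      rw [integral_const_mul, h3, mul_zero]
  · intro i _
    refine Continuous.integrable_of_hasCompactSupport ?_ hs.mul_right
    have := (contDiff_monomial (d := d) (Function.update α i (α i - 1))).continuous
    have := hρ.continuous
    fun_prop

/-! ### The alternating Poisson summation formula for the density -/

lemma tendsto_conv_heat {ρ : E d → ℝ} (hc : Continuous ρ) (hs : HasCompactSupport ρ) (z : E d) :
    Filter.Tendsto (fun t => conv (heat t) ρ z) (nhdsWithin 0 (Set.Ioi 0)) (nhds (ρ z)) := by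
  obtain ⟨B, hB⟩ := hc.bounded_above_of_compact_support hs
  have hlim : Filter.Tendsto (fun t : ℝ => ∫ v : E d, heat 1 v * ρ (z - √t • v))
      (nhdsWithin 0 (Set.Ioi 0)) (nhds (∫ v : E d, heat 1 v * ρ z)) := by
    refine tendsto_integral_filter_of_dominated_convergence (fun v => heat 1 v * B) ?_ ?_ ?_ ?_
    · refine .of_forall fun t => Continuous.aestronglyMeasurable ?_
      fun_prop
    · refine .of_forall fun t => .of_forall fun v => ?_
      rw [norm_mul, Real.norm_of_nonneg (heat_nonneg _ _)]
      exact mul_le_mul_of_nonneg_left (hB _) (heat_nonneg _ _)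
    · exact (integrable_heat one_pos).mul_const _
    · refine .of_forall fun v => ?_
      have h1 : Continuous fun t : ℝ => heat 1 v * ρ (z - √t • v) := by fun_prop
      have h2 := h1.tendsto 0
      simp only [Real.sqrt_zero, zero_smul, sub_zero] at h2
      exact h2.mono_left nhdsWithin_le_nhds
  rw [integral_mul_const, integral_heat one_pos, one_mul] at hlim
  refine hlim.congr' ?_
  filter_upwards [self_mem_nhdsWithin] with t ht
  have ht0 : (0 : ℝ) < t := ht
  have hst : 0 < √t := Real.sqrt_pos.2 ht0
  have h1 := Measure.integral_comp_smul (volume : Measure (E d))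
    (fun v => heat 1 v * ρ (z - √t • v)) (√t)⁻¹
  rw [finrank_euclideanSpace_fin, inv_pow, inv_inv, abs_of_pos (by positivity), smul_eq_mul] at h1
  have h0 := integral_sub_left_eq_self (fun y => heat t (z - y) * ρ y) volume z
  simp only [sub_sub_cancel] at h0
  rw [conv, ← h0]
  have h2 : ∀ u : E d, heat t u * ρ (z - u) =
      (√t ^ d)⁻¹ * (heat 1 ((√t)⁻¹ • u) * ρ (z - √t • (√t)⁻¹ • u)) := by
    intro u
    have e1 : ‖(√t)⁻¹ • u‖ ^ 2 / (4 * 1) = ‖u‖ ^ 2 / (4 * t) := by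
      rw [norm_smul, Real.norm_of_nonneg (by positivity), mul_pow, inv_pow, Real.sq_sqrt ht0.le]
      field_simp
    rw [smul_inv_smul₀ hst.ne', heat, heat, e1, Real.sqrt_mul (by positivity) t, mul_one, mul_inv,
      mul_pow, inv_pow (√t)]
    ring
  simp_rw [h2]
  rw [integral_const_mul, h1, inv_mul_cancel_left₀ (by positivity)]

lemma apply_add_period_eq_zero {ρ : E d → ℝ} (hc : Continuous ρ) {L : ℝ} (hL : 0 < L)
    (hsub : tsupport ρ ⊆ box d L) {x : E d} (hx : x ∈ box d L) {n : Fin d → ℤ} (hn : n ≠ 0) :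
    ρ (x + period L n) = 0 := by
  by_contra h
  obtain ⟨i, hi⟩ := Function.ne_iff.1 hn
  have hopen : IsOpen (Function.support ρ) := hc.isOpen_support
  have hint : x + period L n ∈ interior (box d L) :=
    interior_mono ((subset_tsupport ρ).trans hsub) (hopen.interior_eq.symm ▸ h)
  have hlt : |(x + period L n) i| < L := by
    refine lt_of_le_of_ne (abs_le.2 (interior_subset hint i)) fun he => ?_
    exact (mem_frontier_box hL (interior_subset hint) he).2 hint
  have e : (x + period L n) i = x i + 2 * L * n i := by simp [period]
  rw [e] at hlt
  have h1 : (1 : ℝ) ≤ |(n i : ℝ)| := by exact_mod_cast Int.one_le_abs hi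
  have h2 := abs_le.2 (hx i)
  have h3 : |2 * L * (n i : ℝ)| = 2 * L * |(n i : ℝ)| := by
    rw [abs_mul, abs_of_pos (by positivity)]
  have h4 : |2 * L * (n i : ℝ)| ≤ |x i + 2 * L * n i| + |x i| := by
    have := abs_sub (x i + 2 * L * n i) (x i)
    rwa [add_sub_cancel_left] at this
  nlinarith

lemma fullSum_one_eq {m : ℕ} {ρ : E d → ℝ} (hm : VanishingMoments m ρ) (hρ : ContDiff ℝ ∞ ρ)
    (hs : HasCompactSupport ρ) (hd : 0 < d) {L : ℝ} (hL : 0 < L) (hsub : tsupport ρ ⊆ box d L)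
    {x : E d} (hx : x ∈ box d L) : fullSum (fun _ => 1) ρ L x = ρ x := by
  have hc := hρ.continuous
  obtain ⟨B, hB⟩ := hc.bounded_above_of_compact_support hs
  have hB0 : 0 ≤ B := (norm_nonneg _).trans (hB 0)
  obtain ⟨C, hC, hCb⟩ := hm.exists_conv_heat_le hc hs
  have ht0 : ∀ᶠ t : ℝ in nhdsWithin 0 (Set.Ioi 0), 0 < t := self_mem_nhdsWithin
  have hn : Filter.Tendsto (fun t => theta ρ L t x) (nhdsWithin 0 (Set.Ioi 0))
      (nhds (∑' n : Fin d → ℤ, altSign n * (ρ (x + period L n) : ℂ))) := by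
    refine tendsto_tsum_of_dominated_convergence
      (bound := fun n => (B + C * 2 ^ (d + m + 1) * (L ^ (d + m + 1))⁻¹) *
        ((1 + ‖n‖) ^ (d + m + 1))⁻¹)
      ((summable_one_add_norm_inv_pow hd (by omega)).mul_left _) (fun n => ?_) ?_
    · exact (Complex.continuous_ofReal.tendsto _).comp (tendsto_conv_heat hc hs _) |>.const_mul _
    · filter_upwards [ht0] with t ht n
      rw [norm_mul, norm_altSign, one_mul, Complex.norm_real, Real.norm_eq_abs]
      have p : 0 ≤ C * 2 ^ (d + m + 1) * (L ^ (d + m + 1))⁻¹ := by positivity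
      by_cases hn : n = 0
      · subst hn
        have := abs_conv_heat_le hB ht (x + period L 0)
        simp only [norm_zero, add_zero, one_pow, inv_one, mul_one]
        linarith
      · have h1 := (hCb t ht (x + period L n)).1
        have h2 := norm_add_period_ge_half hL hx n hn
        have h3 : |conv (heat t) ρ (x + period L n)| * (L * ((1 + ‖n‖) / 2)) ^ (d + m + 1) ≤ C :=
          le_trans (by gcongr) h1
        rw [← le_div_iff₀ (by positivity)] at h3
        refine h3.trans ?_
        have h4 : C / (L * ((1 + ‖n‖) / 2)) ^ (d + m + 1) =
            C * 2 ^ (d + m + 1) * (L ^ (d + m + 1))⁻¹ * ((1 + ‖n‖) ^ (d + m + 1))⁻¹ := by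
          rw [mul_pow, div_pow]
          field_simp
        rw [h4]
        gcongr
        linarith
  have hp : Filter.Tendsto (fun t => theta ρ L t x) (nhdsWithin 0 (Set.Ioi 0))
      (nhds (fullSum (fun _ => 1) ρ L x)) := by
    have h1 : Filter.Tendsto (fun t : ℝ => ∑' p : Fin d → ℤ, 1 / (2 * (L : ℂ)) ^ d *
        ((Real.exp (-(t * ‖node L p‖ ^ 2)) : ℂ) *
        (fourier ρ (node L p) * Complex.exp (Complex.I * (inner ℝ (node L p) x : ℝ)))))
        (nhdsWithin 0 (Set.Ioi 0)) (nhds (fullSum (fun _ => 1) ρ L x)) := by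
      refine tendsto_tsum_of_dominated_convergence
        (bound := fun p => ‖1 / (2 * (L : ℂ)) ^ d‖ * ‖(((fun _ => 1 : E d → ℝ) (node L p)) : ℂ) *
          fourier ρ (node L p)‖)
        ((summable_symbol_mul_fourier hρ hs hL hd (f := fun _ => 1) (B := 1)
          (fun p => by simp)).mul_left _) (fun p => ?_) ?_
      · have h2 : Continuous fun t : ℝ => 1 / (2 * (L : ℂ)) ^ d *
            ((Real.exp (-(t * ‖node L p‖ ^ 2)) : ℂ) *
            (fourier ρ (node L p) * Complex.exp (Complex.I * (inner ℝ (node L p) x : ℝ)))) := by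
          fun_prop
        have h3 := h2.tendsto 0
        simp only [zero_mul, neg_zero, Real.exp_zero, Complex.ofReal_one, one_mul] at h3
        simp only [Complex.ofReal_one, one_mul]
        exact h3.mono_left nhdsWithin_le_nhds
      · filter_upwards [ht0] with t ht p
        rw [norm_mul, norm_mul, norm_mul, norm_mul, mul_comm Complex.I,
          Complex.norm_exp_ofReal_mul_I, mul_one, Complex.norm_real,
          Real.norm_of_nonneg (Real.exp_pos _).le]
        have : Real.exp (-(t * ‖node L p‖ ^ 2)) ≤ 1 :=
          Real.exp_le_one_iff.2 (neg_nonpos.2 (by positivity))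
        simp only [Complex.ofReal_one, norm_one]
        gcongr
    refine h1.congr' ?_
    filter_upwards [ht0] with t ht
    exact (hasSum_theta hc hs hL ht x).2.tsum_eq
  rw [tendsto_nhds_unique hp hn, tsum_eq_single 0]
  · rw [altSign_zero, period_zero, add_zero, one_mul]
  · intro n hn
    rw [apply_add_period_eq_zero hc hL hsub hx hn, Complex.ofReal_zero, mul_zero]

lemma summable_fullSum {ρ : E d → ℝ} (hρ : ContDiff ℝ ∞ ρ) (hs : HasCompactSupport ρ)
    {L : ℝ} (hL : 0 < L) (hd : 0 < d) {f : E d → ℝ} {B : ℝ} (hf : ∀ p, |f (node L p)| ≤ B)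
    (x : E d) :
    Summable fun p : Fin d → ℤ => 1 / (2 * (L : ℂ)) ^ d * ((f (node L p) : ℂ) *
      fourier ρ (node L p) * Complex.exp (Complex.I * (inner ℝ (node L p) x : ℝ))) := by
  refine Summable.mul_left _ (Summable.of_norm ?_)
  refine (summable_symbol_mul_fourier hρ hs hL hd hf).congr fun p => ?_
  rw [norm_mul _ (Complex.exp _), mul_comm Complex.I, Complex.norm_exp_ofReal_mul_I, mul_one]

lemma abs_poisson_symbol_node_le {L : ℝ} (hL : 0 < L) (hd : 0 < d) (p : Fin d → ℤ) :
    |1 / ‖node L p‖ ^ 2| ≤ L ^ 2 := by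
  have h := (norm_node_ge hL hd p).1
  rw [abs_of_nonneg (by positivity), one_div, ← inv_pow]
  have : 0 < 1 / L := by positivity
  gcongr
  rw [inv_le_comm₀ (by linarith) hL]
  simpa using h

lemma exists_error_dipole {a b : E 3} (ha : ‖a‖ = 1) (hb : ‖b‖ = 1) {m : ℕ} {ρ : E 3 → ℝ}
    (hm : VanishingMoments m ρ) (hρ : ContDiff ℝ ∞ ρ) (hs : HasCompactSupport ρ) :
    ∃ C : ℝ, 0 ≤ C ∧ ∀ L : ℝ, 0 < L → tsupport ρ ⊆ box 3 L → ∀ x ∈ box 3 L,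
      ‖fullSum (Kernel.symbol (.dipole3 a b ha hb)) ρ L x -
        (Kernel.potential (.dipole3 a b ha hb) ρ x : ℂ)‖ ≤ C * L ^ (-(m + 4) : ℝ) := by
  set ρ' : E 3 → ℝ := fun y => lineDeriv ℝ (fun z => lineDeriv ℝ ρ z b) y a with hρ'
  have s1 := contDiff_lineDeriv hρ b
  have k1 := hasCompactSupport_lineDeriv hρ hs b
  have s2 : ContDiff ℝ ∞ ρ' := contDiff_lineDeriv s1 a
  have k2 : HasCompactSupport ρ' := hasCompactSupport_lineDeriv s1 k1 a
  have m2 : VanishingMoments (m + 1 + 1) ρ' := (hm.lineDeriv hρ hs b).lineDeriv s1 k1 a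
  obtain ⟨C, hC, h⟩ := exists_error_poisson_three m2 s2 k2
  refine ⟨3 * C, by positivity, fun L hL hsub x hx => ?_⟩
  have h1 := h L hL x hx
  have hf : ∀ k : E 3, fourier ρ' k = -((inner ℝ k a * inner ℝ k b : ℝ) : ℂ) * fourier ρ k := by
    intro k
    rw [hρ', fourier_lineDeriv s1 k1, fourier_lineDeriv hρ hs]
    push_cast
    linear_combination ((inner ℝ k a : ℝ) : ℂ) * ((inner ℝ k b : ℝ) : ℂ) * fourier ρ k *
      Complex.I_mul_I
  have i1 := summable_fullSum hρ hs hL three_pos (f := fun _ => 1) (B := 1) (fun p => by simp) x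
  have i2 := summable_fullSum s2 k2 hL three_pos (f := Kernel.symbol .poisson3)
    (abs_poisson_symbol_node_le hL three_pos) x
  have hsum : fullSum (Kernel.symbol (.dipole3 a b ha hb)) ρ L x =
      -((inner ℝ a b : ℝ) : ℂ) * fullSum (fun _ => 1) ρ L x +
        -3 * fullSum (Kernel.symbol .poisson3) ρ' L x := by
    rw [fullSum, fullSum, fullSum, ← tsum_mul_left, ← tsum_mul_left,
      ← (i1.mul_left _).tsum_add (i2.mul_left _)]
    refine tsum_congr fun p => ?_
    simp only [Kernel.symbol, hf]
    push_cast
    ring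
  rw [hsum, fullSum_one_eq hm hρ hs three_pos hL hsub hx]
  have e : -((inner ℝ a b : ℝ) : ℂ) * (ρ x : ℂ) + -3 * fullSum (Kernel.symbol .poisson3) ρ' L x -
      (Kernel.potential (.dipole3 a b ha hb) ρ x : ℂ) =
      -3 * (fullSum (Kernel.symbol .poisson3) ρ' L x - (Kernel.potential .poisson3 ρ' x : ℂ)) := by
    simp only [Kernel.potential, ← hρ']
    push_cast
    ring
  rw [e, norm_mul]
  rw [show (-(((m + 1 + 1 : ℕ) : ℝ) + 2) : ℝ) = -(m + 4) by push_cast; ring] at h1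
  calc _ ≤ 3 * (C * L ^ (-(m + 4) : ℝ)) := by
        gcongr
        simp
    _ = _ := by ring

/-! ### Exponentially decaying kernels -/

/-- The properties of a mixture of exponentials `e^{-μ r}` with `μ ≥ lam` that the error bound
for the Yukawa kernel rests on. -/
structure IsExpMixture (lam : ℝ) (G : ℝ → ℝ) : Prop where
  pos : ∀ r, 0 < r → 0 < G r
  decay : ∀ r s, 0 < r → 0 ≤ s → G (r + s) ≤ Real.exp (-(lam * s)) * G r
  le_abs_iteratedDeriv : ∀ r, 0 < r → ∀ n, lam ^ n * G r ≤ |iteratedDeriv n G r|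

lemma isExpMixture_mgf {μ : Measure ℝ} (hμ : μ ≠ 0) {X : ℝ → ℝ} {lam A : ℝ} (hlam : 0 < lam)
    (hA : 0 < A) (hX : ∀ᵐ u ∂μ, X u ≤ -lam)
    (hint : ∀ r : ℝ, 0 < r → Integrable (fun u => Real.exp (r * X u)) μ) :
    IsExpMixture lam fun r => A * ProbabilityTheory.mgf X μ r := by
  have hmem : ∀ r : ℝ, 0 < r → r ∈ interior (ProbabilityTheory.integrableExpSet X μ) := fun r hr =>
    mem_interior_iff_mem_nhds.2 (Filter.mem_of_superset (Ioi_mem_nhds hr) fun s hs => hint s hs)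
  refine ⟨fun r hr => ?_, fun r s hr hs => ?_, fun r hr n => ?_⟩
  · exact mul_pos hA (ProbabilityTheory.mgf_pos' hμ (hint r hr))
  · rw [mul_left_comm]
    refine mul_le_mul_of_nonneg_left ?_ hA.le
    rw [ProbabilityTheory.mgf, ProbabilityTheory.mgf, ← integral_const_mul]
    refine integral_mono_ae (hint _ (by linarith)) ((hint r hr).const_mul _) ?_
    filter_upwards [hX] with u hu
    rw [← Real.exp_add, Real.exp_le_exp]
    nlinarith
  · have hi := ProbabilityTheory.iteratedDeriv_mgf (hmem r hr) n
    have hpow : ∀ u, X u ≤ -lam → lam ^ n * Real.exp (r * X u) ≤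
        (-1) ^ n * (X u ^ n * Real.exp (r * X u)) := by
      intro u hu
      rw [← mul_assoc, ← mul_pow]
      gcongr
      linarith
    have hXi : Integrable (fun u => X u ^ n * Real.exp (r * X u)) μ :=
      ProbabilityTheory.integrable_pow_mul_exp_of_mem_interior_integrableExpSet (hmem r hr) n
    rw [iteratedDeriv_const_mul_field, abs_mul, abs_of_pos hA, mul_left_comm]
    refine mul_le_mul_of_nonneg_left ?_ hA.le
    calc lam ^ n * ProbabilityTheory.mgf X μ r
        = ∫ u, lam ^ n * Real.exp (r * X u) ∂μ := by rw [integral_const_mul]; rfl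
      _ ≤ ∫ u, (-1) ^ n * (X u ^ n * Real.exp (r * X u)) ∂μ :=
          integral_mono_ae ((hint r hr).const_mul _) (hXi.const_mul _)
            (hX.mono fun u hu => hpow u hu)
      _ = (-1) ^ n * iteratedDeriv n (ProbabilityTheory.mgf X μ) r := by
          rw [integral_const_mul, hi]
      _ ≤ |(-1) ^ n * iteratedDeriv n (ProbabilityTheory.mgf X μ) r| := le_abs_self _
      _ = _ := by rw [abs_mul, abs_pow, abs_neg, abs_one, one_pow, one_mul]

lemma isExpMixture_besselK0 {lam : ℝ} (hlam : 0 < lam) :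
    IsExpMixture lam fun r => 1 / (2 * Real.pi) * besselK0 (lam * r) := by
  have hpi := Real.pi_pos
  have e : (fun r => 1 / (2 * Real.pi) * besselK0 (lam * r)) = fun r => 1 / (2 * Real.pi) *
      ProbabilityTheory.mgf (fun t => -(lam * Real.cosh t)) (volume.restrict (Set.Ioi 0)) r := by
    funext r
    rw [besselK0, ProbabilityTheory.mgf]
    congr 1
    refine integral_congr_ae (.of_forall fun t => ?_)
    simp only
    ring_nf
  rw [e]
  refine isExpMixture_mgf (μ := volume.restrict (Set.Ioi 0)) (by simp) hlam (by positivity) (.of_forall fun t => ?_) fun r hr => ?_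
  · nlinarith [Real.one_le_cosh t]
  · refine Integrable.mono' (exp_neg_integrableOn_Ioi 0 (by positivity : 0 < r * lam / 2))
      (Continuous.aestronglyMeasurable (by fun_prop)) (.of_forall fun t => ?_)
    rw [Real.norm_of_nonneg (Real.exp_pos _).le, Real.exp_le_exp]
    have h1 : t / 2 ≤ Real.cosh t := by
      rw [Real.cosh_eq]
      linarith [Real.add_one_le_exp t, Real.exp_pos (-t)]
    have h2 : r * lam * (t / 2) ≤ r * lam * Real.cosh t := by gcongr
    linarith

lemma exp_div_eq_mgf {lam r : ℝ} (hr : 0 < r) :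
    1 / (4 * Real.pi * r) * Real.exp (-(lam * r)) = 1 / (4 * Real.pi) *
      ProbabilityTheory.mgf (fun t => -t) (volume.restrict (Set.Ioi lam)) r := by
  have hpi := Real.pi_pos
  have h := integral_exp_mul_Ioi (neg_lt_zero.2 hr) lam
  have e : ProbabilityTheory.mgf (fun t => -t) (volume.restrict (Set.Ioi lam)) r =
      ∫ t in Set.Ioi lam, Real.exp (-r * t) := by
    rw [ProbabilityTheory.mgf]
    simp only [mul_neg, neg_mul]
  rw [e, h, neg_div_neg_eq, show -r * lam = -(lam * r) by ring]
  field_simp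

lemma isExpMixture_exp_div {lam : ℝ} (hlam : 0 < lam) :
    IsExpMixture lam fun r => 1 / (4 * Real.pi) *
      ProbabilityTheory.mgf (fun t => -t) (volume.restrict (Set.Ioi lam)) r := by
  have hpi := Real.pi_pos
  refine isExpMixture_mgf (μ := volume.restrict (Set.Ioi lam)) (by simp) hlam (by positivity) ?_ fun r hr => ?_
  · exact (ae_restrict_iff' measurableSet_Ioi).2 (.of_forall fun t ht => neg_le_neg (le_of_lt ht))
  · refine (exp_neg_integrableOn_Ioi lam hr).congr (.of_forall fun t => ?_)
    simp only [mul_neg, neg_mul]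

lemma isHeatRepresentation_exp {U : E d → ℝ} {lam : ℝ} (hlam : 0 < lam)
    (hU : ∀ z, z ≠ 0 → U z = ∫ t in Set.Ioi 0, Real.exp (-(lam ^ 2 * t)) * heat t z) :
    IsHeatRepresentation U (fun t => Real.exp (-(lam ^ 2 * t))) (fun _ => 0) (fun _ => 0) where
  measurable_w := by fun_prop
  measurable_c₀ := by fun_prop
  measurable_c₂ := by fun_prop
  nonneg t ht := by positivity
  integrable_w := (Continuous.integrableOn_Icc (by fun_prop)).mono_set Set.Ioc_subset_Icc_self
  integrable_c₀ := by simp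
  integrable_c₂ := by simp
  eq_integral z hz := by
    rw [hU z hz]
    simp
  bound R := by
    refine ⟨fun t => Real.exp (-(lam ^ 2) * t), exp_neg_integrableOn_Ioi 1 (by positivity),
      fun t ht z _ => ?_⟩
    have ht0 : 0 < t := by linarith
    have hpi := Real.pi_gt_three
    have h1 : heat t z ≤ 1 := by
      refine (heat_le ht0 z).trans (pow_le_one₀ (by positivity) (inv_le_one_of_one_le₀ ?_))
      rw [Real.one_le_sqrt]
      nlinarith
    have h0 := heat_nonneg t z
    simp only [sub_zero, zero_mul]
    rw [abs_of_nonneg (by positivity), neg_mul]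
    exact mul_le_of_le_one_right (Real.exp_pos _).le h1

lemma heat_le_heat {t : ℝ} (ht : 0 < t) {z z' : E d} (h : ‖z'‖ ≤ ‖z‖) : heat t z ≤ heat t z' := by
  unfold heat
  gcongr

lemma abs_conv_heat_le_of_le_norm {ρ : E d → ℝ} (hc : Continuous ρ) (hs : HasCompactSupport ρ)
    {t : ℝ} (ht : 0 < t) {z z' : E d} (h : ∀ y, ρ y ≠ 0 → ‖z'‖ ≤ ‖z - y‖) :
    |conv (heat t) ρ z| ≤ (∫ y, |ρ y|) * heat t z' := by
  have hint : Integrable ρ := hc.integrable_of_hasCompactSupport hs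
  rw [conv, ← integral_mul_const, ← Real.norm_eq_abs]
  refine norm_integral_le_of_norm_le (hint.abs.mul_const _) (.of_forall fun y => ?_)
  by_cases hy : ρ y = 0
  · simp [hy]
  rw [norm_mul, Real.norm_of_nonneg (heat_nonneg _ _), Real.norm_eq_abs, mul_comm]
  exact mul_le_mul_of_nonneg_left (heat_le_heat ht (h y hy)) (abs_nonneg _)

lemma summable_exp_neg_norm {lam : ℝ} (hlam : 0 < lam) (hd : 0 < d) :
    Summable fun n : Fin d → ℤ => Real.exp (-(lam * (2 * (‖n‖ - 1)))) := by
  refine Summable.of_nonneg_of_le (fun n => (Real.exp_pos _).le) (fun n => ?_)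
    ((summable_one_add_norm_inv_pow hd (Nat.lt_succ_self d)).mul_left
      (Real.exp (4 * lam) * ((d + 1).factorial / (2 * lam) ^ (d + 1))))
  have h := Real.pow_div_factorial_le_exp (2 * lam * (1 + ‖n‖)) (by positivity) (d + 1)
  have e : Real.exp (-(lam * (2 * (‖n‖ - 1)))) =
      Real.exp (4 * lam) * (Real.exp (2 * lam * (1 + ‖n‖)))⁻¹ := by
    rw [← Real.exp_neg, ← Real.exp_add]
    ring_nf
  rw [e, mul_assoc (Real.exp (4 * lam))]
  refine mul_le_mul_of_nonneg_left ?_ (Real.exp_pos _).le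
  refine (inv_anti₀ (by positivity) h).trans (le_of_eq ?_)
  rw [mul_pow, inv_div]
  field_simp

lemma norm_add_period_sub_ge {L L₁ : ℝ} (hL : 0 < L) {x y : E d} (hx : x ∈ box d L)
    (hy : y ∈ box d L₁) {n : Fin d → ℤ} (hn : n ≠ 0) :
    L - L₁ + 2 * L * (‖n‖ - 1) ≤ ‖x + period L n - y‖ := by
  obtain ⟨i, hi, -⟩ := norm_add_period_ge hL hx n hn
  have h2 := PiLp.norm_apply_le (x + period L n - y) i
  have e : ‖(x + period L n - y) i‖ = |x i + 2 * L * n i - y i| := by simp [period]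
  rw [e] at h2
  have h3 := abs_sub_abs_le_abs_sub (x i + 2 * L * n i) (y i)
  have h4 := abs_le.2 (hy i)
  linarith

lemma exists_enorm_fullSum_sub_conv_le {U f : E d → ℝ} {w G : ℝ → ℝ} {lam : ℝ} (hlam : 0 < lam)
    (hG : IsExpMixture lam G) (hUG : ∀ z, z ≠ 0 → U z = G ‖z‖)
    (h : IsHeatRepresentation U w (fun _ => 0) (fun _ => 0)) (hw : IsHeatWeight w f)
    (hd : 0 < d) {ρ : E d → ℝ} (hρ : ContDiff ℝ ∞ ρ) (hs : HasCompactSupport ρ)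
    (h0 : ∫ y, ρ y = 0) {L₁ : ℝ} (hL₁ : 0 ≤ L₁) (hsub : tsupport ρ ⊆ box d L₁) :
    ∃ C : ℝ, 0 ≤ C ∧ ∀ L : ℝ, L₁ + 1 ≤ L → ∀ x ∈ box d L,
      ‖fullSum f ρ L x - (conv U ρ x : ℂ)‖ₑ ≤ ENNReal.ofReal (C * G (L - L₁)) := by
  have hc := hρ.continuous
  set I : ℝ := ∫ y, |ρ y| with hI
  have hI0 : 0 ≤ I := integral_nonneg fun y => abs_nonneg _
  have hsumm := summable_exp_neg_norm hlam hd
  set S : ℝ := ∑' n : Fin d → ℤ, Real.exp (-(lam * (2 * (‖n‖ - 1)))) with hS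
  have hS0 : 0 ≤ S := tsum_nonneg fun n => (Real.exp_pos _).le
  refine ⟨I * S, by positivity, fun L hL x hx => ?_⟩
  have hL' : 0 < L := by linarith
  have hLL : 0 < L - L₁ := by linarith
  set r : (Fin d → ℤ) → ℝ := fun n => L - L₁ + 2 * L * (‖n‖ - 1) with hr
  set e : ℝ → E d := fun s => s • EuclideanSpace.single ⟨0, hd⟩ 1 with he
  have hr0 : ∀ n, n ≠ 0 → L - L₁ + 2 * (‖n‖ - 1) ≤ r n ∧ 1 ≤ ‖n‖ := by
    intro n hn
    obtain ⟨_, _, h1⟩ := norm_add_period_ge hL' hx n hn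
    refine ⟨?_, h1⟩
    simp only [hr]
    nlinarith
  have hrpos : ∀ n, n ≠ 0 → 0 < r n := fun n hn => by
    have := hr0 n hn
    linarith
  have hne : ∀ s, 0 < s → ‖e s‖ = s := fun s hs => norm_smul_single_of_pos hs _
  have hGint : ∀ s, 0 < s → IntegrableOn (fun t => w t * heat t (e s)) (Set.Ioi 0) ∧
      ∫ t in Set.Ioi 0, w t * heat t (e s) = G s := by
    intro s hs
    have h1 : e s ≠ 0 := by rw [← norm_pos_iff, hne s hs]; exact hs
    have h2 := h.eq_integral (e s) h1
    rw [hUG _ h1, hne s hs] at h2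
    simp only [sub_zero, zero_mul] at h2
    refine ⟨?_, h2.symm⟩
    by_contra h3
    rw [integral_undef h3] at h2
    exact (hG.pos s hs).ne' h2
  obtain ⟨i1, e1⟩ := hw.integrable_and_integral_eq hρ hs hL' hd (hw.abs_node_le hd hL') x
  obtain ⟨i2, e2⟩ := h.integrable_and_conv_eq hd hc hs h0 x
  simp only [zero_mul, neg_zero, add_zero] at i2 e2
  have e3 : fullSum f ρ L x - (conv U ρ x : ℂ) =
      ∫ t in Set.Ioi 0, (w t : ℂ) * (theta ρ L t x - (conv (heat t) ρ x : ℂ)) := by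
    rw [← e1, e2, ← integral_complex_ofReal,
      ← integral_sub (g := fun t => ((w t * conv (heat t) ρ x : ℝ) : ℂ)) i1 i2.ofReal]
    refine integral_congr_ae (.of_forall fun t => ?_)
    simp only
    push_cast
    ring
  have hpt : ∀ t ∈ Set.Ioi (0 : ℝ), ‖(w t : ℂ) * (theta ρ L t x - (conv (heat t) ρ x : ℂ))‖ₑ ≤
      ∑' n : Fin d → ℤ, if n = 0 then 0 else ENNReal.ofReal (I * (w t * heat t (e (r n)))) := by
    intro t ht
    have ht0 : (0 : ℝ) < t := ht
    have hwt := h.nonneg t ht0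
    rw [theta_sub_eq_tsum hc hs hL' ht0, ← tsum_mul_left]
    refine enorm_tsum_le_tsum_enorm.trans (ENNReal.tsum_le_tsum fun n => ?_)
    by_cases hn : n = 0
    · simp [hn]
    simp only [hn, if_false]
    rw [← ofReal_norm, norm_mul, norm_mul, norm_altSign, one_mul, Complex.norm_real,
      Complex.norm_real, Real.norm_of_nonneg hwt, Real.norm_eq_abs]
    refine ENNReal.ofReal_le_ofReal ?_
    rw [mul_left_comm]
    refine mul_le_mul_of_nonneg_left ?_ hwt
    refine abs_conv_heat_le_of_le_norm hc hs ht0 fun y hy => ?_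
    rw [hne _ (hrpos n hn)]
    exact norm_add_period_sub_ge hL' hx (hsub (subset_tsupport ρ hy)) hn
  rw [e3]
  calc ‖∫ t in Set.Ioi 0, (w t : ℂ) * (theta ρ L t x - (conv (heat t) ρ x : ℂ))‖ₑ
      ≤ ∫⁻ t in Set.Ioi 0, ‖(w t : ℂ) * (theta ρ L t x - (conv (heat t) ρ x : ℂ))‖ₑ :=
        enorm_integral_le_lintegral_enorm _
    _ ≤ ∫⁻ t in Set.Ioi 0, ∑' n : Fin d → ℤ, if n = 0 then 0 else
          ENNReal.ofReal (I * (w t * heat t (e (r n)))) := setLIntegral_mono' measurableSet_Ioi hpt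
    _ = ∑' n : Fin d → ℤ, ∫⁻ t in Set.Ioi 0, if n = 0 then 0 else
          ENNReal.ofReal (I * (w t * heat t (e (r n)))) := by
        refine lintegral_tsum fun n => ?_
        by_cases hn : n = 0
        · simp [hn]
        simp only [hn, if_false]
        exact (((hGint _ (hrpos n hn)).1.aestronglyMeasurable.aemeasurable).const_mul I).ennreal_ofReal
    _ ≤ ∑' n : Fin d → ℤ,
          ENNReal.ofReal (I * (Real.exp (-(lam * (2 * (‖n‖ - 1)))) * G (L - L₁))) := by
        refine ENNReal.tsum_le_tsum fun n => ?_
        by_cases hn : n = 0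
        · simp [hn]
        simp only [hn, if_false]
        obtain ⟨j1, j2⟩ := hGint _ (hrpos n hn)
        rw [← ofReal_integral_eq_lintegral_ofReal (j1.const_mul I)
          ((ae_restrict_iff' measurableSet_Ioi).2 (.of_forall fun t ht =>
            mul_nonneg hI0 (mul_nonneg (h.nonneg t ht) (heat_nonneg _ _)))),
          integral_const_mul, j2]
        refine ENNReal.ofReal_le_ofReal (mul_le_mul_of_nonneg_left ?_ hI0)
        obtain ⟨k1, k2⟩ := hr0 n hn
        have k3 : r n = (L - L₁) + (r n - (L - L₁)) := by ring
        rw [k3]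
        refine (hG.decay _ _ hLL (by linarith)).trans ?_
        refine mul_le_mul_of_nonneg_right (Real.exp_le_exp.2 ?_) (hG.pos _ hLL).le
        refine neg_le_neg (mul_le_mul_of_nonneg_left ?_ hlam.le)
        linarith
    _ = ENNReal.ofReal (I * S * G (L - L₁)) := by
        have hGp := (hG.pos _ hLL).le
        rw [← ENNReal.ofReal_tsum_of_nonneg (fun n => by positivity)
          ((hsumm.mul_right _).mul_left _), tsum_mul_left, tsum_mul_right, mul_assoc]

/-- The smallest box that contains a compact set touches it. -/
lemma exists_extremal_point (hd : 0 < d) {s : Set (E d)} (hs : IsCompact s) (hne : s.Nonempty) :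
    ∃ y ∈ s, ∃ i, ∀ y' ∈ s, ∀ j, |y' j| ≤ |y i| := by
  have : Nonempty (Fin d) := ⟨⟨0, hd⟩⟩
  have hcont : Continuous fun y : E d => ‖WithLp.ofLp y‖ := by fun_prop
  obtain ⟨y, hy, hmax⟩ := hs.exists_isMaxOn hne hcont.continuousOn
  obtain ⟨i, -, hi⟩ := Finset.univ.exists_max_image (fun i => |y i|) Finset.univ_nonempty
  refine ⟨y, hy, i, fun y' hy' j => ?_⟩
  have h1 : ‖WithLp.ofLp y‖ ≤ |y i| :=
    (pi_norm_le_iff_of_nonneg (abs_nonneg _)).2 fun j => hi j (Finset.mem_univ j)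
  exact (norm_le_pi_norm (WithLp.ofLp y') j).trans ((hmax hy').trans h1)

lemma exists_extremal_point_tsupport (hd : 0 < d) {ρ : E d → ℝ} (hc : Continuous ρ)
    (hs : HasCompactSupport ρ) (hne : (tsupport ρ).Nonempty) :
    ∃ y ∈ tsupport ρ, ∃ i, 0 < |y i| ∧ ∀ y' ∈ tsupport ρ, ∀ j, |y' j| ≤ |y i| := by
  obtain ⟨y, hy, i, hi⟩ := exists_extremal_point hd hs.isCompact hne
  refine ⟨y, hy, i, lt_of_le_of_ne (abs_nonneg _) fun h => ?_, hi⟩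
  obtain ⟨z, hz⟩ : (Function.support ρ).Nonempty := by
    by_contra h
    rw [Set.not_nonempty_iff_eq_empty] at h
    rw [tsupport, h, closure_empty] at hne
    exact Set.not_nonempty_empty hne
  have hcont : Continuous fun s : ℝ => ρ (z + s • EuclideanSpace.single i 1) := by fun_prop
  have h1 := (hcont.tendsto 0).mono_left (nhdsWithin_le_nhds (s := Set.Ioi 0))
  simp only [zero_smul, add_zero] at h1
  obtain ⟨s, hs1, hs0⟩ := ((h1.eventually_ne hz).and self_mem_nhdsWithin).exists
  have b1 := hi _ (subset_tsupport ρ hz) i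
  have b2 := hi _ (subset_tsupport ρ hs1) i
  rw [← h, abs_nonpos_iff] at b1 b2
  simp [b1] at b2
  exact (ne_of_gt hs0) b2

lemma abs_iteratedDeriv_radial {U : E d → ℝ} {G : ℝ → ℝ} (hUG : ∀ z, z ≠ 0 → U z = G ‖z‖)
    (i : Fin d) (n : ℕ) {r s : ℝ} (hr : 0 < r) (hs : |s| = r) :
    |(pderiv i)^[n] U (s • EuclideanSpace.single i 1)| = |iteratedDeriv n G r| := by
  set g : ℝ → ℝ := fun t => U (t • EuclideanSpace.single i 1) with hg
  have hG : g =ᶠ[nhds r] G := by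
    filter_upwards [lt_mem_nhds hr] with t ht
    have h1 := norm_smul_single_of_pos ht i
    rw [hg]
    simp only
    rw [hUG _ (by rw [← norm_pos_iff, h1]; exact ht), h1]
  have heven : (fun t => g (-t)) = g := by
    funext t
    by_cases h : t = 0
    · simp [h]
    have h1 : ∀ u : ℝ, u ≠ 0 → u • EuclideanSpace.single i (1 : ℝ) ≠ 0 := fun u hu => by
      simp [hu]
    simp only [hg]
    rw [hUG _ (h1 _ h), hUG _ (h1 _ (neg_ne_zero.2 h)), neg_smul, norm_neg]
  rw [iterate_pderiv_smul_single]
  rcases abs_eq hr.le |>.1 hs with rfl | rfl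
  · rw [hG.iteratedDeriv_eq]
  · have := iteratedDeriv_comp_neg n g r
    rw [heven, hG.iteratedDeriv_eq] at this
    rw [this, smul_eq_mul, abs_mul, abs_pow, abs_neg, abs_one, one_pow, one_mul]

lemma le_farField_of_isExpMixture (K : Kernel d) {lam : ℝ} {G : ℝ → ℝ} (hG : IsExpMixture lam G)
    (hUG : ∀ z, z ≠ 0 → K.U z = G ‖z‖) (m : ℕ) {ρ : E d → ℝ} {y : E d} (hy : y ∈ tsupport ρ)
    (i : Fin d) (hi : ∀ j, |y j| ≤ |y i|) {L : ℝ} (hL : 0 < L) :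
    ENNReal.ofReal (lam ^ (m + 1) * G L) ≤ K.farField m ρ L ∧
      (|y i| < L → ENNReal.ofReal (lam ^ (m + 1) * G (L - |y i|)) ≤ K.farField m ρ L) := by
  constructor
  · refine ofReal_le_farField K (β := Pi.single i (m + 1)) (by simp)
      (smul_single_mem_frontier hL i) hy ?_
    rw [mderiv_single, abs_iteratedDeriv_radial hUG i _ hL (abs_of_pos hL)]
    exact hG.le_abs_iteratedDeriv L hL _
  · intro hlt
    have hr : 0 < L - |y i| := by linarith
    obtain ⟨σ, hσ, hσy⟩ : ∃ σ : ℝ, |σ| = 1 ∧ y i = σ * |y i| := by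
      rcases le_total 0 (y i) with h | h
      · exact ⟨1, abs_one, by rw [abs_of_nonneg h, one_mul]⟩
      · exact ⟨-1, by simp, by rw [abs_of_nonpos h]; ring⟩
    set x : E d := y + (σ * (L - |y i|)) • EuclideanSpace.single i 1 with hx
    have hxi : x i = σ * L := by
      simp [hx]
      linear_combination hσy
    have hxf : x ∈ frontier (box d L) := by
      have habs : |x i| = L := by rw [hxi, abs_mul, hσ, one_mul, abs_of_pos hL]
      refine mem_frontier_box hL (i := i) (fun j => ?_) habs
      rw [Set.mem_Icc, ← abs_le]
      by_cases hj : j = i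
      · rw [hj, habs]
      · have : x j = y j := by simp [hx, hj]
        rw [this]
        exact (hi j).trans hlt.le
    refine le_trans ?_ (norm_mderiv_le_farField K (β := Pi.single i (m + 1)) (by simp) hxf hy
      (s := 1) (by simp))
    rw [one_smul, hx, add_sub_cancel_left, mderiv_single, Real.enorm_eq_ofReal_abs,
      abs_iteratedDeriv_radial hUG i _ hr (by rw [abs_mul, hσ, one_mul, abs_of_pos hr])]
    exact ENNReal.ofReal_le_ofReal (hG.le_abs_iteratedDeriv _ hr _)

/-- The error bound for a kernel that is a mixture of decaying exponentials. -/
lemma exists_error_of_isExpMixture (K : Kernel d) (hd : 2 ≤ d) {lam : ℝ} (hlam : 0 < lam)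
    {G : ℝ → ℝ} (hG : IsExpMixture lam G) (hUG : ∀ z, z ≠ 0 → K.U z = G ‖z‖)
    (hU : ∀ z, z ≠ 0 → K.U z = ∫ t in Set.Ioi 0, Real.exp (-(lam ^ 2 * t)) * heat t z)
    {m : ℕ} {ρ : E d → ℝ} (hm : VanishingMoments m ρ) (hρ : ContDiff ℝ ∞ ρ)
    (hs : HasCompactSupport ρ) (hne : (tsupport ρ).Nonempty) :
    ∃ c : ℝ, 0 < c ∧ ∀ L : ℝ, 0 < L → tsupport ρ ⊆ box d L →
      0 < K.farField m ρ L ∧ ∀ x ∈ box d L,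
      ‖fullSum (fun k => 1 / (‖k‖ ^ 2 + lam ^ 2)) ρ L x - (conv K.U ρ x : ℂ)‖ₑ ≤
        ENNReal.ofReal c * K.farField m ρ L := by
  have hd0 : 0 < d := by omega
  have hd' : (2 : ℝ) ≤ d := by exact_mod_cast hd
  obtain ⟨y, hy, i, hL₁pos, hi⟩ :=
    exists_extremal_point_tsupport hd0 hρ.continuous hs hne
  set L₁ := |y i| with hL₁
  have hL₁0 : 0 ≤ L₁ := abs_nonneg _
  have hrep := isHeatRepresentation_exp hlam hU
  have hw : IsHeatWeight (d := d) _ _ := isHeatWeight_exp hlam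
  have hpow : ∀ n, 0 < lam ^ n := fun n => by positivity
  have hsub : tsupport ρ ⊆ box d L₁ := fun y' hy' j => abs_le.1 (hi y' hy' j)
  obtain ⟨C₁, hC₁, h1⟩ := exists_enorm_fullSum_sub_conv_le hlam hG hUG hrep hw hd0 hρ hs
    (integral_eq_zero_of_moments hm) hL₁0 hsub
  obtain ⟨C₂, hC₂, h2⟩ := hrep.exists_fullSum_sub_conv_le_rpow hw hd0 one_pos zero_le_one
    (fun t ht => by
      rw [sub_self, Real.rpow_zero, one_mul]
      exact Real.exp_le_one_iff.2 (neg_nonpos.2 (by positivity)))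
    (fun L => by simp) hm hρ hs (by linarith [Nat.cast_nonneg (α := ℝ) m]) (by simp)
  set q : ℝ := 2 * 1 - (d + m + 1) with hq
  have hq0 : q ≤ 0 := by
    have := Nat.cast_nonneg (α := ℝ) m
    rw [hq]
    linarith
  have hgpos := hG.pos (L₁ + 1) (by linarith)
  set g := lam ^ (m + 1) * G (L₁ + 1) with hg
  have hg0 : 0 < g := mul_pos (hpow _) hgpos
  have hc1 : 0 ≤ C₂ * L₁ ^ q / g := by positivity
  have hc2 : 0 ≤ C₁ / lam ^ (m + 1) := by positivity
  refine ⟨C₂ * L₁ ^ q / g + C₁ / lam ^ (m + 1) + 1, by positivity, fun L hL hLs => ?_⟩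
  obtain ⟨f1, f2⟩ := le_farField_of_isExpMixture K hG hUG m hy i (fun j => hi y hy j) hL
  refine ⟨lt_of_lt_of_le (ENNReal.ofReal_pos.2 (mul_pos (hpow _) (hG.pos L hL))) f1,
    fun x hx => ?_⟩
  have hLL₁ : L₁ ≤ L := abs_le.2 (hLs hy i)
  have key : ∀ a b : ℝ, 0 ≤ a → a ≤ C₂ * L₁ ^ q / g + C₁ / lam ^ (m + 1) + 1 →
      ENNReal.ofReal b ≤ K.farField m ρ L →
      ‖fullSum (fun k => 1 / (‖k‖ ^ 2 + lam ^ 2)) ρ L x - (conv K.U ρ x : ℂ)‖ₑ ≤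
        ENNReal.ofReal (a * b) →
      ‖fullSum (fun k => 1 / (‖k‖ ^ 2 + lam ^ 2)) ρ L x - (conv K.U ρ x : ℂ)‖ₑ ≤
        ENNReal.ofReal (C₂ * L₁ ^ q / g + C₁ / lam ^ (m + 1) + 1) * K.farField m ρ L := by
    intro a b ha hac hb h
    rw [ENNReal.ofReal_mul ha] at h
    exact h.trans (mul_le_mul' (ENNReal.ofReal_le_ofReal hac) hb)
  rcases le_total L (L₁ + 1) with hle | hle
  · refine key (C₂ * L₁ ^ q / g) g hc1 (by linarith) ((ENNReal.ofReal_le_ofReal ?_).trans f1) ?_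
    · have := hG.decay L (L₁ + 1 - L) hL (by linarith)
      rw [add_sub_cancel] at this
      refine mul_le_mul_of_nonneg_left (this.trans ?_) (hpow _).le
      refine mul_le_of_le_one_left (hG.pos L hL).le (Real.exp_le_one_iff.2 (neg_nonpos.2 ?_))
      exact mul_nonneg hlam.le (by linarith)
    · rw [div_mul_cancel₀ _ hg0.ne', ← ofReal_norm]
      refine ENNReal.ofReal_le_ofReal ((h2 L hL x hx).trans ?_)
      exact mul_le_mul_of_nonneg_left (Real.rpow_le_rpow_of_nonpos hL₁pos hLL₁ hq0) hC₂
  · refine key (C₁ / lam ^ (m + 1)) (lam ^ (m + 1) * G (L - L₁)) hc2 (by linarith)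
      (f2 (by linarith)) ?_
    rw [← mul_assoc, div_mul_cancel₀ _ (hpow _).ne']
    exact h1 L hle x hx

/-! ### The error of the midpoint rule -/

lemma Kernel.dim_pos (K : Kernel d) : 0 < d := by
  cases K <;> norm_num

lemma Kernel.exists_abs_symbol_node_le (K : Kernel d) {L : ℝ} (hL : 0 < L) :
    ∃ B : ℝ, ∀ p, |K.symbol (node L p)| ≤ B := by
  have hd := K.dim_pos
  have h : ∀ p : Fin d → ℤ, 0 < ‖node L p‖ ∧ ‖node L p‖⁻¹ ≤ L := fun p => by
    have h1 := (norm_node_ge hL hd p).1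
    have h2 : 0 < 1 / L := by positivity
    refine ⟨by linarith, ?_⟩
    rw [inv_le_comm₀ (by linarith) hL]
    simpa using h1
  have hn : ∀ (n : ℕ) (p : Fin d → ℤ), |1 / ‖node L p‖ ^ n| ≤ L ^ n := fun n p => by
    obtain ⟨h1, h2⟩ := h p
    rw [abs_of_nonneg (by positivity), one_div, ← inv_pow]
    gcongr
  have hy : ∀ (lam : ℝ), 0 < lam → ∀ p : Fin d → ℤ,
      |1 / (‖node L p‖ ^ 2 + lam ^ 2)| ≤ 1 / lam ^ 2 := fun lam hlam p => by
    rw [abs_of_nonneg (by positivity)]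
    gcongr
    exact le_add_of_nonneg_left (by positivity)
  cases K with
  | coulomb2 => exact ⟨L ^ 1, fun p => by simpa [Kernel.symbol] using hn 1 p⟩
  | poisson2 => exact ⟨L ^ 2, hn 2⟩
  | poisson3 => exact ⟨L ^ 2, hn 2⟩
  | biharmonic2 => exact ⟨L ^ 4, fun p => by rw [Kernel.symbol, abs_neg]; exact hn 4 p⟩
  | biharmonic3 => exact ⟨L ^ 4, fun p => by rw [Kernel.symbol, abs_neg]; exact hn 4 p⟩
  | yukawa2 lam hlam => exact ⟨_, hy lam hlam⟩
  | yukawa3 lam hlam => exact ⟨_, hy lam hlam⟩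
  | dipole3 a b ha hb =>
    refine ⟨4, fun p => ?_⟩
    obtain ⟨h1, -⟩ := h p
    set k := node L p
    have ka := abs_real_inner_le_norm k a
    have kb := abs_real_inner_le_norm k b
    have ab := abs_real_inner_le_norm a b
    rw [ha, hb, mul_one] at ab
    rw [ha, mul_one] at ka
    rw [hb, mul_one] at kb
    have h3 : |3 * inner ℝ k a * inner ℝ k b / ‖k‖ ^ 2| ≤ 3 := by
      rw [abs_div, abs_of_pos (by positivity : 0 < ‖k‖ ^ 2), div_le_iff₀ (by positivity), abs_mul,
        abs_mul, abs_of_pos (by norm_num : (0 : ℝ) < 3)]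
      calc 3 * |inner ℝ k a| * |inner ℝ k b| ≤ 3 * ‖k‖ * ‖k‖ := by gcongr
        _ = _ := by ring
    rw [Kernel.symbol]
    refine (abs_add_le _ _).trans ?_
    rw [abs_neg]
    linarith

lemma Kernel.enorm_fullSum_sub_midpoint_le (K : Kernel d) {ρ : E d → ℝ} (hρ : ContDiff ℝ ∞ ρ)
    (hs : HasCompactSupport ρ) {L : ℝ} (hL : 0 < L) (N : ℕ) (x : E d) :
    ‖fullSum K.symbol ρ L x - K.midpoint ρ L N x‖ₑ ≤ K.tail ρ L N := by
  obtain ⟨B, hB⟩ := K.exists_abs_symbol_node_le hL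
  have hsumm := summable_fullSum hρ hs hL K.dim_pos hB x
  have h := hsumm.sum_add_tsum_subtype_compl (indices d N)
  rw [fullSum, ← h, Kernel.midpoint, Finset.mul_sum, add_sub_cancel_left, Kernel.tail,
    ← ENNReal.tsum_mul_left]
  refine enorm_tsum_le_tsum_enorm.trans (ENNReal.tsum_le_tsum fun p => le_of_eq ?_)
  rw [enorm_mul, enorm_mul _ (Complex.exp _)]
  have e1 : ‖Complex.exp (Complex.I * (inner ℝ (node L p.1) x : ℝ))‖ₑ = 1 := by
    rw [← ofReal_norm, mul_comm, Complex.norm_exp_ofReal_mul_I, ENNReal.ofReal_one]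
  have e2 : ‖1 / (2 * (L : ℂ)) ^ d‖ₑ = ENNReal.ofReal (1 / (2 * L) ^ d) := by
    rw [← ofReal_norm, norm_div, norm_one, norm_pow, norm_mul, Complex.norm_real,
      Real.norm_of_nonneg hL.le, Complex.norm_ofNat]
  rw [e1, e2, mul_one]

lemma tendsto_indices_atTop : Filter.Tendsto (indices d) Filter.atTop Filter.atTop := by
  refine Filter.tendsto_atTop_finset_of_monotone (fun N N' h p hp => ?_) fun p => ?_
  · simp only [indices, Fintype.mem_piFinset, Finset.mem_Ico] at hp ⊢
    intro i
    have := hp i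
    have : N / 2 ≤ N' / 2 := Nat.div_le_div_right h
    omega
  · refine ⟨2 * (∑ i, (p i).natAbs + 1), ?_⟩
    simp only [indices, Fintype.mem_piFinset, Finset.mem_Ico]
    intro i
    have := Finset.single_le_sum (f := fun i => (p i).natAbs) (fun _ _ => Nat.zero_le _)
      (Finset.mem_univ i)
    omega

lemma Kernel.tendsto_tail (K : Kernel d) {ρ : E d → ℝ} (hρ : ContDiff ℝ ∞ ρ)
    (hs : HasCompactSupport ρ) {L : ℝ} (hL : 0 < L) :
    Filter.Tendsto (K.tail ρ L) Filter.atTop (nhds 0) := by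
  obtain ⟨B, hB⟩ := K.exists_abs_symbol_node_le hL
  have hsumm := summable_symbol_mul_fourier hρ hs hL K.dim_pos hB
  have h1 : ∑' p : Fin d → ℤ, ‖(K.symbol (node L p) : ℂ) * fourier ρ (node L p)‖ₑ ≠ ⊤ := by
    simp_rw [← ofReal_norm]
    exact hsumm.tsum_ofReal_ne_top
  have h2 := (ENNReal.tendsto_tsum_compl_atTop_zero h1).comp (tendsto_indices_atTop (d := d))
  have h3 := ENNReal.Tendsto.const_mul (a := ENNReal.ofReal (1 / (2 * L) ^ d)) h2
    (.inr ENNReal.ofReal_ne_top)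
  rw [mul_zero] at h3
  exact h3

/-- The error of the midpoint rule on the whole frequency space is controlled by the far field. -/
def Kernel.HasFarFieldBound (K : Kernel d) (m : ℕ) (ρ : E d → ℝ) : Prop :=
  ∃ c : ℝ, 0 < c ∧ ∀ L : ℝ, 0 < L → tsupport ρ ⊆ box d L →
    0 < K.farField m ρ L ∧ ∀ x ∈ box d L,
      ‖fullSum K.symbol ρ L x - (K.potential ρ x : ℂ)‖ₑ ≤ ENNReal.ofReal c * K.farField m ρ L

lemma Kernel.hasFarFieldBound_of_rate (K : Kernel d) {m : ℕ} {ρ : E d → ℝ} {Φ : ℝ → ℝ}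
    {L₀ : ℝ} (hsub : ∀ L, tsupport ρ ⊆ box d L → L₀ ≤ L)
    (hΦ : ∀ L, 0 < L → 0 < Φ L)
    (hup : ∃ C : ℝ, 0 ≤ C ∧ ∀ L, L₀ ≤ L → tsupport ρ ⊆ box d L → ∀ x ∈ box d L,
      ‖fullSum K.symbol ρ L x - (K.potential ρ x : ℂ)‖ ≤ C * Φ L)
    (hlow : ∃ c : ℝ, 0 < c ∧ ∀ L, 0 < L → ENNReal.ofReal (c * Φ L) ≤ K.farField m ρ L) :
    K.HasFarFieldBound m ρ := by
  obtain ⟨C, hC, hup⟩ := hup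
  obtain ⟨c, hc, hlow⟩ := hlow
  refine ⟨C / c + 1, by positivity, fun L hL hLs => ?_⟩
  have hf := hlow L hL
  have hΦL := hΦ L hL
  refine ⟨lt_of_lt_of_le (ENNReal.ofReal_pos.2 (by positivity)) hf, fun x hx => ?_⟩
  calc ‖fullSum K.symbol ρ L x - (K.potential ρ x : ℂ)‖ₑ
      ≤ ENNReal.ofReal ((C / c + 1) * (c * Φ L)) := by
        rw [← ofReal_norm]
        refine ENNReal.ofReal_le_ofReal ((hup L (hsub L hLs) hLs x hx).trans ?_)
        have e : (C / c + 1) * (c * Φ L) = C * Φ L + c * Φ L := by field_simp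
        rw [e]
        have : 0 < c * Φ L := by positivity
        linarith
    _ ≤ _ := by
        rw [ENNReal.ofReal_mul (by positivity)]
        gcongr

lemma Kernel.hasFarFieldBound (K : Kernel d) {m : ℕ} {ρ : E d → ℝ} (hm : VanishingMoments m ρ)
    (hρ : ContDiff ℝ ∞ ρ) (hs : HasCompactSupport ρ) (hne : (tsupport ρ).Nonempty) :
    K.HasFarFieldBound m ρ := by
  obtain ⟨y, hy, i, hi0, -⟩ := exists_extremal_point_tsupport K.dim_pos hρ.continuous hs hne
  have hsub : ∀ L, tsupport ρ ⊆ box d L → |y i| ≤ L := fun L hL => abs_le.2 (hL hy i)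
  have hpow : ∀ q L : ℝ, 0 < L → 0 < L ^ q := fun q L hL => by positivity
  cases K with
  | coulomb2 =>
    obtain ⟨C, hC, h⟩ := exists_error_coulomb hm hρ hs
    exact hasFarFieldBound_of_rate _ hsub (hpow _)
      ⟨C, hC, fun L hL _ => h L (hi0.trans_le hL)⟩ (exists_le_farField_coulomb m ρ hy)
  | poisson2 =>
    obtain ⟨C, hC, h⟩ := exists_error_poisson_two hm hρ hs
    exact hasFarFieldBound_of_rate _ hsub (hpow _)
      ⟨C, hC, fun L hL _ => h L (hi0.trans_le hL)⟩ (exists_le_farField_poisson_two m ρ hy)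
  | poisson3 =>
    obtain ⟨C, hC, h⟩ := exists_error_poisson_three hm hρ hs
    exact hasFarFieldBound_of_rate _ hsub (hpow _)
      ⟨C, hC, fun L hL _ => h L (hi0.trans_le hL)⟩ (exists_le_farField_poisson_three m ρ hy)
  | biharmonic2 =>
    rcases le_or_gt m 1 with h1 | h1
    · obtain ⟨C, hC, h⟩ := exists_error_biharmonic_two_of_le_one hm hρ hs h1 hi0
      exact hasFarFieldBound_of_rate _ hsub
        (Φ := fun L => L ^ (1 - m : ℝ) * (1 + |Real.log L|)) (fun L hL => by positivity)
        ⟨C, hC, fun L hL _ => h L hL⟩ (exists_le_farField_biharmonic_two_of_le_one h1 ρ hy)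
    · obtain ⟨C, hC, h⟩ := exists_error_biharmonic_two_of_two_le hm hρ hs h1
      exact hasFarFieldBound_of_rate _ hsub (hpow _)
        ⟨C, hC, fun L hL _ => h L (hi0.trans_le hL)⟩
        (exists_le_farField_biharmonic_two_of_two_le h1 ρ hy)
  | biharmonic3 =>
    obtain ⟨C, hC, h⟩ := exists_error_biharmonic_three hm hρ hs hi0
    exact hasFarFieldBound_of_rate _ hsub (hpow _)
      ⟨C, hC, fun L hL _ => h L hL⟩ (exists_le_farField_biharmonic_three m ρ hy)
  | yukawa2 lam hlam =>
    exact exists_error_of_isExpMixture (.yukawa2 lam hlam) le_rfl hlam (isExpMixture_besselK0 hlam)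
      (fun z _ => rfl) (fun z hz => yukawa_two_eq_integral hlam hz) hm hρ hs hne
  | yukawa3 lam hlam =>
    exact exists_error_of_isExpMixture (.yukawa3 lam hlam) (by norm_num) hlam
      (isExpMixture_exp_div hlam) (fun z hz => exp_div_eq_mgf (norm_pos_iff.2 hz))
      (fun z hz => yukawa_three_eq_integral hlam hz) hm hρ hs hne
  | dipole3 a b ha hb =>
    obtain ⟨C, hC, h⟩ := exists_error_dipole ha hb hm hρ hs
    exact hasFarFieldBound_of_rate _ hsub (hpow _)
      ⟨C, hC, fun L hL hLs => h L (hi0.trans_le hL) hLs⟩ (exists_le_farField_dipole ha hb m ρ hy)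

lemma Kernel.error_le_add_tail (K : Kernel d) {ρ : E d → ℝ} (hρ : ContDiff ℝ ∞ ρ)
    (hs : HasCompactSupport ρ) {L : ℝ} (hL : 0 < L) {b : ℝ≥0∞}
    (hb : ∀ x ∈ box d L, ‖fullSum K.symbol ρ L x - (K.potential ρ x : ℂ)‖ₑ ≤ b) (N : ℕ) :
    K.error ρ L N ≤ b + K.tail ρ L N := by
  refine iSup₂_le fun x hx => ?_
  have e : (K.potential ρ x : ℂ) - K.midpoint ρ L N x =
      -(fullSum K.symbol ρ L x - (K.potential ρ x : ℂ)) +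
        (fullSum K.symbol ρ L x - K.midpoint ρ L N x) := by ring
  rw [e]
  refine (enorm_add_le _ _).trans (add_le_add ?_ (K.enorm_fullSum_sub_midpoint_le hρ hs hL N x))
  rw [enorm_neg]
  exact hb x hx

lemma Kernel.error_zero (K : Kernel d) (L : ℝ) (N : ℕ) : K.error (fun _ => 0) L N = 0 := by
  have h1 : ∀ x, K.potential (fun _ => 0) x = 0 := fun x => by
    have h2 : ∀ U : E d → ℝ, conv U (fun _ => 0) x = 0 := fun U => by simp [conv]
    cases K with
    | dipole3 a b ha hb => simp [Kernel.potential, conv, lineDeriv]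
    | _ => exact h2 _
  simp [Kernel.error, h1, Kernel.midpoint, fourier]

end FSMM

end

theorem theorem3 {d : ℕ} (K : FSMM.Kernel d) (m : ℕ) (ρ : FSMM.E d → ℝ)
    (hρ : ContDiff ℝ ∞ ρ) (hsupp : HasCompactSupport ρ)
    (hmom : FSMM.VanishingMoments m ρ) :
    ∃ c : ℝ, 0 < c ∧ ∀ L : ℝ, 0 < L → tsupport ρ ⊆ FSMM.box d L →
      (∃ N₀ : ℕ, ∀ N : ℕ, N₀ ≤ N → 0 < N → Even N →
        K.error ρ L N ≤ ENNReal.ofReal c * K.farField m ρ L) ∧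
      (∀ N : ℕ, 0 < N → Even N →
        K.error ρ L N ≤ ENNReal.ofReal c * K.farField m ρ L + K.tail ρ L N) := by
  rcases Set.eq_empty_or_nonempty (tsupport ρ) with hemp | hne
  · obtain rfl : ρ = fun _ => 0 := tsupport_eq_empty_iff.1 hemp
    refine ⟨1, one_pos, fun L _ _ => ⟨⟨0, fun N _ _ _ => ?_⟩, fun N _ _ => ?_⟩⟩ <;>
      · rw [K.error_zero]
        exact zero_le
  · obtain ⟨c, hc, h⟩ := K.hasFarFieldBound hmom hρ hsupp hne
    refine ⟨c + 1, by linarith, fun L hL hsub => ?_⟩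
    obtain ⟨hpos, hb⟩ := h L hL hsub
    have herr := K.error_le_add_tail hρ hsupp hL hb
    have hle : ENNReal.ofReal c * K.farField m ρ L ≤
        ENNReal.ofReal (c + 1) * K.farField m ρ L := by
      gcongr
      linarith
    refine ⟨?_, fun N _ _ => (herr N).trans (by gcongr)⟩
    obtain ⟨N₀, hN₀⟩ := Filter.eventually_atTop.1
      ((K.tendsto_tail hρ hsupp hL).eventually (gt_mem_nhds hpos))
    refine ⟨N₀, fun N hN _ _ => (herr N).trans ?_⟩
    rw [ENNReal.ofReal_add hc.le zero_le_one, ENNReal.ofReal_one, add_mul, one_mul]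
    gcongr
    exact (hN₀ N hN).le
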